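/- **Theorem (semidiscrete error estimate).** *Setting.* Let $L>0$, let $\mu,\Lambda\in C^4[0,L]$ be strictly positive, and let $M,J>0$. For $j=1,2$ let $A_j\in\mathbb R^{n\times n}$ be Hurwitz, $b_j,c_j\in\mathbb R^n$, $k_j>0$, and $d_j\ge\delta_j>0$ with $\operatorname{Re}\bigl((i\omega I-A_j)^{-1}b_j\cdot c_j+d_j\bigr)\ge d_j$ for all $\omega\ge 0$. Let $P_j$ be symmetric positive definite such that, for some $\varepsilon_j>0$ and $q_j\in\mathbb R^n$, $$P_jA_j+A_j^\top P_j=-q_jq_j^\top-\varepsilon_jP_j,\qquad P_jb_j=c_j-\sqrt{2(d_j-\delta_j)}\,q_j .$$ For $k\ge2$ put $\tilde H^k_0(0,L)=\{u\in H^k(0,L): u(0)=u_x(0)=0\}$. Let $H=\mathbb R\times\mathbb R\times L^2(0,L)$ with inner product $(\varphi,\nu)_H=J\varphi^1\nu^1+M\varphi^2\nu^2+\int_0^L\mu\varphi^3\nu^3\,dx$, write $\hat w=(w_x(L),w(L),w)$ for $w\in\tilde H^2_0(0,L)$, and let $V=\{\hat w: w\in\tilde H^2_0(0,L)\}\subset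 H\subset V'$. Set $$a(\hat u,\hat w)=\int_0^L\Lambda u_{xx}w_{xx}\,dx+k_1u_x(L)w_x(L)+k_2u(L)w(L),\qquad b(\varphi,\nu)=d_1\varphi^1\nu^1+d_2\varphi^2\nu^2 .$$ *Weak solution.* Let $T>0$. A triple $(u,\zeta_1,\zeta_2)$ with $\hat u\in L^2(0,T;V)\cap H^1(0,T;H)\cap H^2(0,T;V')$ and $\zeta_j\in H^1(0,T;\mathbb R^n)$, attaining some initial data $\hat u(0)=\hat u_0\in V$, $\hat u_t(0)=\hat v_0\in H$, $\zeta_j(0)=\zeta_{j,0}\in\mathbb R^n$, is a weak solution if for a.e. $t\in(0,T)$ and all $w\in\tilde H^2_0(0,L)$ $$\langle\hat u_{tt},\hat w\rangle_{V',V}+a(\hat u,\hat w)+b(\hat u_t,\hat w)+c_1\cdot\zeta_1\,w_x(L)+c_2\cdot\zeta_2\,w(L)=0,$$ $$(\zeta_1)_t=A_1\zeta_1+b_1\,(\hat u_t)^1,\qquad (\zeta_2)_t=A_2\zeta_2+b_2\,(\hat u_t)^2 ;$$ continuous representatives in time are used. *Semidiscrete solution.* For $N\ge1$ let $h=L/N$,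 $x_m=mh$, and let $W_h\subset\tilde H^2_0(0,L)$ be the space of Hermite cubic finite elements (continuously differentiable, cubic on each $[x_{m-1},x_m]$, with vanishing value and slope at $0$). A semidiscrete solution is a triple $u_h\in C^2([0,\infty);W_h)$, $\tilde\zeta_1,\tilde\zeta_2\in C^1([0,\infty);\mathbb R^n)$ with arbitrary initial data such that for all $t>0$ and $w\in W_h$ $$((\hat u_h)_{tt},\hat w)_H+a(\hat u_h,\hat w)+b((\hat u_h)_t,\hat w)+c_1\cdot\tilde\zeta_1\,w_x(L)+c_2\cdot\tilde\zeta_2\,w(L)=0,$$ $$(\tilde\zeta_1)_t=A_1\tilde\zeta_1+b_1\,(u_h)_{xt}(t,L),\qquad (\tilde\zeta_2)_t=A_2\tilde\zeta_2+b_2\,(u_h)_t(t,L).$$ *Energy.* For a trajectory $(u,\zeta_1,\zeta_2)$ let $$E(t;u,\zeta_1,\zeta_2)=\tfrac12\int_0^L(\Lambda u_{xx}^2+\mu u_t^2)\,dx+\tfrac M2u_t(t,L)^2+\tfrac J2u_{xt}(t,L)^2+\tfrac{k_1}2u_x(t,L)^2+\tfrac{k_2}2u(t,L)^2+\tfrac12\sum_{j=1}^2\zeta_j^\top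 P_j\zeta_j .$$ *Claim.* There is a constant $C>0$, depending only on $T$ and on the data $L,\mu,\Lambda,M,J,A_j,b_j,c_j,d_j,\delta_j,k_j,P_j$ (not on $h$ or on the solutions), such that the following holds. Let $(u,\zeta_1,\zeta_2)$ be a weak solution with $$u\in C([0,T];\tilde H^4_0(0,L)),\quad u_t\in L^2(0,T;\tilde H^4_0(0,L)),\quad u_{tt}\in L^2(0,T;\tilde H^2_0(0,L)),$$ let $(u_h,\tilde\zeta_1,\tilde\zeta_2)$ be a semidiscrete solution with mesh size $h$, and let $\tilde u(t)\in W_h$ be the nodal Hermite projection of $u(t)$, i.e. $\tilde u(t,x_m)=u(t,x_m)$ and $\tilde u_x(t,x_m)=u_x(t,x_m)$ for $m=1,\dots,N$. Then $u$ is differentiable in time on $[0,T]$ (one-sidedly at the endpoints) as a function with values in $\tilde H^2_0(0,L)$, and for all $t\in[0,T]$ $$E(t;u_h-u,\tilde\zeta_1-\zeta_1,\tilde\zeta_2-\zeta_2)^{1/2}\le C\Bigl(E(0;u_h-\tilde u,\tilde\zeta_1-\zeta_1,\tilde\zeta_2-\zeta_2)^{1/2}+h^2\bigl(\|u_{tt}\|_{L^2(0,T;H^2(0,L))}+\|u_t\|_{L^2(0,T;H^4(0,L))}+\|u\|_{C([0,T];H^4(0,L))}\bigr)\Bigr).$$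 -/

import Mathlib

open MeasureTheory Set Topology
open scoped ContDiff

noncomputable section

namespace BeamFEM

/-! ### Weak derivatives and Sobolev spaces on an interval -/

/-- `g` is the weak (distributional) derivative of `f` on `(0, ℓ)`, for functions with values in a
(complete) normed space: `∫ φ' f = - ∫ φ g` for all `φ ∈ C_c^∞((0, ℓ))`.
Used both for derivatives in `x ∈ (0, L)` and in `t ∈ (0, T)`. -/
def HasWeakDeriv {X : Type*} [NormedAddCommGroup X] [NormedSpace ℝ X] (ℓ : ℝ) (f g : ℝ → X) :
    Prop :=
  ∀ φ : ℝ → ℝ, ContDiff ℝ ∞ φ → HasCompactSupport φ → tsupport φ ⊆ Ioo 0 ℓ →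
    ∫ s in Ioo 0 ℓ, deriv φ s • f s = -∫ s in Ioo 0 ℓ, φ s • g s

/-- Lebesgue measure on the open interval `(0, ℓ)`. -/
abbrev vol (ℓ : ℝ) : Measure ℝ := volume.restrict (Ioo 0 ℓ)

/-- The Hilbert space `L²(0, L)`. -/
abbrev L2 (L : ℝ) : Type := Lp ℝ 2 (vol L)

/-- The space of all `(k+1)`-tuples of elements of `L²(0, L)`, with the Hilbert norm
`(∑ i, ‖f i‖²)^{1/2}`. -/
abbrev Jet (k : ℕ) (L : ℝ) : Type := PiLp 2 (fun _ : Fin (k + 1) => L2 L)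

lemma memLp_of_bdd {L : ℝ} {ψ : ℝ → ℝ} (hm : Measurable ψ) {C : ℝ}
    (hb : ∀ x ∈ Ioo 0 L, |ψ x| ≤ C) : MemLp ψ 2 (vol L) := by
  refine MemLp.of_bound hm.aestronglyMeasurable C ?_
  filter_upwards [ae_restrict_mem measurableSet_Ioo] with x hx using hb x hx

lemma memLp_of_cont {L : ℝ} {ψ : ℝ → ℝ} (h : Continuous ψ) : MemLp ψ 2 (vol L) := by
  obtain ⟨C, hC⟩ := (isCompact_Icc (a := (0 : ℝ)) (b := L)).exists_bound_of_continuousOn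
    h.continuousOn
  exact memLp_of_bdd h.measurable (C := C) fun x hx => hC x (Ioo_subset_Icc_self hx)

/-- Integration of an `L²` function against a fixed `L²` weight. -/
def pair {L : ℝ} {ψ : ℝ → ℝ} (h : MemLp ψ 2 (vol L)) : L2 L →L[ℝ] ℝ := innerSL ℝ (h.toLp ψ)

lemma pair_apply {L : ℝ} {ψ : ℝ → ℝ} (h : MemLp ψ 2 (vol L)) (f : L2 L) :
    pair h f = ∫ s in Ioo 0 L, ψ s • f s := by
  rw [pair, innerSL_apply_apply, MeasureTheory.L2.inner_def]
  refine integral_congr_ae ?_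
  filter_upwards [h.coeFn_toLp] with x hx
  simp [hx, mul_comm]

lemma hasWeakDeriv_iff {L : ℝ} (f g : L2 L) : HasWeakDeriv L f g ↔
    ∀ φ : ℝ → ℝ, ∀ h : ContDiff ℝ ∞ φ, HasCompactSupport φ → tsupport φ ⊆ Ioo 0 L →
      pair (memLp_of_cont (L := L) (h.continuous_deriv (by simp))) f
        + pair (memLp_of_cont (L := L) h.continuous) g = 0 := by
  unfold HasWeakDeriv
  simp only [pair_apply, ← eq_neg_iff_add_eq_zero]

/-- The Sobolev space `H^k(0, L)`: an element is the tuple `(u, u', …, u^{(k)})` of an `L²`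
function and its weak derivatives, and its norm is `(∑_{i ≤ k} ‖u^{(i)}‖²_{L²})^{1/2}`. -/
def Sob (k : ℕ) (L : ℝ) : Submodule ℝ (Jet k L) where
  carrier := {u | ∀ i : Fin k, HasWeakDeriv L (u i.castSucc) (u i.succ)}
  zero_mem' := by
    intro i
    rw [hasWeakDeriv_iff]
    intros
    simp
  add_mem' := by
    intro u v hu hv i
    have hu := (hasWeakDeriv_iff _ _).1 (hu i)
    have hv := (hasWeakDeriv_iff _ _).1 (hv i)
    rw [hasWeakDeriv_iff]
    intro φ h h1 h2
    have a := hu φ h h1 h2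
    have b := hv φ h h1 h2
    simp only [PiLp.add_apply, map_add]
    linarith
  smul_mem' := by
    intro c u hu i
    have hu := (hasWeakDeriv_iff _ _).1 (hu i)
    rw [hasWeakDeriv_iff]
    intro φ h h1 h2
    have a := hu φ h h1 h2
    simp only [PiLp.smul_apply, map_smul, smul_eq_mul, ← mul_add, a, mul_zero]

lemma isClosed_Sob (k : ℕ) (L : ℝ) : IsClosed (Sob k L : Set (Jet k L)) := by
  have : (Sob k L : Set (Jet k L)) = ⋂ (i : Fin k) (φ : ℝ → ℝ) (h : ContDiff ℝ ∞ φ)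
      (_ : HasCompactSupport φ) (_ : tsupport φ ⊆ Ioo 0 L),
      {u | pair (memLp_of_cont (L := L) (h.continuous_deriv (by simp))) (u i.castSucc)
        + pair (memLp_of_cont (L := L) h.continuous) (u i.succ) = 0} := by
    ext u
    simp only [mem_iInter, mem_ofPred_eq]
    exact forall_congr' fun i => hasWeakDeriv_iff _ _
  rw [this]
  refine isClosed_iInter fun i => isClosed_iInter fun φ => isClosed_iInter fun h =>
    isClosed_iInter fun _ => isClosed_iInter fun _ => isClosed_eq ?_ continuous_const
  fun_prop

/-- Point value at `x ∈ [0, L]` of the continuous representative of `f`, where `g = f'` weakly: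
the average over `y ∈ (0, L)` of `f(y) + ∫_y^x g`. -/
def pointVal {L : ℝ} (f g : L2 L) (x : ℝ) : ℝ :=
  (1 / L) * ∫ y in Ioo 0 L, (f y + ∫ s in y..x, g s)

lemma integrable_L2 {L : ℝ} (f : L2 L) : Integrable f (vol L) :=
  (Lp.memLp f).integrable (by norm_num)

lemma ii_L2 {L : ℝ} (g : L2 L) {a b : ℝ} (ha : a ∈ Icc 0 L) (hb : b ∈ Icc 0 L) :
    IntervalIntegrable g volume a b := by
  have h : IntegrableOn g (Icc 0 L) := by
    rw [integrableOn_Icc_iff_integrableOn_Ioo]; exact integrable_L2 g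
  rw [intervalIntegrable_iff]
  exact h.mono_set (uIoc_subset_uIcc.trans (uIcc_subset_Icc ha hb))

lemma cont_prim {L : ℝ} (g : L2 L) {x : ℝ} (hx : x ∈ Icc 0 L) :
    ContinuousOn (fun y => ∫ s in y..x, g s) (Icc 0 L) := by
  have h : IntegrableOn g (Icc 0 L) := by
    rw [integrableOn_Icc_iff_integrableOn_Ioo]; exact integrable_L2 g
  have hL : (0 : ℝ) ≤ L := hx.1.trans hx.2
  have := (intervalIntegral.continuousOn_primitive_interval' (μ := volume) (f := g) (a := x)
    (b₁ := 0) (b₂ := L) (by rw [intervalIntegrable_iff_integrableOn_Icc_of_le hL]; exact h)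
    (by rw [uIcc_of_le hL]; exact hx))
  rw [uIcc_of_le hL] at this
  refine this.neg.congr fun y _ => ?_
  exact intervalIntegral.integral_symm _ _

lemma integrable_prim {L : ℝ} (g : L2 L) {x : ℝ} (hx : x ∈ Icc 0 L) :
    Integrable (fun y => ∫ s in y..x, g s) (vol L) :=
  ((cont_prim g hx).integrableOn_Icc).mono_set Ioo_subset_Icc_self

lemma integrable_add_prim {L : ℝ} (f g : L2 L) {x : ℝ} (hx : x ∈ Icc 0 L) :
    Integrable (fun y => f y + ∫ s in y..x, g s) (vol L) :=
  (integrable_L2 f).add (integrable_prim g hx)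

lemma ae_L2 {L : ℝ} {p : ℝ → Prop} (h : ∀ᵐ s ∂(vol L), p s) {a b : ℝ} (ha : a ∈ Icc 0 L)
    (hb : b ∈ Icc 0 L) : ∀ᵐ s ∂volume, s ∈ uIoc a b → p s := by
  have h1 : ∀ᵐ s ∂(volume.restrict (Icc 0 L)), p s := by
    rw [← restrict_Ioo_eq_restrict_Icc]; exact h
  rw [ae_restrict_iff' measurableSet_Icc] at h1
  filter_upwards [h1] with s hs hs'
  exact hs (uIcc_subset_Icc ha hb (uIoc_subset_uIcc hs'))

lemma pointVal_add {L : ℝ} (f g f' g' : L2 L) {x : ℝ} (hx : x ∈ Icc 0 L) :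
    pointVal (f + f') (g + g') x = pointVal f g x + pointVal f' g' x := by
  rw [pointVal, pointVal, pointVal, ← mul_add,
    ← integral_add (integrable_add_prim f g hx) (integrable_add_prim f' g' hx)]
  congr 1
  refine integral_congr_ae ?_
  filter_upwards [Lp.coeFn_add f f', ae_restrict_mem measurableSet_Ioo] with y hy hy'
  have hy' := Ioo_subset_Icc_self hy'
  have : ∫ s in y..x, (g + g' : L2 L) s = ∫ s in y..x, (g s + g' s) := by
    refine intervalIntegral.integral_congr_ae (ae_L2 (L := L) ?_ hy' hx)
    filter_upwards [Lp.coeFn_add g g'] with s hs using hs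
  rw [hy, this, intervalIntegral.integral_add (ii_L2 g hy' hx) (ii_L2 g' hy' hx)]
  simp only [Pi.add_apply]
  ring

lemma pointVal_smul {L : ℝ} (c : ℝ) (f g : L2 L) {x : ℝ} (hx : x ∈ Icc 0 L) :
    pointVal (c • f) (c • g) x = c * pointVal f g x := by
  rw [pointVal, pointVal, mul_left_comm, ← integral_const_mul c]
  congr 1
  refine integral_congr_ae ?_
  filter_upwards [Lp.coeFn_smul c f, ae_restrict_mem measurableSet_Ioo] with y hy hy'
  have hy' := Ioo_subset_Icc_self hy'
  have : ∫ s in y..x, (c • g : L2 L) s = ∫ s in y..x, c * g s := by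
    refine intervalIntegral.integral_congr_ae (ae_L2 (L := L) ?_ hy' hx)
    filter_upwards [Lp.coeFn_smul c g] with s hs using hs
  rw [hy, this, intervalIntegral.integral_const_mul]
  simp only [Pi.smul_apply, smul_eq_mul]
  ring

/-- Point evaluation as a linear map in the pair `(f, g)`. -/
def pointValL {L : ℝ} {x : ℝ} (hx : x ∈ Icc 0 L) : L2 L × L2 L →ₗ[ℝ] ℝ where
  toFun p := pointVal p.1 p.2 x
  map_add' _ _ := pointVal_add _ _ _ _ hx
  map_smul' c _ := pointVal_smul c _ _ hx

lemma integral_abs_L2 {L : ℝ} (f : L2 L) :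
    ∫ y in Ioo 0 L, |f y| ≤ ((vol L).real univ + 1) * ‖f‖ := by
  set m := (vol L).real univ
  have hm : 0 ≤ m := measureReal_nonneg
  have h := norm_inner_le_norm (𝕜 := ℝ)
    ((memLp_const (1 : ℝ) : MemLp (fun _ => (1 : ℝ)) 2 (vol L)).toLp _) |f|
  rw [MeasureTheory.L2.inner_def] at h
  have e : ∫ a in Ioo 0 L, inner ℝ (((memLp_const (1 : ℝ) :
      MemLp (fun _ => (1 : ℝ)) 2 (vol L)).toLp _) a) ((|f| : L2 L) a)
      = ∫ y in Ioo 0 L, |f y| := by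
    refine integral_congr_ae ?_
    filter_upwards [Lp.coeFn_abs f, (memLp_const (1 : ℝ) :
      MemLp (fun _ => (1 : ℝ)) 2 (vol L)).coeFn_toLp] with y h1 h2
    rw [h1, h2]; simp
  rw [e] at h
  have h3 : ‖(memLp_const (1 : ℝ) : MemLp (fun _ => (1 : ℝ)) 2 (vol L)).toLp _‖ ≤ m + 1 := by
    have h4 := MeasureTheory.L2.inner_def (𝕜 := ℝ) ((memLp_const (1 : ℝ) :
      MemLp (fun _ => (1 : ℝ)) 2 (vol L)).toLp _) ((memLp_const (1 : ℝ) :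
      MemLp (fun _ => (1 : ℝ)) 2 (vol L)).toLp _)
    rw [real_inner_self_eq_norm_sq] at h4
    have h5 : ∫ a in Ioo 0 L, inner ℝ (((memLp_const (1 : ℝ) :
        MemLp (fun _ => (1 : ℝ)) 2 (vol L)).toLp _) a) (((memLp_const (1 : ℝ) :
        MemLp (fun _ => (1 : ℝ)) 2 (vol L)).toLp _) a) = ∫ _y in Ioo 0 L, (1 : ℝ) := by
      refine integral_congr_ae ?_
      filter_upwards [(memLp_const (1 : ℝ) :
        MemLp (fun _ => (1 : ℝ)) 2 (vol L)).coeFn_toLp] with y h2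
      rw [h2]; simp
    rw [h5, integral_const, smul_eq_mul, mul_one] at h4
    refine (abs_le_of_sq_le_sq' ?_ (by positivity)).2
    rw [h4]
    change m ≤ _
    nlinarith
  calc _ ≤ abs (∫ y in Ioo 0 L, |f y|) := le_abs_self _
    _ ≤ _ := h
    _ ≤ _ := by
      rw [norm_abs_eq_norm]
      gcongr

lemma continuous_pointValL {L : ℝ} {x : ℝ} (hx : x ∈ Icc 0 L) :
    Continuous (pointValL (L := L) hx) := by
  set m := (vol L).real univ with hmd
  have hm : 0 ≤ m := measureReal_nonneg
  refine (LinearMap.mkContinuous (pointValL hx)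
    (|1 / L| * ((m + 1) + (m + 1) * m)) fun p => ?_).continuous
  change ‖pointVal p.1 p.2 x‖ ≤ _
  rw [pointVal, norm_mul, Real.norm_eq_abs, mul_assoc]
  gcongr
  have hb : ∀ᵐ y ∂(vol L), ‖∫ s in y..x, p.2 s‖ ≤ (m + 1) * ‖p‖ := by
    filter_upwards [ae_restrict_mem measurableSet_Ioo] with y hy
    have hy := Ioo_subset_Icc_self hy
    refine (intervalIntegral.norm_integral_le_integral_norm_uIoc).trans ?_
    have : ∫ s in uIoc y x, ‖p.2 s‖ ≤ ∫ s in Icc 0 L, ‖p.2 s‖ := by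
      refine setIntegral_mono_set ?_ (ae_of_all _ fun _ => norm_nonneg _)
        (LE.le.eventuallyLE (uIoc_subset_uIcc.trans (uIcc_subset_Icc hy hx)))
      refine Integrable.norm ?_
      rw [← restrict_Ioo_eq_restrict_Icc]
      exact integrable_L2 _
    refine this.trans ?_
    rw [← restrict_Ioo_eq_restrict_Icc]
    refine (integral_abs_L2 p.2).trans ?_
    gcongr
    exact norm_snd_le p
  calc ‖∫ y in Ioo 0 L, (p.1 y + ∫ s in y..x, p.2 s)‖
      ≤ ‖∫ y in Ioo 0 L, p.1 y‖ + ‖∫ y in Ioo 0 L, ∫ s in y..x, p.2 s‖ := by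
        rw [integral_add (integrable_L2 _) (integrable_prim _ hx)]
        exact norm_add_le _ _
    _ ≤ (m + 1) * ‖p‖ + (m + 1) * ‖p‖ * m := by
        gcongr
        · refine (norm_integral_le_integral_norm _).trans ((integral_abs_L2 p.1).trans ?_)
          gcongr
          exact norm_fst_le p
        · exact norm_integral_le_of_norm_le_const hb
    _ = _ := by ring

/-- The space `H̃^k_0(0, L) = {u ∈ H^k(0, L) | u(0) = u_x(0) = 0}` for `k ≥ 2`, with the `H^k` norm
(the indices `0, 1, 2` are taken in `Fin (k + 1)`). -/
def HTilde (k : ℕ) (L : ℝ) (hL : 0 < L) : Submodule ℝ (Jet k L) where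
  carrier := {u | u ∈ Sob k L ∧ pointVal (u 0) (u 1) 0 = 0 ∧ pointVal (u 1) (u 2) 0 = 0}
  zero_mem' := by
    have h := (pointValL (L := L) (left_mem_Icc.2 hL.le)).map_zero
    exact ⟨zero_mem _, h, h⟩
  add_mem' := by
    rintro u v ⟨hu, hu1, hu2⟩ ⟨hv, hv1, hv2⟩
    refine ⟨add_mem hu hv, ?_, ?_⟩ <;>
    · simp only [PiLp.add_apply]
      rw [pointVal_add _ _ _ _ (left_mem_Icc.2 hL.le)]
      simp only [hu1, hu2, hv1, hv2, add_zero]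
  smul_mem' := by
    rintro c u ⟨hu, hu1, hu2⟩
    refine ⟨Submodule.smul_mem _ c hu, ?_, ?_⟩ <;>
    · simp only [PiLp.smul_apply]
      rw [pointVal_smul _ _ _ (left_mem_Icc.2 hL.le)]
      simp only [hu1, hu2, mul_zero]

lemma isClosed_HTilde (k : ℕ) (L : ℝ) (hL : 0 < L) :
    IsClosed (HTilde k L hL : Set (Jet k L)) := by
  have h0 := left_mem_Icc.2 hL.le
  refine (isClosed_Sob k L).inter ((isClosed_eq (f := fun u : Jet k L =>
    pointValL h0 (u 0, u 1)) ?_ continuous_const).inter (isClosed_eq (f := fun u : Jet k L =>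
    pointValL h0 (u 1, u 2)) ?_ continuous_const)) <;>
  · have := continuous_pointValL h0
    fun_prop

instance (k : ℕ) (L : ℝ) (hL : 0 < L) : CompleteSpace (HTilde k L hL) :=
  (isClosed_HTilde k L hL).completeSpace_coe


lemma hasWeakDeriv_of_right {L : ℝ} (hL : 0 < L) {f g : ℝ → ℝ} (hf : Continuous f)
    (hd : ∀ x, HasDerivWithinAt f (g x) (Ioi x) x) (hg : MemLp g 2 (vol L)) :
    HasWeakDeriv L f g := by
  intro φ hφ _ hs
  have hgi : IntervalIntegrable g volume 0 L := by
    rw [intervalIntegrable_iff_integrableOn_Ioo_of_le hL.le]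
    exact hg.integrable (by norm_num)
  have hv : ∀ x, x ∉ Ioo 0 L → φ x = 0 := fun x hx =>
    image_eq_zero_of_notMem_tsupport fun h => hx (hs h)
  have hφd : ∀ x, HasDerivAt φ (deriv φ x) x := fun x =>
    (hφ.differentiable (by simp) x).hasDerivAt
  have h := intervalIntegral.integral_mul_deriv_eq_deriv_mul_of_hasDeriv_right
    (a := 0) (b := L) (u := φ) (v := f) (u' := deriv φ) (v' := g)
    hφ.continuous.continuousOn hf.continuousOn (fun x _ => (hφd x).hasDerivWithinAt)
    (fun x _ => hd x) ((hφ.continuous_deriv (by simp)).intervalIntegrable _ _) hgi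
  rw [hv 0 (by simp), hv L (by simp)] at h
  simp only [intervalIntegral.integral_of_le hL.le, integral_Ioc_eq_integral_Ioo] at h
  simp only [smul_eq_mul]
  linarith

lemma pointVal_of_right {L : ℝ} (hL : 0 < L) {f g : ℝ → ℝ} (hf : Continuous f)
    (hd : ∀ x, HasDerivWithinAt f (g x) (Ioi x) x) (hf' : MemLp f 2 (vol L))
    (hg : MemLp g 2 (vol L)) {x : ℝ} (hx : x ∈ Icc 0 L) :
    pointVal (hf'.toLp f) (hg.toLp g) x = f x := by
  have e : ∫ y in Ioo 0 L, (hf'.toLp f y + ∫ s in y..x, hg.toLp g s)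
      = ∫ _y in Ioo 0 L, f x := by
    refine integral_congr_ae ?_
    filter_upwards [hf'.coeFn_toLp, ae_restrict_mem measurableSet_Ioo] with y hy hy'
    have hy' := Ioo_subset_Icc_self hy'
    have h1 : ∫ s in y..x, hg.toLp g s = ∫ s in y..x, g s :=
      intervalIntegral.integral_congr_ae (ae_L2 hg.coeFn_toLp hy' hx)
    have hgi : IntervalIntegrable g volume y x :=
      (ii_L2 (hg.toLp g) hy' hx).congr_ae
        ((ae_restrict_iff' measurableSet_uIoc).2 (ae_L2 hg.coeFn_toLp hy' hx))
    rw [hy, h1, intervalIntegral.integral_eq_sub_of_hasDeriv_right hf.continuousOn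
      (fun z _ => hd z) hgi]
    ring
  rw [pointVal, e]
  simp [hL.le, hL.ne']

/-- The element of `H̃²_0(0, L)` given by a continuously differentiable function `f` on `ℝ` with
`f(0) = f'(0) = 0` whose derivative `f₁` has the square integrable right derivative `f₂`. -/
def mkHTilde {L : ℝ} (hL : 0 < L) (f f₁ f₂ : ℝ → ℝ) (hf : Continuous f) (hf₁ : Continuous f₁)
    (hf₂ : MemLp f₂ 2 (vol L)) (hd : ∀ x, HasDerivWithinAt f (f₁ x) (Ioi x) x)
    (hd₁ : ∀ x, HasDerivWithinAt f₁ (f₂ x) (Ioi x) x) (h0 : f 0 = 0) (h1 : f₁ 0 = 0) :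
    HTilde 2 L hL :=
  ⟨WithLp.toLp 2 ![(memLp_of_cont hf).toLp f, (memLp_of_cont hf₁).toLp f₁, hf₂.toLp f₂], by
    refine ⟨fun i => ?_, ?_, ?_⟩
    · have key : ∀ {p q : ℝ → ℝ} (hp : MemLp p 2 (vol L)) (hq : MemLp q 2 (vol L)),
          HasWeakDeriv L p q → HasWeakDeriv L (hp.toLp p) (hq.toLp q) := by
        intro p q hp hq h φ a b c
        have h1 : ∫ s in Ioo 0 L, deriv φ s • hp.toLp p s = ∫ s in Ioo 0 L, deriv φ s • p s :=
          integral_congr_ae (by filter_upwards [hp.coeFn_toLp] with s hs; rw [hs])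
        have h2 : ∫ s in Ioo 0 L, φ s • hq.toLp q s = ∫ s in Ioo 0 L, φ s • q s :=
          integral_congr_ae (by filter_upwards [hq.coeFn_toLp] with s hs; rw [hs])
        rw [h1, h2]
        exact h φ a b c
      fin_cases i
      · exact key (memLp_of_cont hf) (memLp_of_cont hf₁) (hasWeakDeriv_of_right hL hf hd (memLp_of_cont hf₁))
      · exact key (memLp_of_cont hf₁) hf₂ (hasWeakDeriv_of_right hL hf₁ hd₁ hf₂)
    · exact (pointVal_of_right hL hf hd (memLp_of_cont hf) (memLp_of_cont hf₁) (left_mem_Icc.2 hL.le)).trans h0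
    · exact (pointVal_of_right hL hf₁ hd₁ (memLp_of_cont hf₁) hf₂ (left_mem_Icc.2 hL.le)).trans h1⟩

/-! ### Hermite cubic finite elements -/

/-- Reference Hermite cubic with `φ(0) = 1`, `φ'(0) = 0`, `φ(±1) = φ'(±1) = 0`. -/
def shapeVal (s : ℝ) : ℝ := if |s| ≤ 1 then (1 - |s|) ^ 2 * (1 + 2 * |s|) else 0

/-- First derivative of `shapeVal`. -/
def shapeVal₁ (s : ℝ) : ℝ := if |s| ≤ 1 then -6 * s * (1 - |s|) else 0

/-- Right derivative of `shapeVal₁`. -/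
def shapeVal₂ (s : ℝ) : ℝ := if -1 ≤ s ∧ s < 1 then 12 * |s| - 6 else 0

/-- Reference Hermite cubic with `φ(0) = 0`, `φ'(0) = 1`, `φ(±1) = φ'(±1) = 0`. -/
def shapeSlope (s : ℝ) : ℝ := if |s| ≤ 1 then s * (1 - |s|) ^ 2 else 0

/-- First derivative of `shapeSlope`. -/
def shapeSlope₁ (s : ℝ) : ℝ := if |s| ≤ 1 then (1 - |s|) * (1 - 3 * |s|) else 0

/-- Right derivative of `shapeSlope₁`. -/
def shapeSlope₂ (s : ℝ) : ℝ :=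
  if -1 ≤ s ∧ s < 0 then 6 * s + 4 else if 0 ≤ s ∧ s < 1 then 6 * s - 4 else 0

lemma right_deriv_pieces {f f' p q p' q' : ℝ → ℝ}
    (h1 : ∀ x, x < -1 → f x = 0 ∧ f' x = 0)
    (h2 : ∀ x, -1 ≤ x → x < 0 → f x = p x ∧ f' x = p' x)
    (h3 : ∀ x, 0 ≤ x → x < 1 → f x = q x ∧ f' x = q' x)
    (h4 : ∀ x, 1 ≤ x → f x = 0 ∧ f' x = 0)
    (hp : ∀ x, HasDerivAt p (p' x) x) (hq : ∀ x, HasDerivAt q (q' x) x) (x : ℝ) :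
    HasDerivWithinAt f (f' x) (Ioi x) x := by
  have key : ∀ {g : ℝ → ℝ} {g' b : ℝ}, x < b → (∀ y, x ≤ y → y < b → f y = g y) →
      HasDerivAt g g' x → HasDerivWithinAt f g' (Ioi x) x := by
    intro g g' b hb hfg hg
    refine hg.hasDerivWithinAt.congr_of_eventuallyEq ?_ (hfg x le_rfl hb)
    filter_upwards [Ioo_mem_nhdsGT hb] with y hy using hfg y hy.1.le hy.2
  rcases lt_or_ge x (-1) with hx | hx
  · rw [(h1 x hx).2]
    exact key hx (fun y _ hy => (h1 y hy).1) (hasDerivAt_const x (0 : ℝ))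
  rcases lt_or_ge x 0 with hx' | hx'
  · rw [(h2 x hx hx').2]
    exact key hx' (fun y hy hy' => (h2 y (hx.trans hy) hy').1) (hp x)
  rcases lt_or_ge x 1 with hx'' | hx''
  · rw [(h3 x hx' hx'').2]
    exact key hx'' (fun y hy hy' => (h3 y (hx'.trans hy) hy').1) (hq x)
  · rw [(h4 x hx'').2]
    exact key (lt_add_one x) (fun y hy _ => (h4 y (hx''.trans hy)).1) (hasDerivAt_const x (0 : ℝ))

lemma hasDeriv_cubic (a b c d x : ℝ) :
    HasDerivAt (fun x : ℝ => a * x ^ 3 + b * x ^ 2 + c * x + d)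
      (3 * a * x ^ 2 + 2 * b * x + c) x := by
  have h := ((((hasDerivAt_id x).pow 3).const_mul a).add
    (((hasDerivAt_id x).pow 2).const_mul b)).add (((hasDerivAt_id x).const_mul c)) |>.add_const d
  refine (h.congr_deriv ?_)
  simp
  ring

lemma shapeVal_hasDeriv (x : ℝ) : HasDerivWithinAt shapeVal (shapeVal₁ x) (Ioi x) x := by
  refine right_deriv_pieces (p := fun x => -2 * x ^ 3 + (-3) * x ^ 2 + 0 * x + 1)
    (q := fun x => 2 * x ^ 3 + (-3) * x ^ 2 + 0 * x + 1)
    ?_ ?_ ?_ ?_ (hasDeriv_cubic _ _ _ _) (hasDeriv_cubic _ _ _ _) x <;> intro x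
  all_goals unfold shapeVal shapeVal₁
  · intro h; rw [abs_of_neg (by linarith)]; grind
  · intro h h'; rw [abs_of_neg (by linarith)]; grind
  · intro h h'; rw [abs_of_nonneg h]; grind
  · intro h
    rw [abs_of_pos (by linarith)]
    rcases eq_or_lt_of_le h with rfl | h
    · norm_num
    · grind

lemma shapeVal₁_hasDeriv (x : ℝ) : HasDerivWithinAt shapeVal₁ (shapeVal₂ x) (Ioi x) x := by
  refine right_deriv_pieces (p := fun x => 0 * x ^ 3 + (-6) * x ^ 2 + (-6) * x + 0)
    (q := fun x => 0 * x ^ 3 + 6 * x ^ 2 + (-6) * x + 0)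
    ?_ ?_ ?_ ?_ (hasDeriv_cubic _ _ _ _) (hasDeriv_cubic _ _ _ _) x <;> intro x
  all_goals unfold shapeVal₁ shapeVal₂
  · intro h; rw [abs_of_neg (by linarith)]; grind
  · intro h h'; rw [abs_of_neg (by linarith)]; grind
  · intro h h'; rw [abs_of_nonneg h]; grind
  · intro h
    rw [abs_of_pos (by linarith)]
    rcases eq_or_lt_of_le h with rfl | h
    · norm_num
    · grind

lemma shapeSlope_hasDeriv (x : ℝ) : HasDerivWithinAt shapeSlope (shapeSlope₁ x) (Ioi x) x := by
  refine right_deriv_pieces (p := fun x => 1 * x ^ 3 + 2 * x ^ 2 + 1 * x + 0)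
    (q := fun x => 1 * x ^ 3 + (-2) * x ^ 2 + 1 * x + 0)
    ?_ ?_ ?_ ?_ (hasDeriv_cubic _ _ _ _) (hasDeriv_cubic _ _ _ _) x <;> intro x
  all_goals unfold shapeSlope shapeSlope₁
  · intro h; rw [abs_of_neg (by linarith)]; grind
  · intro h h'; rw [abs_of_neg (by linarith)]; grind
  · intro h h'; rw [abs_of_nonneg h]; grind
  · intro h
    rw [abs_of_pos (by linarith)]
    rcases eq_or_lt_of_le h with rfl | h
    · norm_num
    · grind

lemma shapeSlope₁_hasDeriv (x : ℝ) : HasDerivWithinAt shapeSlope₁ (shapeSlope₂ x) (Ioi x) x := by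
  refine right_deriv_pieces (p := fun x => 0 * x ^ 3 + 3 * x ^ 2 + 4 * x + 1)
    (q := fun x => 0 * x ^ 3 + 3 * x ^ 2 + (-4) * x + 1)
    ?_ ?_ ?_ ?_ (hasDeriv_cubic _ _ _ _) (hasDeriv_cubic _ _ _ _) x <;> intro x
  all_goals unfold shapeSlope₁ shapeSlope₂
  · intro h; rw [abs_of_neg (by linarith)]; grind
  · intro h h'; rw [abs_of_neg (by linarith)]; grind
  · intro h h'; rw [abs_of_nonneg h]; grind
  · intro h
    rw [abs_of_pos (by linarith)]
    rcases eq_or_lt_of_le h with rfl | h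
    · norm_num
    · grind

lemma continuous_shape {f : ℝ → ℝ} (hf : Continuous f) (h : ∀ s, |s| = 1 → f s = 0) :
    Continuous fun s => if |s| ≤ 1 then f s else 0 :=
  hf.if_le continuous_const continuous_abs continuous_const h

lemma continuous_shapeVal : Continuous shapeVal :=
  continuous_shape (by fun_prop) fun s hs => by simp [hs]

lemma continuous_shapeVal₁ : Continuous shapeVal₁ :=
  continuous_shape (by fun_prop) fun s hs => by simp [hs]

lemma continuous_shapeSlope : Continuous shapeSlope :=
  continuous_shape (by fun_prop) fun s hs => by simp [hs]

lemma continuous_shapeSlope₁ : Continuous shapeSlope₁ :=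
  continuous_shape (by fun_prop) fun s hs => by simp [hs]

lemma measurable_shapeVal₂ : Measurable shapeVal₂ := by
  refine Measurable.ite ?_ (by fun_prop) measurable_const
  exact measurableSet_Ico (a := (-1 : ℝ)) (b := 1)

lemma measurable_shapeSlope₂ : Measurable shapeSlope₂ := by
  refine Measurable.ite ?_ (by fun_prop) (Measurable.ite ?_ (by fun_prop) measurable_const)
  · exact measurableSet_Ico (a := (-1 : ℝ)) (b := 0)
  · exact measurableSet_Ico (a := (0 : ℝ)) (b := 1)

lemma abs_shapeVal₂_le (s : ℝ) : |shapeVal₂ s| ≤ 18 := by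
  unfold shapeVal₂; split_ifs <;> grind

lemma abs_shapeSlope₂_le (s : ℝ) : |shapeSlope₂ s| ≤ 18 := by
  unfold shapeSlope₂; split_ifs <;> grind

lemma scale_hasDeriv {f f' : ℝ → ℝ} (hf : ∀ x, HasDerivWithinAt f (f' x) (Ioi x) x) {h : ℝ}
    (hh : 0 < h) (a c x : ℝ) :
    HasDerivWithinAt (fun x => c * f ((x - a) / h)) (c / h * f' ((x - a) / h)) (Ioi x) x := by
  have h1 : HasDerivWithinAt (fun x : ℝ => (x - a) / h) (1 / h) (Ioi x) x :=
    (((hasDerivAt_id x).sub_const a).div_const h).hasDerivWithinAt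
  have h2 := ((hf ((x - a) / h)).comp x h1 (fun y hy => by
    simp only [mem_Ioi] at hy ⊢; gcongr)).const_mul c
  refine h2.congr_deriv ?_
  ring

/-- The mesh size `h = L / N` of the uniform partition of `[0, L]` into `N` elements. -/
abbrev meshSize (L : ℝ) (N : ℕ) : ℝ := L / N

/-- The node `x_{m+1} = (m + 1) h`. -/
abbrev node (L : ℝ) (N : ℕ) (m : Fin N) : ℝ := ((m : ℝ) + 1) * meshSize L N

lemma meshSize_pos {L : ℝ} (hL : 0 < L) {N : ℕ} (m : Fin N) : 0 < meshSize L N :=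
  div_pos hL (by exact_mod_cast m.pos)

lemma ref_zero_le {L : ℝ} (hL : 0 < L) {N : ℕ} (m : Fin N) :
    (0 - node L N m) / meshSize L N ≤ -1 := by
  have h := meshSize_pos hL m
  have hm : (0 : ℝ) ≤ (m : ℕ) := Nat.cast_nonneg _
  rw [div_le_iff₀ h]
  unfold node
  nlinarith

lemma shape_zero {s : ℝ} (hs : s ≤ -1) :
    shapeVal s = 0 ∧ shapeVal₁ s = 0 ∧ shapeSlope s = 0 ∧ shapeSlope₁ s = 0 := by
  unfold shapeVal shapeVal₁ shapeSlope shapeSlope₁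
  rw [abs_of_neg (by linarith)]
  rcases eq_or_lt_of_le hs with rfl | h
  · norm_num
  · grind

/-- The Hermite basis function of `W_h` attached to the value at the node `x_{m+1}`:
it has value `1` at that node, value `0` at all other nodes, and slope `0` at all nodes. -/
def hermiteVal {L : ℝ} (hL : 0 < L) {N : ℕ} (m : Fin N) : HTilde 2 L hL :=
  let h := meshSize L N
  let a := node L N m
  mkHTilde hL (fun x => 1 * shapeVal ((x - a) / h)) (fun x => 1 / h * shapeVal₁ ((x - a) / h))
    (fun x => 1 / h / h * shapeVal₂ ((x - a) / h))
    (by have := continuous_shapeVal; fun_prop) (by have := continuous_shapeVal₁; fun_prop)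
    (MemLp.const_mul (memLp_of_bdd (measurable_shapeVal₂.comp (by fun_prop))
      fun _ _ => abs_shapeVal₂_le _) _)
    (scale_hasDeriv shapeVal_hasDeriv (meshSize_pos hL m) a 1)
    (scale_hasDeriv shapeVal₁_hasDeriv (meshSize_pos hL m) a (1 / h))
    (by simp only [h, a, (shape_zero (ref_zero_le hL m)).1, mul_zero])
    (by simp only [h, a, (shape_zero (ref_zero_le hL m)).2.1, mul_zero])

/-- The Hermite basis function of `W_h` attached to the slope at the node `x_{m+1}`:
it has slope `1` at that node, slope `0` at all other nodes, and value `0` at all nodes. -/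
def hermiteSlope {L : ℝ} (hL : 0 < L) {N : ℕ} (m : Fin N) : HTilde 2 L hL :=
  let h := meshSize L N
  let a := node L N m
  mkHTilde hL (fun x => h * shapeSlope ((x - a) / h))
    (fun x => h / h * shapeSlope₁ ((x - a) / h))
    (fun x => h / h / h * shapeSlope₂ ((x - a) / h))
    (by have := continuous_shapeSlope; fun_prop) (by have := continuous_shapeSlope₁; fun_prop)
    (MemLp.const_mul (memLp_of_bdd (measurable_shapeSlope₂.comp (by fun_prop))
      fun _ _ => abs_shapeSlope₂_le _) _)
    (scale_hasDeriv shapeSlope_hasDeriv (meshSize_pos hL m) a h)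
    (scale_hasDeriv shapeSlope₁_hasDeriv (meshSize_pos hL m) a (h / h))
    (by simp only [h, a, (shape_zero (ref_zero_le hL m)).2.2.1, mul_zero])
    (by simp only [h, a, (shape_zero (ref_zero_le hL m)).2.2.2, mul_zero])

/-- The value `w(x)` of `w ∈ H̃²_0(0, L)` at `x ∈ [0, L]`. -/
def val {L : ℝ} {hL : 0 < L} (w : HTilde 2 L hL) (x : ℝ) : ℝ := pointVal (w.1 0) (w.1 1) x

/-- The slope `w_x(x)` of `w ∈ H̃²_0(0, L)` at `x ∈ [0, L]`. -/
def slope {L : ℝ} {hL : 0 < L} (w : HTilde 2 L hL) (x : ℝ) : ℝ := pointVal (w.1 1) (w.1 2) x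

/-- The embedding `H̃⁴_0(0, L) ⊂ H̃²_0(0, L)`. -/
def toH2 {L : ℝ} {hL : 0 < L} (u : HTilde 4 L hL) : HTilde 2 L hL :=
  ⟨WithLp.toLp 2 ![u.1 0, u.1 1, u.1 2], by
    refine ⟨fun i => ?_, u.2.2.1, u.2.2.2⟩
    fin_cases i
    · exact u.2.1 0
    · exact u.2.1 1⟩

/-- The space `W_h` of Hermite cubic finite elements on the uniform mesh with `N` elements, i.e.
the span of the `2 N` Hermite basis functions attached to the nodes `x_1, …, x_N`. -/
def hermiteSpace {L : ℝ} (hL : 0 < L) (N : ℕ) : Submodule ℝ (HTilde 2 L hL) :=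
  Submodule.span ℝ (range (hermiteVal hL (N := N)) ∪ range (hermiteSlope hL (N := N)))

/-- The nodal projection `ũ = ∑ₘ u(x_m) w_{2m-1} + ∑ₘ u_x(x_m) w_{2m} ∈ W_h`. -/
def nodalProj {L : ℝ} {hL : 0 < L} (N : ℕ) (u : HTilde 2 L hL) : HTilde 2 L hL :=
  ∑ m : Fin N, (val u (node L N m) • hermiteVal hL m + slope u (node L N m) • hermiteSlope hL m)

/-! ### The controlled beam -/

/-- An Euler-Bernoulli beam of length `L` with linear mass density `μ`, flexural rigidity `Λ`, and
a tip body of mass `M` and moment of inertia `J`. -/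
structure Beam where
  L : ℝ
  μ : ℝ → ℝ
  Λ : ℝ → ℝ
  M : ℝ
  J : ℝ
  L_pos : 0 < L
  μ_smooth : ContDiffOn ℝ 4 μ (Icc 0 L)
  μ_pos : ∀ x ∈ Icc 0 L, 0 < μ x
  Λ_smooth : ContDiffOn ℝ 4 Λ (Icc 0 L)
  Λ_pos : ∀ x ∈ Icc 0 L, 0 < Λ x
  M_pos : 0 < M
  J_pos : 0 < J

/-- The space `H̃^k_0(0, L)` on the beam. -/
abbrev Beam.Ht (B : Beam) (k : ℕ) : Type := HTilde k B.L B.L_pos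

/-- Data of one controller `ζ' = A ζ + b y'`, `Θ = k y + c · ζ + d y'`, where the boundary
measurement `y` is `u_x(·, L)` for the first and `u(·, L)` for the second controller. -/
structure Controller (n : ℕ) where
  A : Matrix (Fin n) (Fin n) ℝ
  b : Fin n → ℝ
  c : Fin n → ℝ
  d : ℝ
  k : ℝ

variable {n : ℕ}

/-- The transfer function `G(s) = ((s I - A)⁻¹ b) · c + d`. -/
def Controller.transfer (K : Controller n) (s : ℂ) : ℂ :=
  Matrix.mulVec (s • (1 : Matrix (Fin n) (Fin n) ℂ) - K.A.map Complex.ofReal)⁻¹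
    (fun i => (K.b i : ℂ)) ⬝ᵥ (fun i => (K.c i : ℂ)) + (K.d : ℂ)

/-- Assumptions on a controller: `A` is Hurwitz, `k > 0`, and
`Re G(i r) ≥ d ≥ δ > 0` for all `r ≥ 0`. -/
structure Controller.Admissible (K : Controller n) (δ : ℝ) : Prop where
  hurwitz : ∀ z ∈ spectrum ℂ (K.A.map Complex.ofReal), z.re < 0
  k_pos : 0 < K.k
  δ_pos : 0 < δ
  δ_le : δ ≤ K.d
  spr : ∀ r : ℝ, 0 ≤ r → K.d ≤ (K.transfer (Complex.I * r)).re

/-- `P` is a symmetric positive definite weight matrix for the controller: for some `ε > 0` and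
some vector `q`, `P A + Aᵀ P = - q qᵀ - ε P` and `P b = c - √(2 (d - δ)) q`. -/
def Controller.IsWeight (K : Controller n) (δ : ℝ) (P : Matrix (Fin n) (Fin n) ℝ) : Prop :=
  P.PosDef ∧ ∃ ε : ℝ, 0 < ε ∧ ∃ q : Fin n → ℝ,
    P * K.A + K.A.transpose * P = -Matrix.vecMulVec q q - ε • P ∧
    P.mulVec K.b = K.c - Real.sqrt (2 * (K.d - δ)) • q

/-- The energy of a state `(u, v, ζ₁, ζ₂)`, where `v` is the velocity. -/
def energy (B : Beam) (K₁ K₂ : Controller n) (P₁ P₂ : Matrix (Fin n) (Fin n) ℝ)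
    (u v : B.Ht 2) (ζ₁ ζ₂ : Fin n → ℝ) : ℝ :=
  1 / 2 * (∫ x in Ioo 0 B.L, (B.Λ x * (u.1 2 x) ^ 2 + B.μ x * (v.1 0 x) ^ 2))
    + B.M / 2 * (val v B.L) ^ 2 + B.J / 2 * (slope v B.L) ^ 2
    + K₁.k / 2 * (slope u B.L) ^ 2 + K₂.k / 2 * (val u B.L) ^ 2
    + 1 / 2 * (ζ₁ ⬝ᵥ P₁.mulVec ζ₁) + 1 / 2 * (ζ₂ ⬝ᵥ P₂.mulVec ζ₂)

/-- The energy functional `E(t; u, ζ₁, ζ₂)` of a trajectory on `[0, T]`, with the `H̃²_0`-valued time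
derivative `u_t` (one-sided at the endpoints). -/
def energyAt (B : Beam) (K₁ K₂ : Controller n) (P₁ P₂ : Matrix (Fin n) (Fin n) ℝ) (T : ℝ)
    (u : ℝ → B.Ht 2) (ζ₁ ζ₂ : ℝ → Fin n → ℝ) (t : ℝ) : ℝ :=
  energy B K₁ K₂ P₁ P₂ (u t) (derivWithin u (Icc 0 T) t) (ζ₁ t) (ζ₂ t)

/-! ### Weak solutions -/

/-- The pivot space `H = ℝ × ℝ × L²(0, L)`. (Its topology is that of the product; the weighted
inner product is `innerH`.) -/
abbrev PivotH (B : Beam) : Type := ℝ × ℝ × L2 B.L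

/-- The inner product `J φ¹ ν¹ + M φ² ν² + (μ φ³, ν³)_{L²}` of `H`. -/
def innerH (B : Beam) (φ ν : PivotH B) : ℝ :=
  B.J * φ.1 * ν.1 + B.M * φ.2.1 * ν.2.1 + ∫ x in Ioo 0 B.L, B.μ x * (φ.2.2 x * ν.2.2 x)

/-- `ŵ = (w_x(L), w(L), w)`. The space `V = {ŵ | w ∈ H̃²_0}` is identified with `H̃²_0` (with an
equivalent norm), and `V'` with the dual of `H̃²_0`. -/
def hat {B : Beam} (w : B.Ht 2) : PivotH B := (slope w B.L, val w B.L, w.1 0)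

/-- `a(û, ŵ) = (Λ u_xx, w_xx) + k₁ u_x(L) w_x(L) + k₂ u(L) w(L)`. -/
def aForm (B : Beam) (K₁ K₂ : Controller n) (u w : B.Ht 2) : ℝ :=
  (∫ x in Ioo 0 B.L, B.Λ x * (u.1 2 x * w.1 2 x))
    + K₁.k * slope u B.L * slope w B.L + K₂.k * val u B.L * val w B.L

/-- `b(φ, ν) = d₁ φ¹ ν¹ + d₂ φ² ν²`. -/
def bForm {B : Beam} (K₁ K₂ : Controller n) (φ ν : PivotH B) : ℝ :=
  K₁.d * φ.1 * ν.1 + K₂.d * φ.2.1 * ν.2.1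

/-- `(u, ζ₁, ζ₂)` is a weak solution on `(0, T)` with initial data `u₀`, `v₀`, `ζ₁₀`, `ζ₂₀`:
`û ∈ L²(V) ∩ H¹(H) ∩ H²(V')`, `ζ₁, ζ₂ ∈ H¹(ℝⁿ)`, and, for a.e. `t` and all `w ∈ H̃²_0`,
`⟨û_tt, ŵ⟩ + a(û, ŵ) + b(û_t, ŵ) + c₁·ζ₁ w_x(L) + c₂·ζ₂ w(L) = 0`,
`ζ₁' = A₁ ζ₁ + b₁ ¹û_t`, `ζ₂' = A₂ ζ₂ + b₂ ²û_t`.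
The functions `û` and `ζ_j` are their representatives continuous on `[0, T]` (with values in `H`,
resp. `ℝⁿ`). The pairing of `V'` and `V` extends the inner product of `H`, so that `û_tt` is the
derivative of `û_t` after testing with each `ŵ`; likewise `û_t(0) = v₀` is understood through the
continuous representatives of `(û_t, ŵ)_H`. -/
def IsWeakSolution (B : Beam) (K₁ K₂ : Controller n) (T : ℝ)
    (u : ℝ → B.Ht 2) (ζ₁ ζ₂ : ℝ → Fin n → ℝ)
    (u₀ : B.Ht 2) (v₀ : PivotH B) (ζ₁₀ ζ₂₀ : Fin n → ℝ) : Prop :=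
  ∃ (u_t : ℝ → PivotH B) (u_tt : ℝ → StrongDual ℝ (B.Ht 2)) (ζ₁_t ζ₂_t : ℝ → Fin n → ℝ),
    MemLp u 2 (vol T) ∧ MemLp u_t 2 (vol T) ∧ MemLp u_tt 2 (vol T) ∧
    HasWeakDeriv T (fun t => hat (u t)) u_t ∧
    (∀ w : B.Ht 2, HasWeakDeriv T (fun t => innerH B (u_t t) (hat w)) (fun t => u_tt t w)) ∧
    MemLp ζ₁ 2 (vol T) ∧ MemLp ζ₁_t 2 (vol T) ∧ HasWeakDeriv T ζ₁ ζ₁_t ∧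
    MemLp ζ₂ 2 (vol T) ∧ MemLp ζ₂_t 2 (vol T) ∧ HasWeakDeriv T ζ₂ ζ₂_t ∧
    (∀ᵐ t ∂(vol T), ∀ w : B.Ht 2,
      u_tt t w + aForm B K₁ K₂ (u t) w + bForm K₁ K₂ (u_t t) (hat w)
        + (K₁.c ⬝ᵥ ζ₁ t) * slope w B.L + (K₂.c ⬝ᵥ ζ₂ t) * val w B.L = 0) ∧
    (∀ᵐ t ∂(vol T), ζ₁_t t = K₁.A.mulVec (ζ₁ t) + (u_t t).1 • K₁.b) ∧
    (∀ᵐ t ∂(vol T), ζ₂_t t = K₂.A.mulVec (ζ₂ t) + (u_t t).2.1 • K₂.b) ∧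
    ContinuousOn (fun t => hat (u t)) (Icc 0 T) ∧ u 0 = u₀ ∧
    (∀ w : B.Ht 2, ∃ p : ℝ → ℝ, ContinuousOn p (Icc 0 T) ∧
      (∀ᵐ t ∂(vol T), p t = innerH B (u_t t) (hat w)) ∧ p 0 = innerH B v₀ (hat w)) ∧
    ContinuousOn ζ₁ (Icc 0 T) ∧ ζ₁ 0 = ζ₁₀ ∧ ContinuousOn ζ₂ (Icc 0 T) ∧ ζ₂ 0 = ζ₂₀

/-- `(u_t, u_tt)` are the time derivatives of `u`, and the solution has the regularity
`u ∈ C([0, T]; H̃⁴_0)`, `u_t ∈ L²(0, T; H̃⁴_0)`, `u_tt ∈ L²(0, T; H̃²_0)`. -/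
def HasRegularity (B : Beam) (T : ℝ) (u u_t : ℝ → B.Ht 4) (u_tt : ℝ → B.Ht 2) : Prop :=
  ContinuousOn u (Icc 0 T) ∧
    MemLp u_t 2 (vol T) ∧ HasWeakDeriv T u u_t ∧
    MemLp u_tt 2 (vol T) ∧ HasWeakDeriv T (fun t => toH2 (u_t t)) u_tt

/-- `(u_h, ζ₁, ζ₂)` solves the semi-discrete Galerkin scheme on `[0, ∞)` in `W_h` with
`N` elements and initial data `u_{h,0}`, `v_{h,0}`, `ζ₁₀`, `ζ₂₀`. -/
structure IsSemidiscreteSolution (B : Beam) (K₁ K₂ : Controller n) (N : ℕ)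
    (u : ℝ → B.Ht 2) (ζ₁ ζ₂ : ℝ → Fin n → ℝ)
    (u₀ v₀ : B.Ht 2) (ζ₁₀ ζ₂₀ : Fin n → ℝ) : Prop where
  mem : ∀ t, 0 ≤ t → u t ∈ hermiteSpace B.L_pos N
  smooth : ContDiffOn ℝ 2 u (Ici 0)
  smooth₁ : ContDiffOn ℝ 1 ζ₁ (Ici 0)
  smooth₂ : ContDiffOn ℝ 1 ζ₂ (Ici 0)
  galerkin : ∀ t, 0 < t → ∀ w ∈ hermiteSpace B.L_pos N,
    innerH B (hat (deriv (deriv u) t)) (hat w) + aForm B K₁ K₂ (u t) w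
      + bForm K₁ K₂ (hat (deriv u t)) (hat w)
      + (K₁.c ⬝ᵥ ζ₁ t) * slope w B.L + (K₂.c ⬝ᵥ ζ₂ t) * val w B.L = 0
  ode₁ : ∀ t, 0 < t → deriv ζ₁ t = K₁.A.mulVec (ζ₁ t) + slope (deriv u t) B.L • K₁.b
  ode₂ : ∀ t, 0 < t → deriv ζ₂ t = K₂.A.mulVec (ζ₂ t) + val (deriv u t) B.L • K₂.b
  init_u : u 0 = u₀
  init_v : derivWithin u (Ici 0) 0 = v₀
  init₁ : ζ₁ 0 = ζ₁₀
  init₂ : ζ₂ 0 = ζ₂₀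

end BeamFEM

end

open BeamFEM

/-!
The error is measured against the nodal projection `ũ(t) ∈ W_h` of `u(t)`. Consider the energy `G`
of the mixed state `(u_h - u, (u_h)_t - ũ_t, ζ̃_j - ζ_j)`, whose velocity is a finite element
function and hence admissible in both the exact and the discrete equation. Testing with it and
subtracting gives `G'`. Since `ũ` has the value and slope of `u` at the tip `x = L`, the boundary
and controller terms are those of controllers with inputs `(u_h - u)_xt(L)` and `(u_h - u)_t(L)`,
and the Lur'e equations for `P_j` make their sum nonpositive (`Controller.IsWeight.dissipation`).
What remains is (`energy_deriv_le`)
`G' ≤ -(Λ (u_h - u)_xx, (u_t - ũ_t)_xx) + (μ (u_tt - ũ_tt), (u_h)_t - ũ_t)`.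

Both terms contain an interpolation error as a factor. On an element, the interpolation error `r`
of `w` vanishes at both ends together with its slope, so that `r_xx` is orthogonal to the affine
functions; as the second derivative of the interpolant is affine, `r_xx` is at most as large in
`L²` as the difference of `w_xx` to any affine function. With the Taylor polynomial of `w_xx` this
gives `‖r_xx‖ ≤ h² ‖w_xxxx‖` (`norm_sub_nodalProj_two_le`), and two integrations of `r_xx`,
together with `‖r_xx‖ ≤ ‖w_xx‖`, give `‖r‖ ≤ h² ‖w_xx‖` (`norm_sub_nodalProj_zero_le`). Therefore
`G' ≤ 2 κ h² (‖u_t‖_{H⁴} + ‖u_tt‖_{H²}) √G` (`interpolation_power_le`). Evaluating the integral of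
this inequality at a maximum of `G` yields
`√G(t) ≤ √G(0) + 2 κ h² ∫ (‖u_t‖ + ‖u_tt‖)` without an exponential factor
(`sqrt_le_of_deriv_le`), and the Cauchy-Schwarz inequality in time turns the integral into `L²`
norms (`sqrt_energy_discrete_error_le`). Exchanging `ũ_t` for `u_t` at time `t`, and `u` for `ũ` at
time `0`, costs two more interpolation errors.

The functional analysis rests on primitives: `IsPrimitiveOn T f g` says that `f` is absolutely
continuous on `[0, T]` with derivative `g`. Weakly differentiable functions agree almost everywhere
with primitives (`HasWeakDeriv.exists_isPrimitiveOn`), and bounded bilinear expressions in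
primitives are primitives (`IsPrimitiveOn.bilin`). This identifies point values of Sobolev
functions in space, differentiates the energy in time, and shows that `u_t` is continuous with
values in `H̃²_0`, which gives the differentiability of `u`.
-/

noncomputable section

namespace BeamFEM

/-! ### Primitives of integrable functions -/

lemma intervalIntegrable_of_vol {X : Type*} [NormedAddCommGroup X] {T : ℝ} {g : ℝ → X}
    (hg : Integrable g (vol T)) {a b : ℝ} (ha : a ∈ Icc 0 T) (hb : b ∈ Icc 0 T) :
    IntervalIntegrable g volume a b := by
  have h : IntegrableOn g (Icc 0 T) := by
    rw [integrableOn_Icc_iff_integrableOn_Ioo]; exact hg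
  rw [intervalIntegrable_iff]
  exact h.mono_set (uIoc_subset_uIcc.trans (uIcc_subset_Icc ha hb))

lemma _root_.AbsolutelyContinuousOnInterval.of_dist_le {X Y Z : Type*} [NormedAddCommGroup X]
    [NormedAddCommGroup Y] [NormedAddCommGroup Z] {f : ℝ → X} {g : ℝ → Y} {k : ℝ → Z}
    {a b C D : ℝ} (hf : AbsolutelyContinuousOnInterval f a b)
    (hg : AbsolutelyContinuousOnInterval g a b)
    (h : ∀ x ∈ uIcc a b, ∀ y ∈ uIcc a b,
      dist (k x) (k y) ≤ C * dist (f x) (f y) + D * dist (g x) (g y)) :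
    AbsolutelyContinuousOnInterval k a b := by
  unfold AbsolutelyContinuousOnInterval at *
  refine squeeze_zero'
    (Filter.Eventually.of_forall fun E => Finset.sum_nonneg fun _ _ => dist_nonneg) ?_
    (by simpa using (hf.const_mul C).add (hg.const_mul D))
  filter_upwards [Filter.mem_inf_of_right (Filter.mem_principal_self _)] with E hE
  rw [Finset.mul_sum, Finset.mul_sum, ← Finset.sum_add_distrib]
  exact Finset.sum_le_sum fun i hi => h _ (hE.1 i hi).1 _ (hE.1 i hi).2

section Primitive

variable {X Y Z : Type*} [NormedAddCommGroup X] [NormedSpace ℝ X]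
  [NormedAddCommGroup Y] [NormedSpace ℝ Y] [NormedAddCommGroup Z] [NormedSpace ℝ Z]
  {T : ℝ}

lemma ae_uIoc_of_ae_vol {p : ℝ → Prop} (h : ∀ᵐ s ∂(vol T), p s) {a b : ℝ} (ha : a ∈ Icc 0 T)
    (hb : b ∈ Icc 0 T) : ∀ᵐ s ∂volume, s ∈ uIoc a b → p s :=
  ae_L2 h ha hb

/-- On `[0, T]`, the function `f` is a primitive of the integrable function `g`; equivalently, `f`
is absolutely continuous with derivative `g`. -/
structure IsPrimitiveOn (T : ℝ) (f g : ℝ → X) : Prop where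
  integrable : Integrable g (vol T)
  eq : ∀ t ∈ Icc 0 T, f t = f 0 + ∫ s in (0 : ℝ)..t, g s

namespace IsPrimitiveOn

variable {f f' g g' : ℝ → X}

lemma sub_eq (h : IsPrimitiveOn T f g) {a b : ℝ} (ha : a ∈ Icc 0 T) (hb : b ∈ Icc 0 T) :
    f b - f a = ∫ s in a..b, g s := by
  have h0 : (0 : ℝ) ∈ Icc 0 T := ⟨le_rfl, ha.1.trans ha.2⟩
  rw [h.eq a ha, h.eq b hb, add_sub_add_left_eq_sub,
    intervalIntegral.integral_interval_sub_left (intervalIntegrable_of_vol h.integrable h0 hb)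
      (intervalIntegrable_of_vol h.integrable h0 ha)]

lemma of_sub_eq (hg : Integrable g (vol T))
    (h : ∀ t ∈ Icc 0 T, f t - f 0 = ∫ s in (0 : ℝ)..t, g s) :
    IsPrimitiveOn T f g :=
  ⟨hg, fun t ht => by rw [← h t ht]; abel⟩

lemma congr_left (h : IsPrimitiveOn T f g) (e : EqOn f f' (Icc 0 T)) : IsPrimitiveOn T f' g := by
  refine ⟨h.integrable, fun t ht => ?_⟩
  rw [← e ht, ← e ⟨le_rfl, ht.1.trans ht.2⟩]
  exact h.eq t ht

lemma congr_right (h : IsPrimitiveOn T f g) (e : g =ᵐ[vol T] g') : IsPrimitiveOn T f g' := by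
  refine ⟨h.integrable.congr e, fun t ht => ?_⟩
  rw [h.eq t ht]
  congr 1
  exact intervalIntegral.integral_congr_ae
    (ae_uIoc_of_ae_vol e ⟨le_rfl, ht.1.trans ht.2⟩ ht)

lemma continuousOn (h : IsPrimitiveOn T f g) : ContinuousOn f (Icc 0 T) := by
  rcases lt_or_ge T 0 with hT | hT
  · simp [Icc_eq_empty (not_le.2 hT)]
  have := intervalIntegral.continuousOn_primitive_interval' (μ := volume) (f := g) (a := 0)
    (b₁ := 0) (b₂ := T) (intervalIntegrable_of_vol h.integrable ⟨le_rfl, hT⟩ ⟨hT, le_rfl⟩) (by simp)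
  rw [uIcc_of_le hT] at this
  exact (this.const_add (f 0)).congr h.eq

lemma integrable_left (h : IsPrimitiveOn T f g) : Integrable f (vol T) :=
  (h.continuousOn.integrableOn_Icc).mono_set Ioo_subset_Icc_self

lemma add (h : IsPrimitiveOn T f g) (h' : IsPrimitiveOn T f' g') :
    IsPrimitiveOn T (fun t => f t + f' t) (fun t => g t + g' t) := by
  refine of_sub_eq (h.integrable.add h'.integrable) fun t ht => ?_
  have h0 : (0 : ℝ) ∈ Icc 0 T := ⟨le_rfl, ht.1.trans ht.2⟩
  rw [intervalIntegral.integral_add (intervalIntegrable_of_vol h.integrable h0 ht)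
    (intervalIntegrable_of_vol h'.integrable h0 ht), ← h.sub_eq h0 ht, ← h'.sub_eq h0 ht]
  abel

lemma clm [CompleteSpace X] [CompleteSpace Y] (A : X →L[ℝ] Y) (h : IsPrimitiveOn T f g) :
    IsPrimitiveOn T (fun t => A (f t)) (fun t => A (g t)) := by
  refine of_sub_eq (A.integrable_comp h.integrable) fun t ht => ?_
  have h0 : (0 : ℝ) ∈ Icc 0 T := ⟨le_rfl, ht.1.trans ht.2⟩
  rw [A.intervalIntegral_comp_comm (intervalIntegrable_of_vol h.integrable h0 ht),
    ← h.sub_eq h0 ht, map_sub]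

lemma neg (h : IsPrimitiveOn T f g) : IsPrimitiveOn T (fun t => -f t) (fun t => -g t) := by
  refine of_sub_eq h.integrable.neg fun t ht => ?_
  have h0 : (0 : ℝ) ∈ Icc 0 T := ⟨le_rfl, ht.1.trans ht.2⟩
  rw [intervalIntegral.integral_neg, ← h.sub_eq h0 ht]
  abel

lemma sub (h : IsPrimitiveOn T f g) (h' : IsPrimitiveOn T f' g') :
    IsPrimitiveOn T (fun t => f t - f' t) (fun t => g t - g' t) := by
  simpa only [sub_eq_add_neg] using h.add h'.neg

lemma of_hasDerivAt [CompleteSpace X] (hf : ContinuousOn f (Icc 0 T))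
    (hd : ∀ t ∈ Ioo 0 T, HasDerivAt f (g t) t) (hg : Integrable g (vol T)) :
    IsPrimitiveOn T f g := by
  refine of_sub_eq hg fun t ht => ?_
  rw [intervalIntegral.integral_eq_sub_of_hasDerivAt_of_le ht.1
    (hf.mono (Icc_subset_Icc_right ht.2)) (fun x hx => hd x ⟨hx.1, hx.2.trans_le ht.2⟩)
    (intervalIntegrable_of_vol hg ⟨le_rfl, ht.1.trans ht.2⟩ ht)]

lemma hasDerivWithinAt [CompleteSpace X] (h : IsPrimitiveOn T f g) (hg : ContinuousOn g (Icc 0 T))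
    {t : ℝ} (ht : t ∈ Icc 0 T) : HasDerivWithinAt f (g t) (Icc 0 T) t := by
  have h0 : (0 : ℝ) ∈ Icc 0 T := ⟨le_rfl, ht.1.trans ht.2⟩
  have : Fact (t ∈ Icc 0 T) := ⟨ht⟩
  have key := intervalIntegral.integral_hasDerivWithinAt_right (f := g) (s := Icc 0 T)
    (t := Icc 0 T) (intervalIntegrable_of_vol h.integrable h0 ht)
    (hg.stronglyMeasurableAtFilter_nhdsWithin measurableSet_Icc t) (hg t ht)
  exact (key.const_add (f 0)).congr h.eq (h.eq t ht)

/-- The primitive is controlled by the primitive of `‖g‖`, which is absolutely continuous. -/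
lemma absolutelyContinuous (h : IsPrimitiveOn T f g) (hT : 0 ≤ T) :
    AbsolutelyContinuousOnInterval f 0 T := by
  have h0 : (0 : ℝ) ∈ Icc 0 T := ⟨le_rfl, hT⟩
  have hn := (intervalIntegrable_of_vol h.integrable.norm h0
    (right_mem_Icc.2 hT)).absolutelyContinuousOnInterval_intervalIntegral (c := 0) (by simp)
  rw [absolutelyContinuousOnInterval_iff] at hn ⊢
  intro ε hε
  obtain ⟨δ, hδ, H⟩ := hn ε hε
  refine ⟨δ, hδ, fun E hE hE' => lt_of_le_of_lt (Finset.sum_le_sum fun i hi => ?_) (H E hE hE')⟩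
  have hi := hE.1 i hi
  rw [uIcc_of_le hT] at hi
  rw [dist_comm, dist_eq_norm, h.sub_eq hi.1 hi.2, dist_comm, dist_eq_norm,
    intervalIntegral.integral_interval_sub_left
      (intervalIntegrable_of_vol h.integrable.norm h0 hi.2)
      (intervalIntegrable_of_vol h.integrable.norm h0 hi.1)]
  exact intervalIntegral.norm_integral_le_abs_integral_norm

/-- Product rule. The difference of the two sides is absolutely continuous, and its derivative
vanishes almost everywhere by the Lebesgue differentiation theorem. -/
lemma bilin [CompleteSpace X] [CompleteSpace Y] [CompleteSpace Z] (B : X →L[ℝ] Y →L[ℝ] Z)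
    {p q : ℝ → Y} (h : IsPrimitiveOn T f g) (h' : IsPrimitiveOn T p q) :
    IsPrimitiveOn T (fun t => B (f t) (p t)) (fun t => B (g t) (p t) + B (f t) (q t)) := by
  obtain ⟨C, hC⟩ := (isCompact_Icc (a := (0 : ℝ)) (b := T)).exists_bound_of_continuousOn
    h.continuousOn
  obtain ⟨D, hD⟩ := (isCompact_Icc (a := (0 : ℝ)) (b := T)).exists_bound_of_continuousOn
    h'.continuousOn
  have hi1 : Integrable (fun t => B (g t) (p t)) (vol T) := by
    refine B.integrable_of_bilin_of_bdd_right D h.integrable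
      h'.integrable_left.aestronglyMeasurable ?_
    filter_upwards [ae_restrict_mem measurableSet_Ioo] with s hs using hD s (Ioo_subset_Icc_self hs)
  have hi2 : Integrable (fun t => B (f t) (q t)) (vol T) := by
    refine B.integrable_of_bilin_of_bdd_left C h.integrable_left.aestronglyMeasurable ?_
      h'.integrable
    filter_upwards [ae_restrict_mem measurableSet_Ioo] with s hs using hC s (Ioo_subset_Icc_self hs)
  refine of_sub_eq (hi1.add hi2) fun t₁ ht₁ => ?_
  have hT : 0 ≤ T := ht₁.1.trans ht₁.2
  have h0 : (0 : ℝ) ∈ Icc 0 T := ⟨le_rfl, hT⟩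
  have hTT : T ∈ Icc 0 T := ⟨hT, le_rfl⟩
  have hP : IsPrimitiveOn T (fun t => ∫ s in (0 : ℝ)..t, (B (g s) (p s) + B (f s) (q s)))
      (fun t => B (g t) (p t) + B (f t) (q t)) := ⟨hi1.add hi2, fun t ht => by simp⟩
  have hac1 : AbsolutelyContinuousOnInterval (fun t => B (f t) (p t)) 0 T := by
    refine (h.absolutelyContinuous hT).of_dist_le (h'.absolutelyContinuous hT) (C := ‖B‖ * D)
      (D := ‖B‖ * C) fun x hx y hy => ?_
    rw [uIcc_of_le hT] at hx hy
    have e : B (f x) (p x) - B (f y) (p y) = B (f x - f y) (p x) + B (f y) (p x - p y) := by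
      simp only [map_sub, sub_apply]; abel
    rw [dist_eq_norm, e, dist_eq_norm, dist_eq_norm]
    refine (norm_add_le _ _).trans (add_le_add ((B.le_opNorm₂ _ _).trans ?_)
      ((B.le_opNorm₂ _ _).trans ?_))
    · rw [mul_right_comm]
      gcongr
      exact hD x hx
    · gcongr
      exact hC y hy
  have hac := hac1.sub (hP.absolutelyContinuous hT)
  have hder : ∀ᵐ t, t ∈ uIcc 0 T → HasDerivAt ((fun t => B (f t) (p t)) -
      fun t => ∫ s in (0 : ℝ)..t, (B (g s) (p s) + B (f s) (q s))) 0 t := by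
    filter_upwards [(intervalIntegrable_of_vol h.integrable h0 hTT).ae_hasDerivAt_integral,
      (intervalIntegrable_of_vol h'.integrable h0 hTT).ae_hasDerivAt_integral,
      (intervalIntegrable_of_vol hP.integrable h0 hTT).ae_hasDerivAt_integral,
      Measure.ae_ne volume 0, Measure.ae_ne volume T] with t a1 a2 a3 b1 b2 ht
    have hu : Icc 0 T ∈ 𝓝 t := by
      rw [uIcc_of_le hT] at ht
      exact Icc_mem_nhds (lt_of_le_of_ne ht.1 b1.symm) (lt_of_le_of_ne ht.2 b2)
    have d1 : HasDerivAt f (g t) t := ((a1 ht 0 (by simp)).const_add (f 0)).congr_of_eventuallyEq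
      (by filter_upwards [hu] with s hs using h.eq s hs)
    have d2 : HasDerivAt p (q t) t := ((a2 ht 0 (by simp)).const_add (p 0)).congr_of_eventuallyEq
      (by filter_upwards [hu] with s hs using h'.eq s hs)
    have d3 := B.hasDerivAt_of_bilinear (fun _ => d1) (fun _ => d2)
    refine (d3.sub (a3 ht 0 (by simp))).congr_deriv ?_
    abel
  obtain ⟨K, hK⟩ := hac.const_of_ae_hasDerivAt_zero hder
  have e0 := hK 0 (by simp)
  have e1 := hK t₁ (by rw [uIcc_of_le hT]; exact ht₁)
  simp only [Pi.sub_apply, intervalIntegral.integral_same, sub_zero] at e0 e1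
  rw [e0, ← e1]
  abel

end IsPrimitiveOn

end Primitive

/-! ### Weak derivatives and primitives -/

section Weak

variable {X : Type*} [NormedAddCommGroup X] [NormedSpace ℝ X] {T : ℝ}

lemma integral_Ioo_eq_intervalIntegral (hT : 0 ≤ T) (f : ℝ → X) :
    ∫ s in Ioo 0 T, f s = ∫ s in (0 : ℝ)..T, f s := by
  rw [intervalIntegral.integral_of_le hT, integral_Ioc_eq_integral_Ioo]

lemma integrable_vol_of_continuous {X : Type*} [NormedAddCommGroup X] {T : ℝ} {f : ℝ → X}
    (hf : Continuous f) : Integrable f (vol T) :=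
  (hf.continuousOn.integrableOn_Icc).mono_set Ioo_subset_Icc_self

lemma integrable_test_smul {φ : ℝ → ℝ} (hφ : Continuous φ) {f : ℝ → X}
    (hf : Integrable f (vol T)) : Integrable (fun t => φ t • f t) (vol T) := by
  obtain ⟨C, hC⟩ := (isCompact_Icc (a := (0 : ℝ)) (b := T)).exists_bound_of_continuousOn
    hφ.continuousOn
  refine (ContinuousLinearMap.lsmul ℝ ℝ).integrable_of_bilin_of_bdd_left C
    (integrable_vol_of_continuous hφ).aestronglyMeasurable ?_ hf
  filter_upwards [ae_restrict_mem measurableSet_Ioo] with s hs using hC s (Ioo_subset_Icc_self hs)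

lemma eq_zero_of_tsupport_subset {φ : ℝ → ℝ} (h : tsupport φ ⊆ Ioo 0 T) {x : ℝ}
    (hx : x ∉ Ioo 0 T) : φ x = 0 :=
  image_eq_zero_of_notMem_tsupport fun h' => hx (h h')

variable [CompleteSpace X]

lemma IsPrimitiveOn.hasWeakDeriv (hT : 0 < T) {f g : ℝ → X} (h : IsPrimitiveOn T f g) :
    HasWeakDeriv T f g := by
  intro φ hφ _ hs
  have hc : Continuous (deriv φ) := hφ.continuous_deriv (by simp)
  have hp : IsPrimitiveOn T φ (deriv φ) := .of_hasDerivAt hφ.continuous.continuousOn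
    (fun t _ => (hφ.differentiable (by simp) t).hasDerivAt) (integrable_vol_of_continuous hc)
  have hb := (hp.bilin (ContinuousLinearMap.lsmul ℝ ℝ) h).sub_eq (left_mem_Icc.2 hT.le)
    (right_mem_Icc.2 hT.le)
  simp only [ContinuousLinearMap.lsmul_apply, eq_zero_of_tsupport_subset hs (x := 0) (by simp),
    eq_zero_of_tsupport_subset hs (x := T) (by simp), zero_smul, sub_zero] at hb
  rw [← integral_Ioo_eq_intervalIntegral hT.le, integral_add (integrable_test_smul hc
    h.integrable_left) (integrable_test_smul hφ.continuous h.integrable)] at hb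
  exact eq_neg_of_add_eq_zero_left hb.symm

/-- The fundamental lemma of the calculus of variations on `(0, T)`. -/
lemma ae_eq_zero_of_forall_test {f : ℝ → X} (hf : Integrable f (vol T))
    (h : ∀ φ : ℝ → ℝ, ContDiff ℝ ∞ φ → HasCompactSupport φ → tsupport φ ⊆ Ioo 0 T →
      ∫ s in Ioo 0 T, φ s • f s = 0) : f =ᵐ[vol T] 0 := by
  have key := isOpen_Ioo.ae_eq_zero_of_integral_contDiff_smul_eq_zero (μ := volume) (U := Ioo 0 T)
    (f := f) (IntegrableOn.locallyIntegrableOn hf) fun φ h1 h2 h3 => by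
      rw [← setIntegral_eq_integral_of_forall_compl_eq_zero (s := Ioo 0 T)
        fun x hx => by rw [eq_zero_of_tsupport_subset h3 hx, zero_smul]]
      exact h φ h1 h2 h3
  exact (ae_restrict_iff' measurableSet_Ioo).2 key

lemma HasWeakDeriv.unique {f g g' : ℝ → X} (h : HasWeakDeriv T f g) (h' : HasWeakDeriv T f g')
    (hg : Integrable g (vol T)) (hg' : Integrable g' (vol T)) : g =ᵐ[vol T] g' := by
  have := ae_eq_zero_of_forall_test (hg.sub hg') fun φ h1 h2 h3 => by
    have e := (h φ h1 h2 h3).symm.trans (h' φ h1 h2 h3)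
    simp only [Pi.sub_apply, smul_sub]
    rw [integral_sub (integrable_test_smul h1.continuous hg)
      (integrable_test_smul h1.continuous hg'), neg_injective e, sub_self]
  filter_upwards [this] with t ht
  exact sub_eq_zero.1 ht

/-- A function with vanishing weak derivative is constant: every test function is the sum of the
derivative of a test function and of a multiple of a fixed test function. -/
lemma HasWeakDeriv.ae_const (hT : 0 < T) {f : ℝ → X} (h : HasWeakDeriv T f fun _ => 0)
    (hf : Integrable f (vol T)) : ∃ c, f =ᵐ[vol T] fun _ => c := by
  let β : ContDiffBump (T / 2) := ⟨T / 8, T / 4, by positivity, by linarith⟩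
  have hβs : ContDiff ℝ ∞ (β.normed volume) := β.contDiff_normed
  have hβt : tsupport (β.normed volume) = Icc (T / 2 - T / 4) (T / 2 + T / 4) := by
    rw [β.tsupport_normed_eq, Real.closedBall_eq_Icc]
  set ψ : ℝ → ℝ := β.normed volume with hψ
  have hψT : tsupport ψ ⊆ Ioo 0 T := by
    rw [hβt]
    exact fun x hx => ⟨by linarith [hx.1], by linarith [hx.2]⟩
  refine ⟨∫ s in Ioo 0 T, ψ s • f s, ?_⟩
  set c := ∫ s in Ioo 0 T, ψ s • f s with hc
  have key := ae_eq_zero_of_forall_test (hf.sub (integrable_const c)) fun φ h1 h2 h3 => by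
    set I := ∫ s in Ioo 0 T, φ s with hI
    -- `k` has integral zero, hence its primitive `χ` is again a test function
    let k : ℝ → ℝ := fun s => φ s - I * ψ s
    have hk : ContDiff ℝ ∞ k := h1.sub (contDiff_const.mul hβs)
    let χ : ℝ → ℝ := fun t => ∫ s in (0 : ℝ)..t, k s
    have hχd : ∀ t, HasDerivAt χ (k t) t := fun t =>
      intervalIntegral.integral_hasDerivAt_right (hk.continuous.intervalIntegrable _ _)
        (hk.continuous.stronglyMeasurableAtFilter _ _) hk.continuous.continuousAt
    have hχ' : deriv χ = k := funext fun t => (hχd t).deriv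
    have hχ : ContDiff ℝ ∞ χ := contDiff_infty_iff_deriv.2
      ⟨fun t => (hχd t).differentiableAt, by rw [hχ']; exact hk⟩
    -- the test functions `φ` and `ψ` vanish outside an interval `[a, b] ⊂ (0, T)`
    obtain ⟨a, b, ha, hb, hφab, hψab⟩ : ∃ a b, 0 < a ∧ b < T ∧ tsupport φ ⊆ Icc a b ∧
        tsupport ψ ⊆ Icc a b := by
      have hK : IsCompact (tsupport φ ∪ tsupport ψ) := by
        refine IsCompact.union h2 ?_
        rw [hβt]; exact isCompact_Icc
      have hne : (tsupport φ ∪ tsupport ψ).Nonempty := by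
        refine ⟨T / 2, Or.inr ?_⟩
        rw [hβt]
        exact ⟨by linarith, by linarith⟩
      obtain ⟨a, haK, ha⟩ := hK.exists_isLeast hne
      obtain ⟨b, hbK, hb⟩ := hK.exists_isGreatest hne
      have hsub := union_subset h3 hψT
      exact ⟨a, b, (hsub haK).1, (hsub hbK).2, fun x hx => ⟨ha (Or.inl hx), hb (Or.inl hx)⟩,
        fun x hx => ⟨ha (Or.inr hx), hb (Or.inr hx)⟩⟩
    have hk0 : ∀ x, x ∉ Icc a b → k x = 0 := fun x hx => by
      simp only [k]
      rw [image_eq_zero_of_notMem_tsupport fun h' => hx (hφab h'),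
        image_eq_zero_of_notMem_tsupport fun h' => hx (hψab h')]
      simp
    have hψ1 : ∫ s in Ioo 0 T, ψ s = 1 := by
      rw [setIntegral_eq_integral_of_forall_compl_eq_zero
        fun x hx => eq_zero_of_tsupport_subset hψT hx]
      exact β.integral_normed
    have hkI : ∫ s in (0 : ℝ)..T, k s = 0 := by
      rw [← integral_Ioo_eq_intervalIntegral hT.le]
      simp only [k]
      rw [integral_sub (integrable_vol_of_continuous h1.continuous)
        ((integrable_vol_of_continuous hβs.continuous).const_mul I), integral_const_mul, hψ1]
      simp [I]
    have hχ0 : ∀ x, x ∉ Icc a b → χ x = 0 := by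
      intro x hx
      rw [mem_Icc, not_and_or, not_le, not_le] at hx
      rcases hx with hx | hx
      · refine intervalIntegral.integral_zero_ae (Filter.Eventually.of_forall fun s hs => hk0 s ?_)
        intro hs'
        rcases hs with ⟨-, hs⟩
        rcases le_max_iff.1 hs with hs | hs <;> linarith [hs'.1]
      · have e : χ T - χ x = ∫ s in x..T, k s := intervalIntegral.integral_interval_sub_left
          (hk.continuous.intervalIntegrable _ _) (hk.continuous.intervalIntegrable _ _)
        have e2 : ∫ s in x..T, k s = 0 := by
          refine intervalIntegral.integral_zero_ae
            (Filter.Eventually.of_forall fun s hs => hk0 s ?_)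
          intro hs'
          rcases hs with ⟨hs, -⟩
          rcases min_lt_iff.1 hs with hs | hs <;> linarith [hs'.2]
        have e3 : χ T = 0 := hkI
        linarith
    have hχt : tsupport χ ⊆ Icc a b :=
      closure_minimal (fun x hx => by by_contra h'; exact hx (hχ0 x h')) isClosed_Icc
    have hw := h χ hχ (IsCompact.of_isClosed_subset isCompact_Icc (isClosed_tsupport _) hχt)
      (hχt.trans fun x hx => ⟨ha.trans_le hx.1, hx.2.trans_lt hb⟩)
    rw [hχ'] at hw
    have hi : Integrable (fun s => I • ψ s • f s) (vol T) :=
      (integrable_test_smul hβs.continuous hf).smul I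
    simp only [k, smul_zero, integral_zero, neg_zero, sub_smul, mul_smul] at hw
    rw [integral_sub (integrable_test_smul h1.continuous hf) hi, integral_smul, ← hc] at hw
    simp only [Pi.sub_apply, smul_sub]
    rw [integral_sub (integrable_test_smul h1.continuous hf)
      (integrable_test_smul h1.continuous (integrable_const c)), integral_smul_const, ← hI]
    exact hw
  filter_upwards [key] with t ht
  exact sub_eq_zero.1 ht

/-- A weakly differentiable function agrees almost everywhere with a primitive of its weak
derivative. -/
lemma HasWeakDeriv.exists_isPrimitiveOn (hT : 0 < T) {f g : ℝ → X} (h : HasWeakDeriv T f g)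
    (hf : Integrable f (vol T)) (hg : Integrable g (vol T)) :
    ∃ F, IsPrimitiveOn T F g ∧ F =ᵐ[vol T] f := by
  have hP : IsPrimitiveOn T (fun t => ∫ s in (0 : ℝ)..t, g s) g := ⟨hg, fun t _ => by simp⟩
  obtain ⟨c, hc⟩ := HasWeakDeriv.ae_const hT (f := fun t => f t - ∫ s in (0 : ℝ)..t, g s)
    (fun φ h1 h2 h3 => by
      have hd : Continuous (deriv φ) := h1.continuous_deriv (by simp)
      simp only [smul_sub]
      rw [integral_sub (integrable_test_smul hd hf) (integrable_test_smul hd hP.integrable_left),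
        h φ h1 h2 h3, hP.hasWeakDeriv hT φ h1 h2 h3]
      simp) (hf.sub hP.integrable_left)
  refine ⟨fun t => c + ∫ s in (0 : ℝ)..t, g s, ⟨hg, fun t _ => by simp⟩, ?_⟩
  filter_upwards [hc] with t ht
  rw [← ht, sub_add_cancel]

lemma eqOn_Icc_of_ae_eq_vol {X : Type*} [NormedAddCommGroup X] (hT : 0 < T) {f g : ℝ → X}
    (hf : ContinuousOn f (Icc 0 T)) (hg : ContinuousOn g (Icc 0 T)) (h : f =ᵐ[vol T] g) :
    EqOn f g (Icc 0 T) := by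
  refine Measure.eqOn_Icc_of_ae_eq volume hT.ne ?_ hf hg
  rw [← restrict_Ioo_eq_restrict_Icc]
  exact h

lemma HasWeakDeriv.isPrimitiveOn (hT : 0 < T) {f g : ℝ → X} (h : HasWeakDeriv T f g)
    (hf : ContinuousOn f (Icc 0 T)) (hg : Integrable g (vol T)) : IsPrimitiveOn T f g := by
  obtain ⟨F, hF, hFf⟩ := h.exists_isPrimitiveOn hT
    ((hf.integrableOn_Icc).mono_set Ioo_subset_Icc_self) hg
  exact hF.congr_left (eqOn_Icc_of_ae_eq_vol hT hF.continuousOn hf hFf)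

end Weak

/-! ### Continuous representatives of Sobolev functions -/

section Sobolev

variable {L : ℝ} {hL : 0 < L}

lemma isPrimitiveOn_pointVal (hL : 0 < L) {f g : L2 L} (h : HasWeakDeriv L f g) :
    IsPrimitiveOn L (pointVal f g) g ∧ pointVal f g =ᵐ[vol L] f := by
  obtain ⟨F, hF, hFf⟩ := h.exists_isPrimitiveOn hL (integrable_L2 f) (integrable_L2 g)
  have e : EqOn F (pointVal f g) (Icc 0 L) := by
    intro x hx
    have h1 : ∫ y in Ioo 0 L, (f y + ∫ s in y..x, g s) = ∫ _y in Ioo 0 L, F x := by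
      refine integral_congr_ae ?_
      filter_upwards [hFf, ae_restrict_mem measurableSet_Ioo] with y hy hy'
      rw [← hy, ← hF.sub_eq (Ioo_subset_Icc_self hy') hx]
      abel
    rw [pointVal, h1]
    simp [hL.le, hL.ne']
  refine ⟨hF.congr_left e, ?_⟩
  filter_upwards [hFf, ae_restrict_mem measurableSet_Ioo] with y hy hy'
  rw [← e (Ioo_subset_Icc_self hy'), hy]

lemma val_ae_eq (w : HTilde 2 L hL) : val w =ᵐ[vol L] w.1 0 :=
  (isPrimitiveOn_pointVal hL (w.2.1 0)).2

lemma isPrimitiveOn_slope (w : HTilde 2 L hL) : IsPrimitiveOn L (slope w) (w.1 2) :=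
  (isPrimitiveOn_pointVal hL (w.2.1 1)).1

lemma isPrimitiveOn_val (w : HTilde 2 L hL) : IsPrimitiveOn L (val w) (slope w) :=
  (isPrimitiveOn_pointVal hL (w.2.1 0)).1.congr_right
    (isPrimitiveOn_pointVal hL (w.2.1 1)).2.symm

lemma val_zero (w : HTilde 2 L hL) : val w 0 = 0 := w.2.2.1

lemma slope_zero (w : HTilde 2 L hL) : slope w 0 = 0 := w.2.2.2

variable (hL) in
/-- The `i`-th weak derivative as a continuous linear map. -/
def jetCLM {k : ℕ} (i : Fin (k + 1)) : HTilde k L hL →L[ℝ] L2 L :=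
  (PiLp.proj 2 (fun _ : Fin (k + 1) => L2 L) i).comp (HTilde k L hL).subtypeL

@[simp] lemma jetCLM_apply {k : ℕ} (i : Fin (k + 1)) (w : HTilde k L hL) :
    jetCLM hL i w = w.1 i := rfl

lemma norm_jet_le {k : ℕ} (i : Fin (k + 1)) (w : HTilde k L hL) : ‖w.1 i‖ ≤ ‖w‖ :=
  PiLp.norm_apply_le w.1 i

variable (hL) in
/-- Point evaluation `w ↦ w(x)` as a continuous linear map. -/
def valCLM {x : ℝ} (hx : x ∈ Icc 0 L) : HTilde 2 L hL →L[ℝ] ℝ :=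
  (⟨pointValL hx, continuous_pointValL hx⟩ : L2 L × L2 L →L[ℝ] ℝ).comp
    ((jetCLM hL 0).prod (jetCLM hL 1))

variable (hL) in
/-- Evaluation of the slope `w ↦ w_x(x)` as a continuous linear map. -/
def slopeCLM {x : ℝ} (hx : x ∈ Icc 0 L) : HTilde 2 L hL →L[ℝ] ℝ :=
  (⟨pointValL hx, continuous_pointValL hx⟩ : L2 L × L2 L →L[ℝ] ℝ).comp
    ((jetCLM hL 1).prod (jetCLM hL 2))

@[simp] lemma valCLM_apply {x : ℝ} (hx : x ∈ Icc 0 L) (w : HTilde 2 L hL) :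
    valCLM hL hx w = val w x := rfl

@[simp] lemma slopeCLM_apply {x : ℝ} (hx : x ∈ Icc 0 L) (w : HTilde 2 L hL) :
    slopeCLM hL hx w = slope w x := rfl

variable (hL) in
/-- The embedding `H̃⁴_0(0, L) ⊂ H̃²_0(0, L)` as a continuous linear map. -/
def toH2CLM : HTilde 4 L hL →L[ℝ] HTilde 2 L hL :=
  LinearMap.mkContinuous
    { toFun := toH2
      map_add' := fun u v => by
        ext1; ext1 i; fin_cases i <;> rfl
      map_smul' := fun c u => by
        ext1; ext1 i; fin_cases i <;> rfl } 1 fun u => by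
    have h1 : ‖toH2 u‖ ^ 2 ≤ ‖u‖ ^ 2 := by
      change ‖(toH2 u).1‖ ^ 2 ≤ ‖u.1‖ ^ 2
      rw [PiLp.norm_sq_eq_of_L2, PiLp.norm_sq_eq_of_L2]
      simp only [Fin.sum_univ_succ, toH2]
      simp
      positivity
    rw [one_mul]
    exact (sq_le_sq₀ (norm_nonneg _) (norm_nonneg _)).1 h1

@[simp] lemma toH2CLM_apply (u : HTilde 4 L hL) : toH2CLM hL u = toH2 u := rfl

lemma norm_toH2_le (u : HTilde 4 L hL) : ‖toH2 u‖ ≤ ‖u‖ := by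
  simpa using (toH2CLM hL).le_of_opNorm_le (LinearMap.mkContinuous_norm_le _ zero_le_one _) u

lemma norm_sq_L2 (f : L2 L) : ‖f‖ ^ 2 = ∫ x in Ioo 0 L, f x ^ 2 := by
  rw [← real_inner_self_eq_norm_sq, MeasureTheory.L2.inner_def]
  simp [sq]

lemma integrable_sq_L2 (f : L2 L) : Integrable (fun x => f x ^ 2) (vol L) :=
  (Lp.memLp f).integrable_sq

end Sobolev

/-! ### Estimates on one element -/

section Element

variable {L a b : ℝ} {r₀ r₁ r₂ : ℝ → ℝ}

lemma sq_integral_abs_le {f : ℝ → ℝ} (hab : a ≤ b) (hf : IntervalIntegrable f volume a b)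
    (hf2 : IntervalIntegrable (fun x => f x ^ 2) volume a b) :
    (∫ x in a..b, |f x|) ^ 2 ≤ (b - a) * ∫ x in a..b, f x ^ 2 := by
  rcases hab.eq_or_lt with rfl | hlt
  · simp
  set I := ∫ x in a..b, |f x| with hI
  have h0 : 0 ≤ ∫ x in a..b, ((b - a) * |f x| - I) ^ 2 :=
    intervalIntegral.integral_nonneg hab fun x _ => sq_nonneg _
  have e : ∫ x in a..b, ((b - a) * |f x| - I) ^ 2 =
      (b - a) ^ 2 * (∫ x in a..b, f x ^ 2) - 2 * (b - a) * I * I + (b - a) * I ^ 2 := by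
    have : ∀ x, ((b - a) * |f x| - I) ^ 2 =
        (b - a) ^ 2 * f x ^ 2 - 2 * (b - a) * I * |f x| + I ^ 2 := fun x => by
      rw [← sq_abs (f x)]; ring
    simp only [this]
    rw [intervalIntegral.integral_add ((hf2.const_mul _).sub (hf.abs.const_mul _))
      intervalIntegrable_const, intervalIntegral.integral_sub (hf2.const_mul _)
      (hf.abs.const_mul _), intervalIntegral.integral_const_mul,
      intervalIntegral.integral_const_mul, intervalIntegral.integral_const, smul_eq_mul]
  rw [e] at h0
  have hd : 0 < b - a := sub_pos.2 hlt
  have : 0 ≤ (b - a) * ((b - a) * (∫ x in a..b, f x ^ 2) - I ^ 2) := by nlinarith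
  nlinarith [(mul_nonneg_iff_of_pos_left hd).1 this]

/-- A function with vanishing Cauchy data at the left end of an interval of length `h` has
`L²` norm at most `h²` times that of its second derivative. -/
lemma integral_sq_le_of_left_zero (h₀ : IsPrimitiveOn L r₀ r₁) (h₁ : IsPrimitiveOn L r₁ r₂)
    (h₂ : MemLp r₂ 2 (vol L)) (ha : a ∈ Icc 0 L) (hb : b ∈ Icc 0 L) (hab : a ≤ b)
    (ha₀ : r₀ a = 0) (ha₁ : r₁ a = 0) :
    ∫ x in a..b, r₀ x ^ 2 ≤ (b - a) ^ 4 * ∫ x in a..b, r₂ x ^ 2 := by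
  have hi₂ := intervalIntegrable_of_vol h₁.integrable ha hb
  have hs₂ := intervalIntegrable_of_vol h₂.integrable_sq ha hb
  set I := ∫ x in a..b, |r₂ x| with hI
  have hI0 : 0 ≤ I := intervalIntegral.integral_nonneg hab fun x _ => abs_nonneg _
  have hsub : Icc a b ⊆ Icc 0 L := Icc_subset_Icc ha.1 hb.2
  have b₁ : ∀ x ∈ Icc a b, |r₁ x| ≤ I := fun x hx => by
    have := h₁.sub_eq ha (hsub hx)
    rw [ha₁, sub_zero] at this
    rw [this]
    refine (intervalIntegral.abs_integral_le_integral_abs hx.1).trans ?_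
    exact intervalIntegral.integral_mono_interval le_rfl hx.1 hx.2
      (Filter.Eventually.of_forall fun _ => abs_nonneg _) hi₂.abs
  have b₀ : ∀ x ∈ Icc a b, |r₀ x| ≤ (b - a) * I := fun x hx => by
    have := h₀.sub_eq ha (hsub hx)
    rw [ha₀, sub_zero] at this
    rw [this, ← Real.norm_eq_abs]
    refine (intervalIntegral.norm_integral_le_of_norm_le_const (C := I) fun y hy => ?_).trans ?_
    · rw [uIoc_of_le hx.1] at hy
      exact b₁ y ⟨hy.1.le, hy.2.trans hx.2⟩
    · rw [abs_of_nonneg (sub_nonneg.2 hx.1), mul_comm]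
      gcongr
      exact hx.2
  have hd : 0 ≤ b - a := sub_nonneg.2 hab
  have hc := (h₀.continuousOn.mono hsub).pow 2
  rw [← uIcc_of_le hab] at hc
  calc ∫ x in a..b, r₀ x ^ 2 ≤ ∫ _x in a..b, ((b - a) * I) ^ 2 :=
        intervalIntegral.integral_mono_on hab hc.intervalIntegrable intervalIntegrable_const
          fun x hx => sq_le_sq' (abs_le.1 (b₀ x hx)).1 (abs_le.1 (b₀ x hx)).2
    _ = (b - a) ^ 3 * I ^ 2 := by
        rw [intervalIntegral.integral_const, smul_eq_mul]; ring
    _ ≤ (b - a) ^ 3 * ((b - a) * ∫ x in a..b, r₂ x ^ 2) := by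
        gcongr
        exact sq_integral_abs_le hab hi₂ hs₂
    _ = _ := by ring

lemma isPrimitiveOn_affine (α β : ℝ) : IsPrimitiveOn L (fun x => α * x + β) fun _ => α :=
  .of_hasDerivAt (by fun_prop) (fun x _ => by
    simpa using ((hasDerivAt_id x).const_mul α).add_const β) (integrable_const α)

/-- If the Cauchy data of `r₀` vanish at both ends of an interval, then `r₀''` is orthogonal to the
affine functions. -/
lemma integral_mul_affine_eq_zero (h₀ : IsPrimitiveOn L r₀ r₁) (h₁ : IsPrimitiveOn L r₁ r₂)
    (ha : a ∈ Icc 0 L) (hb : b ∈ Icc 0 L) (ha₀ : r₀ a = 0) (ha₁ : r₁ a = 0) (hb₀ : r₀ b = 0)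
    (hb₁ : r₁ b = 0) (α β : ℝ) : ∫ x in a..b, r₂ x * (α * x + β) = 0 := by
  have h := ((h₁.bilin (ContinuousLinearMap.mul ℝ ℝ) (isPrimitiveOn_affine α β)).sub
    (h₀.clm (ContinuousLinearMap.mul ℝ ℝ α))).sub_eq ha hb
  simp only [ContinuousLinearMap.mul_apply', ha₀, hb₀, ha₁, hb₁, zero_mul, mul_zero,
    sub_self] at h
  rw [h]
  refine intervalIntegral.integral_congr fun x _ => ?_
  ring

/-- Best approximation: if `r₀''` differs from `g` by an affine function, and the Cauchy data of
`r₀` vanish at both ends, then `r₀''` is no larger in `L²` than the difference of `g` to any affine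
function. -/
lemma integral_sq_le_affine_approx (h₀ : IsPrimitiveOn L r₀ r₁) (h₁ : IsPrimitiveOn L r₁ r₂)
    (h₂ : MemLp r₂ 2 (vol L)) (ha : a ∈ Icc 0 L) (hb : b ∈ Icc 0 L) (hab : a ≤ b)
    (ha₀ : r₀ a = 0) (ha₁ : r₁ a = 0) (hb₀ : r₀ b = 0) (hb₁ : r₁ b = 0) {g : ℝ → ℝ}
    (hg : MemLp g 2 (vol L))
    {α β : ℝ} (hr : ∀ᵐ x, x ∈ Ioo a b → r₂ x = g x - (α * x + β)) (α' β' : ℝ) :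
    ∫ x in a..b, r₂ x ^ 2 ≤ ∫ x in a..b, (g x - (α' * x + β')) ^ 2 := by
  have hg' : MemLp (fun x => g x - (α' * x + β')) 2 (vol L) :=
    hg.sub (memLp_of_cont (by fun_prop))
  have hs := intervalIntegrable_of_vol h₂.integrable_sq ha hb
  have hs' := intervalIntegrable_of_vol hg'.integrable_sq ha hb
  have ho := integral_mul_affine_eq_zero h₀ h₁ ha hb ha₀ ha₁ hb₀ hb₁ (α' - α) (β' - β)
  have hi : IntervalIntegrable (fun x => r₂ x * ((α' - α) * x + (β' - β))) volume a b :=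
    (intervalIntegrable_of_vol h₁.integrable ha hb).mul_continuousOn (by fun_prop)
  have hr' : ∀ᵐ x, x ∈ uIoc a b → r₂ x = g x - (α * x + β) := by
    filter_upwards [hr, Measure.ae_ne volume b] with x hx hxb hx'
    rw [uIoc_of_le hab] at hx'
    exact hx ⟨hx'.1, lt_of_le_of_ne hx'.2 hxb⟩
  have key : ∫ x in a..b, r₂ x ^ 2 ≤ ∫ x in a..b, (1 / 2 * r₂ x ^ 2 +
      1 / 2 * (g x - (α' * x + β')) ^ 2 + r₂ x * ((α' - α) * x + (β' - β))) := by
    refine intervalIntegral.integral_mono_ae_restrict hab hs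
      (((hs.const_mul _).add (hs'.const_mul _)).add hi) ?_
    rw [Filter.EventuallyLE, ae_restrict_iff' measurableSet_Icc]
    filter_upwards [hr', Measure.ae_ne volume a] with x hx hxa hx'
    have e := hx (by rw [uIoc_of_le hab]; exact ⟨lt_of_le_of_ne hx'.1 hxa.symm, hx'.2⟩)
    have : g x - (α' * x + β') = r₂ x - ((α' - α) * x + (β' - β)) := by rw [e]; ring
    rw [this]
    nlinarith [sq_nonneg ((α' - α) * x + (β' - β))]
  rw [intervalIntegral.integral_add ((hs.const_mul _).add (hs'.const_mul _)) hi,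
    intervalIntegral.integral_add (hs.const_mul _) (hs'.const_mul _), ho,
    intervalIntegral.integral_const_mul, intervalIntegral.integral_const_mul] at key
  linarith

end Element

/-! ### Hermite interpolation -/

section Interpolation

variable {L : ℝ} {hL : 0 < L} {N : ℕ}

lemma val_mkHTilde {f f₁ f₂ : ℝ → ℝ} (hf : Continuous f) (hf₁ : Continuous f₁)
    (hf₂ : MemLp f₂ 2 (vol L)) (hd : ∀ x, HasDerivWithinAt f (f₁ x) (Ioi x) x)
    (hd₁ : ∀ x, HasDerivWithinAt f₁ (f₂ x) (Ioi x) x) (h0 : f 0 = 0) (h1 : f₁ 0 = 0)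
    {x : ℝ} (hx : x ∈ Icc 0 L) :
    val (mkHTilde hL f f₁ f₂ hf hf₁ hf₂ hd hd₁ h0 h1) x = f x :=
  pointVal_of_right hL hf hd (memLp_of_cont hf) (memLp_of_cont hf₁) hx

lemma slope_mkHTilde {f f₁ f₂ : ℝ → ℝ} (hf : Continuous f) (hf₁ : Continuous f₁)
    (hf₂ : MemLp f₂ 2 (vol L)) (hd : ∀ x, HasDerivWithinAt f (f₁ x) (Ioi x) x)
    (hd₁ : ∀ x, HasDerivWithinAt f₁ (f₂ x) (Ioi x) x) (h0 : f 0 = 0) (h1 : f₁ 0 = 0)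
    {x : ℝ} (hx : x ∈ Icc 0 L) :
    slope (mkHTilde hL f f₁ f₂ hf hf₁ hf₂ hd hd₁ h0 h1) x = f₁ x :=
  pointVal_of_right hL hf₁ hd₁ (memLp_of_cont hf₁) hf₂ hx

lemma mkHTilde_two_ae_eq {f f₁ f₂ : ℝ → ℝ} (hf : Continuous f) (hf₁ : Continuous f₁)
    (hf₂ : MemLp f₂ 2 (vol L)) (hd : ∀ x, HasDerivWithinAt f (f₁ x) (Ioi x) x)
    (hd₁ : ∀ x, HasDerivWithinAt f₁ (f₂ x) (Ioi x) x) (h0 : f 0 = 0) (h1 : f₁ 0 = 0) :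
    (mkHTilde hL f f₁ f₂ hf hf₁ hf₂ hd hd₁ h0 h1).1 2 =ᵐ[vol L] f₂ :=
  hf₂.coeFn_toLp

lemma hermiteVal_two_ae_eq (m : Fin N) : (hermiteVal hL m).1 2 =ᵐ[vol L] fun x =>
    1 / meshSize L N / meshSize L N * shapeVal₂ ((x - node L N m) / meshSize L N) := by
  rw [hermiteVal]
  exact mkHTilde_two_ae_eq _ _ _ _ _ _ _

lemma hermiteSlope_two_ae_eq (m : Fin N) : (hermiteSlope hL m).1 2 =ᵐ[vol L] fun x =>
    meshSize L N / meshSize L N / meshSize L N *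
      shapeSlope₂ ((x - node L N m) / meshSize L N) := by
  rw [hermiteSlope]
  exact mkHTilde_two_ae_eq _ _ _ _ _ _ _

lemma mul_meshSize_mem {k : ℕ} (hL : 0 ≤ L) (hk : k ≤ N) : (k : ℝ) * meshSize L N ∈ Icc 0 L := by
  rcases N.eq_zero_or_pos with rfl | hN
  · simpa [meshSize] using hL
  have hN' : (0 : ℝ) < N := by exact_mod_cast hN
  refine ⟨by positivity, ?_⟩
  rw [meshSize, ← mul_div_assoc, div_le_iff₀ hN', mul_comm]
  gcongr

lemma node_mem (hL : 0 ≤ L) (m : Fin N) : node L N m ∈ Icc 0 L := by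
  have := mul_meshSize_mem (N := N) hL (k := m + 1) m.2
  simpa [node] using this

lemma node_sub_div (hL : 0 < L) (j m : Fin N) :
    (node L N j - node L N m) / meshSize L N = ((j - m : ℤ) : ℝ) := by
  have h := (meshSize_pos hL m).ne'
  rw [div_eq_iff h]
  push_cast
  unfold node
  ring

lemma shape_int (z : ℤ) : shapeVal z = (if z = 0 then 1 else 0) ∧ shapeVal₁ z = 0 ∧
    shapeSlope z = 0 ∧ shapeSlope₁ z = if z = 0 then 1 else 0 := by
  unfold shapeVal shapeVal₁ shapeSlope shapeSlope₁
  rcases eq_or_ne z 0 with rfl | hz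
  · simp
  have h1 : (1 : ℝ) ≤ |(z : ℝ)| := by exact_mod_cast Int.one_le_abs hz
  by_cases h : |(z : ℝ)| ≤ 1
  · have e : |(z : ℝ)| = 1 := le_antisymm h h1
    simp [e, hz]
  · simp [h, hz]

lemma val_hermiteVal (m j : Fin N) :
    val (hermiteVal hL m) (node L N j) = if j = m then 1 else 0 := by
  rw [hermiteVal, val_mkHTilde _ _ _ _ _ _ _ (node_mem hL.le j),
    node_sub_div hL, (shape_int _).1, one_mul]
  simp [sub_eq_zero, Fin.ext_iff]

lemma slope_hermiteVal (m j : Fin N) : slope (hermiteVal hL m) (node L N j) = 0 := by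
  rw [hermiteVal, slope_mkHTilde _ _ _ _ _ _ _ (node_mem hL.le j),
    node_sub_div hL, (shape_int _).2.1, mul_zero]

lemma val_hermiteSlope (m j : Fin N) : val (hermiteSlope hL m) (node L N j) = 0 := by
  rw [hermiteSlope, val_mkHTilde _ _ _ _ _ _ _ (node_mem hL.le j),
    node_sub_div hL, (shape_int _).2.2.1, mul_zero]

lemma slope_hermiteSlope (m j : Fin N) :
    slope (hermiteSlope hL m) (node L N j) = if j = m then 1 else 0 := by
  rw [hermiteSlope, slope_mkHTilde _ _ _ _ _ _ _ (node_mem hL.le j),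
    node_sub_div hL, (shape_int _).2.2.2, div_self (meshSize_pos hL m).ne']
  simp [sub_eq_zero, Fin.ext_iff]

variable (hL N) in
/-- The nodal projection as a continuous linear map. -/
def nodalCLM : HTilde 2 L hL →L[ℝ] HTilde 2 L hL :=
  ∑ m : Fin N, ((valCLM hL (node_mem hL.le m)).smulRight (hermiteVal hL m) +
    (slopeCLM hL (node_mem hL.le m)).smulRight (hermiteSlope hL m))

@[simp] lemma nodalCLM_apply (w : HTilde 2 L hL) : nodalCLM hL N w = nodalProj N w := by
  simp [nodalCLM, nodalProj]

lemma nodalProj_mem (w : HTilde 2 L hL) : nodalProj N w ∈ hermiteSpace hL N :=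
  Submodule.sum_mem _ fun m _ => add_mem
    (Submodule.smul_mem _ _ (Submodule.subset_span (Or.inl ⟨m, rfl⟩)))
    (Submodule.smul_mem _ _ (Submodule.subset_span (Or.inr ⟨m, rfl⟩)))

lemma val_nodalProj (w : HTilde 2 L hL) (j : Fin N) :
    val (nodalProj N w) (node L N j) = val w (node L N j) := by
  rw [← valCLM_apply (node_mem hL.le j), nodalProj, map_sum]
  simp only [map_add, map_smul]
  simp [val_hermiteVal, val_hermiteSlope]

lemma slope_nodalProj (w : HTilde 2 L hL) (j : Fin N) :
    slope (nodalProj N w) (node L N j) = slope w (node L N j) := by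
  rw [← slopeCLM_apply (node_mem hL.le j), nodalProj, map_sum]
  simp only [map_add, map_smul]
  simp [slope_hermiteVal, slope_hermiteSlope]

/-- The interpolation error has vanishing Cauchy data at every node. -/
lemma val_slope_sub_nodalProj (w : HTilde 2 L hL) {k : ℕ} (hk : k ≤ N) :
    val (w - nodalProj N w) (k * meshSize L N) = 0 ∧
      slope (w - nodalProj N w) (k * meshSize L N) = 0 := by
  rcases k with _ | k
  · simp [val_zero, slope_zero]
  have e : ((k + 1 : ℕ) : ℝ) * meshSize L N = node L N ⟨k, hk⟩ := by simp [node]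
  rw [e, ← valCLM_apply (node_mem hL.le _), ← slopeCLM_apply (node_mem hL.le _), map_sub, map_sub]
  simp [val_nodalProj, slope_nodalProj]

/-- The interpolation error has vanishing Cauchy data at the tip. -/
lemma val_slope_sub_nodalProj_tip (hN : 0 < N) (w : HTilde 2 L hL) :
    val (w - nodalProj N w) L = 0 ∧ slope (w - nodalProj N w) L = 0 := by
  have h := val_slope_sub_nodalProj w le_rfl (N := N)
  have e : (N : ℝ) * meshSize L N = L := by
    rw [meshSize, mul_div_cancel₀]
    exact_mod_cast hN.ne'
  rwa [e] at h

lemma shape_affine (z : ℤ) :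
    (∃ α β : ℝ, ∀ s ∈ Ioo (z : ℝ) (z + 1), shapeVal₂ s = α * s + β) ∧
      ∃ α β : ℝ, ∀ s ∈ Ioo (z : ℝ) (z + 1), shapeSlope₂ s = α * s + β := by
  unfold shapeVal₂ shapeSlope₂
  rcases lt_trichotomy z (-1) with hz | rfl | hz
  · have hz' : (z : ℝ) ≤ -2 := by exact_mod_cast (by lia : z ≤ -2)
    refine ⟨⟨0, 0, fun s hs => ?_⟩, ⟨0, 0, fun s hs => ?_⟩⟩ <;>
    · have := hs.2
      grind
  · refine ⟨⟨-12, -6, fun s hs => ?_⟩, ⟨6, 4, fun s hs => ?_⟩⟩ <;>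
    · have h1 := hs.1
      have h2 := hs.2
      push_cast at h1 h2
      try rw [abs_of_neg (by linarith)]
      grind
  rcases eq_or_ne z 0 with rfl | hz0
  · refine ⟨⟨12, -6, fun s hs => ?_⟩, ⟨6, -4, fun s hs => ?_⟩⟩ <;>
    · have h1 := hs.1
      have h2 := hs.2
      push_cast at h1 h2
      try rw [abs_of_pos (by linarith)]
      grind
  · have hz' : (1 : ℝ) ≤ z := by exact_mod_cast (by lia : 1 ≤ z)
    refine ⟨⟨0, 0, fun s hs => ?_⟩, ⟨0, 0, fun s hs => ?_⟩⟩ <;>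
    · have := hs.1
      grind

lemma scale_affine {f : ℝ → ℝ} (hf : ∀ z : ℤ, ∃ α β : ℝ, ∀ s ∈ Ioo (z : ℝ) (z + 1),
    f s = α * s + β) (hL : 0 < L) (m : Fin N) (k : ℕ) (c : ℝ) :
    ∃ α β : ℝ, ∀ x ∈ Ioo (k * meshSize L N) ((k + 1 : ℕ) * meshSize L N),
      c * f ((x - node L N m) / meshSize L N) = α * x + β := by
  obtain ⟨α, β, h⟩ := hf (k - m - 1)
  have hh := meshSize_pos hL m
  refine ⟨c * (α / meshSize L N), c * (β - α * node L N m / meshSize L N), fun x hx => ?_⟩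
  rw [h _ ⟨?_, ?_⟩]
  · field_simp
    ring
  · rw [lt_div_iff₀ hh]
    push_cast
    unfold node
    linarith [hx.1]
  · rw [div_lt_iff₀ hh]
    have := hx.2
    push_cast at this ⊢
    unfold node
    linarith

/-- On each element, the second derivative of the nodal projection is affine. -/
lemma nodalProj_affine (w : HTilde 2 L hL) (k : ℕ) : ∃ α β : ℝ, ∀ᵐ x ∂(vol L),
    x ∈ Ioo (k * meshSize L N) ((k + 1 : ℕ) * meshSize L N) →
      (nodalProj N w).1 2 x = α * x + β := by
  set I := Ioo (k * meshSize L N) ((k + 1 : ℕ) * meshSize L N) with hI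
  have hadd : ∀ f g : L2 L, (∃ α β : ℝ, ∀ᵐ x ∂(vol L), x ∈ I → f x = α * x + β) →
      (∃ α β : ℝ, ∀ᵐ x ∂(vol L), x ∈ I → g x = α * x + β) →
      ∃ α β : ℝ, ∀ᵐ x ∂(vol L), x ∈ I → (f + g : L2 L) x = α * x + β := by
    rintro f g ⟨α, β, h⟩ ⟨α', β', h'⟩
    refine ⟨α + α', β + β', ?_⟩
    filter_upwards [h, h', Lp.coeFn_add f g] with x h1 h2 h3 hx
    rw [h3, Pi.add_apply, h1 hx, h2 hx]
    ring
  have hsmul : ∀ (c : ℝ) (f : L2 L), (∃ α β : ℝ, ∀ᵐ x ∂(vol L), x ∈ I → f x = α * x + β) →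
      ∃ α β : ℝ, ∀ᵐ x ∂(vol L), x ∈ I → (c • f : L2 L) x = α * x + β := by
    rintro c f ⟨α, β, h⟩
    refine ⟨c * α, c * β, ?_⟩
    filter_upwards [h, Lp.coeFn_smul c f] with x h1 h3 hx
    rw [h3, Pi.smul_apply, h1 hx, smul_eq_mul]
    ring
  have hzero : ∃ α β : ℝ, ∀ᵐ x ∂(vol L), x ∈ I → (0 : L2 L) x = α * x + β := by
    refine ⟨0, 0, ?_⟩
    filter_upwards [Lp.coeFn_zero ℝ 2 (vol L)] with x hx _
    rw [hx]
    simp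
  rw [← jetCLM_apply, nodalProj, map_sum]
  refine Finset.sum_induction _ _ hadd hzero fun m _ => ?_
  rw [map_add, map_smul, map_smul]
  refine hadd _ _ (hsmul _ _ ?_) (hsmul _ _ ?_)
  · obtain ⟨α, β, h⟩ := scale_affine (fun z => (shape_affine z).1) hL m k
      (1 / meshSize L N / meshSize L N)
    refine ⟨α, β, ?_⟩
    filter_upwards [hermiteVal_two_ae_eq (hL := hL) m] with x hx hxI
    exact hx.trans (h x hxI)
  · obtain ⟨α, β, h⟩ := scale_affine (fun z => (shape_affine z).2) hL m k
      (meshSize L N / meshSize L N / meshSize L N)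
    refine ⟨α, β, ?_⟩
    filter_upwards [hermiteSlope_two_ae_eq (hL := hL) m] with x hx hxI
    exact hx.trans (h x hxI)

/-- Estimates on all elements add up to an estimate on `(0, L)`. -/
lemma norm_le_of_forall_element (hL : 0 < L) (hN : 0 < N) {f g : L2 L} {c : ℝ} (hc : 0 ≤ c)
    (h : ∀ k < N, ∫ x in (k * meshSize L N)..((k + 1 : ℕ) * meshSize L N), f x ^ 2 ≤
      c ^ 2 * ∫ x in (k * meshSize L N)..((k + 1 : ℕ) * meshSize L N), g x ^ 2) :
    ‖f‖ ≤ c * ‖g‖ := by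
  have key : ∀ f : L2 L, ‖f‖ ^ 2 = ∑ k ∈ Finset.range N,
      ∫ x in (k * meshSize L N)..((k + 1 : ℕ) * meshSize L N), f x ^ 2 := fun f => by
    rw [intervalIntegral.sum_integral_adjacent_intervals
      (a := fun k : ℕ => (k : ℝ) * meshSize L N) fun k hk =>
        intervalIntegrable_of_vol (integrable_sq_L2 f) (mul_meshSize_mem hL.le hk.le)
          (mul_meshSize_mem hL.le hk)]
    have e : (N : ℝ) * meshSize L N = L := by
      rw [meshSize, mul_div_cancel₀]
      exact_mod_cast hN.ne'
    rw [e, Nat.cast_zero, zero_mul, norm_sq_L2, integral_Ioo_eq_intervalIntegral hL.le]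
  have h2 : ‖f‖ ^ 2 ≤ (c * ‖g‖) ^ 2 := by
    rw [mul_pow, key f, key g, Finset.mul_sum]
    exact Finset.sum_le_sum fun k hk => h k (Finset.mem_range.1 hk)
  exact (sq_le_sq₀ (norm_nonneg _) (by positivity)).1 h2

/-- On each element, the second derivative of the interpolation error is no larger than the
difference of `w''` to any affine function. -/
lemma integral_sq_sub_nodalProj_le (hN : 0 < N) (w : HTilde 2 L hL) {k : ℕ} (hk : k < N)
    (α β : ℝ) :
    ∫ x in (k * meshSize L N)..((k + 1 : ℕ) * meshSize L N), (w - nodalProj N w).1 2 x ^ 2 ≤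
      ∫ x in (k * meshSize L N)..((k + 1 : ℕ) * meshSize L N), (w.1 2 x - (α * x + β)) ^ 2 := by
  have hh : 0 < meshSize L N := div_pos hL (by exact_mod_cast hN)
  obtain ⟨α₀, β₀, h⟩ := nodalProj_affine (N := N) w k
  have h₀ := val_slope_sub_nodalProj w hk.le
  have h₁ := val_slope_sub_nodalProj (N := N) w hk
  refine integral_sq_le_affine_approx (isPrimitiveOn_val _) (isPrimitiveOn_slope _) (Lp.memLp _)
    (mul_meshSize_mem hL.le hk.le) (mul_meshSize_mem hL.le hk) (by gcongr; simp)
    h₀.1 h₀.2 h₁.1 h₁.2 (Lp.memLp _) (α := α₀) (β := β₀) ?_ α β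
  have h' := (ae_restrict_iff' measurableSet_Ioo).1 (h.and
    (Lp.coeFn_sub (w.1 2) ((nodalProj N w).1 2)))
  filter_upwards [h'] with x hx hxI
  obtain ⟨e1, e2⟩ := hx ⟨(mul_meshSize_mem hL.le hk.le).1.trans_lt hxI.1,
    hxI.2.trans_le (mul_meshSize_mem hL.le hk).2⟩
  rw [← e1 hxI]
  exact e2

/-- Interpolation estimate `‖w - w̃‖_{L²} ≤ h² ‖w''‖_{L²}`. -/
lemma norm_sub_nodalProj_zero_le (hN : 0 < N) (w : HTilde 2 L hL) :
    ‖(w - nodalProj N w).1 0‖ ≤ meshSize L N ^ 2 * ‖w.1 2‖ := by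
  have hh : 0 < meshSize L N := div_pos hL (by exact_mod_cast hN)
  refine norm_le_of_forall_element hL hN (by positivity) fun k hk => ?_
  have ha := mul_meshSize_mem (N := N) hL.le hk.le
  have hb := mul_meshSize_mem (N := N) hL.le (k := k + 1) hk
  have h₀ := val_slope_sub_nodalProj w hk.le
  have e1 : ∫ x in (k * meshSize L N)..((k + 1 : ℕ) * meshSize L N),
      (w - nodalProj N w).1 0 x ^ 2 = ∫ x in (k * meshSize L N)..((k + 1 : ℕ) * meshSize L N),
      val (w - nodalProj N w) x ^ 2 := by
    refine intervalIntegral.integral_congr_ae ?_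
    filter_upwards [ae_uIoc_of_ae_vol (val_ae_eq (w - nodalProj N w)) ha hb] with x hx hx'
    rw [hx hx']
  have e2 : ((k + 1 : ℕ) : ℝ) * meshSize L N - k * meshSize L N = meshSize L N := by
    push_cast; ring
  have key := integral_sq_le_of_left_zero (isPrimitiveOn_val (w - nodalProj N w))
    (isPrimitiveOn_slope _) (Lp.memLp _) ha hb (by gcongr; simp) h₀.1 h₀.2
  rw [e1]
  refine key.trans ?_
  rw [e2, ← pow_mul]
  gcongr
  simpa using integral_sq_sub_nodalProj_le hN w hk 0 0

/-- Interpolation estimate `‖(u - ũ)''‖_{L²} ≤ h² ‖u''''‖_{L²}`. On each element, `u''` is compared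
with its Taylor polynomial of degree one at the left node. -/
lemma norm_sub_nodalProj_two_le (hN : 0 < N) (u : HTilde 4 L hL) :
    ‖(toH2 u - nodalProj N (toH2 u)).1 2‖ ≤ meshSize L N ^ 2 * ‖u.1 4‖ := by
  have hh : 0 < meshSize L N := div_pos hL (by exact_mod_cast hN)
  obtain ⟨p₂, q₂⟩ := isPrimitiveOn_pointVal hL (u.2.1 2)
  obtain ⟨p₃, q₃⟩ := isPrimitiveOn_pointVal hL (u.2.1 3)
  set f₂ := pointVal (u.1 (Fin.castSucc 2)) (u.1 (Fin.succ 2))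
  set f₃ := pointVal (u.1 (Fin.castSucc 3)) (u.1 (Fin.succ 3))
  refine norm_le_of_forall_element hL hN (by positivity) fun k hk => ?_
  have ha := mul_meshSize_mem (N := N) hL.le hk.le
  have hb := mul_meshSize_mem (N := N) hL.le (k := k + 1) hk
  set a := (k : ℝ) * meshSize L N with ha'
  set b := ((k + 1 : ℕ) : ℝ) * meshSize L N with hb'
  have e2 : b - a = meshSize L N := by simp only [a, b]; push_cast; ring
  have hab : a ≤ b := by linarith
  refine (integral_sq_sub_nodalProj_le hN (toH2 u) hk (f₃ a) (f₂ a - f₃ a * a)).trans ?_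
  have e1 : ∫ x in a..b, ((toH2 u).1 2 x - (f₃ a * x + (f₂ a - f₃ a * a))) ^ 2 =
      ∫ x in a..b, (f₂ x - (f₃ a * x + (f₂ a - f₃ a * a))) ^ 2 := by
    refine intervalIntegral.integral_congr_ae ?_
    filter_upwards [ae_uIoc_of_ae_vol q₂ ha hb] with x hx hx'
    rw [hx hx']
    rfl
  rw [e1]
  have s₀ := (p₂.congr_right q₃.symm).sub (isPrimitiveOn_affine (L := L) (f₃ a) (f₂ a - f₃ a * a))
  have s₁ : IsPrimitiveOn L (fun x => f₃ x - f₃ a) (u.1 4) := by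
    simpa using p₃.sub (isPrimitiveOn_affine (L := L) 0 (f₃ a))
  have key := integral_sq_le_of_left_zero s₀ s₁ (Lp.memLp _) ha hb hab (by ring) (by ring)
  rwa [e2, show meshSize L N ^ 4 = (meshSize L N ^ 2) ^ 2 by ring] at key

end Interpolation

/-! ### The energy as a quadratic form -/

section Forms

variable {L : ℝ}

lemma integrable_weight_mul {m : ℝ → ℝ} (hm : ContinuousOn m (Icc 0 L)) (f g : L2 L) :
    Integrable (fun x => m x * (f x * g x)) (vol L) := by
  obtain ⟨C, hC⟩ := isCompact_Icc.exists_bound_of_continuousOn hm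
  refine (ContinuousLinearMap.mul ℝ ℝ).integrable_of_bilin_of_bdd_left C
    ((hm.aestronglyMeasurable measurableSet_Icc).mono_set Ioo_subset_Icc_self) ?_
    ((Lp.memLp f).integrable_mul (Lp.memLp g))
  filter_upwards [ae_restrict_mem measurableSet_Ioo] with s hs using hC s (Ioo_subset_Icc_self hs)

lemma abs_integral_weight_le {m : ℝ → ℝ} {C : ℝ} (hC : ∀ x ∈ Icc 0 L, |m x| ≤ C) (f g : L2 L) :
    |∫ x in Ioo 0 L, m x * (f x * g x)| ≤ C * ‖f‖ * ‖g‖ := by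
  rcases lt_or_ge L 0 with hL | hL
  · have e : vol L = 0 := by simp [vol, Ioo_eq_empty (not_lt.2 hL.le)]
    have hz : ∀ f : L2 L, ‖f‖ = 0 := fun f => by simp [Lp.norm_def, e]
    simp [e, hz]
  have hC0 : 0 ≤ C := (abs_nonneg _).trans (hC 0 (left_mem_Icc.2 hL))
  have h1 : ∫ x in Ioo 0 L, |f x| * |g x| ≤ ‖f‖ * ‖g‖ := by
    have h := real_inner_le_norm |f| |g|
    rw [norm_abs_eq_norm, norm_abs_eq_norm, MeasureTheory.L2.inner_def] at h
    refine le_of_eq_of_le (integral_congr_ae ?_) h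
    filter_upwards [Lp.coeFn_abs f, Lp.coeFn_abs g] with x h1 h2
    rw [h1, h2]
    simp [mul_comm]
  calc |∫ x in Ioo 0 L, m x * (f x * g x)| ≤ ∫ x in Ioo 0 L, C * (|f x| * |g x|) := by
        rw [← Real.norm_eq_abs]
        refine norm_integral_le_of_norm_le
          (((Lp.memLp f).abs.integrable_mul (Lp.memLp g).abs).const_mul C) ?_
        filter_upwards [ae_restrict_mem measurableSet_Ioo] with x hx
        rw [norm_mul, norm_mul, Real.norm_eq_abs, Real.norm_eq_abs, Real.norm_eq_abs]
        gcongr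
        exact hC x (Ioo_subset_Icc_self hx)
    _ = C * ∫ x in Ioo 0 L, |f x| * |g x| := integral_const_mul _ _
    _ ≤ C * (‖f‖ * ‖g‖) := by gcongr
    _ = C * ‖f‖ * ‖g‖ := by ring

/-- The weighted `L²` pairing `(f, g) ↦ ∫ m f g` with a continuous weight `m`. -/
def weighted {m : ℝ → ℝ} (hm : ContinuousOn m (Icc 0 L)) : L2 L →L[ℝ] L2 L →L[ℝ] ℝ :=
  LinearMap.mkContinuous₂
    (LinearMap.mk₂ ℝ (fun f g : L2 L => ∫ x in Ioo 0 L, m x * (f x * g x))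
      (fun f f' g => by
        rw [← integral_add (integrable_weight_mul hm f g) (integrable_weight_mul hm f' g)]
        refine integral_congr_ae ?_
        filter_upwards [Lp.coeFn_add f f'] with x hx
        rw [hx, Pi.add_apply]; ring)
      (fun c f g => by
        rw [smul_eq_mul, ← integral_const_mul]
        refine integral_congr_ae ?_
        filter_upwards [Lp.coeFn_smul c f] with x hx
        rw [hx, Pi.smul_apply, smul_eq_mul]; ring)
      (fun f g g' => by
        rw [← integral_add (integrable_weight_mul hm f g) (integrable_weight_mul hm f g')]
        refine integral_congr_ae ?_
        filter_upwards [Lp.coeFn_add g g'] with x hx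
        rw [hx, Pi.add_apply]; ring)
      (fun c f g => by
        rw [smul_eq_mul, ← integral_const_mul]
        refine integral_congr_ae ?_
        filter_upwards [Lp.coeFn_smul c g] with x hx
        rw [hx, Pi.smul_apply, smul_eq_mul]; ring))
    (isCompact_Icc.exists_bound_of_continuousOn hm).choose fun f g =>
      abs_integral_weight_le (isCompact_Icc.exists_bound_of_continuousOn hm).choose_spec f g

lemma weighted_apply {m : ℝ → ℝ} (hm : ContinuousOn m (Icc 0 L)) (f g : L2 L) :
    weighted hm f g = ∫ x in Ioo 0 L, m x * (f x * g x) := rfl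

lemma weighted_comm {m : ℝ → ℝ} (hm : ContinuousOn m (Icc 0 L)) (f g : L2 L) :
    weighted hm f g = weighted hm g f := by
  simp only [weighted_apply, mul_comm]

lemma mul_norm_sq_le_weighted {m : ℝ → ℝ} (hm : ContinuousOn m (Icc 0 L)) {c : ℝ}
    (hc : ∀ x ∈ Icc 0 L, c ≤ m x) (f : L2 L) : c * ‖f‖ ^ 2 ≤ weighted hm f f := by
  rw [weighted_apply, norm_sq_L2, ← integral_const_mul]
  refine integral_mono_ae ((integrable_sq_L2 f).const_mul c) (integrable_weight_mul hm f f) ?_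
  filter_upwards [ae_restrict_mem measurableSet_Ioo] with x hx
  rw [← sq]
  exact mul_le_mul_of_nonneg_right (hc x (Ioo_subset_Icc_self hx)) (sq_nonneg _)

variable {n : ℕ} (B : Beam) (K₁ K₂ : Controller n)

/-- The form `a` as a continuous bilinear form on `H̃²_0(0, L)`. -/
def aBilin : B.Ht 2 →L[ℝ] B.Ht 2 →L[ℝ] ℝ :=
  (weighted B.Λ_smooth.continuousOn).bilinearComp (jetCLM B.L_pos 2) (jetCLM B.L_pos 2)
    + K₁.k • (ContinuousLinearMap.mul ℝ ℝ).bilinearComp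
      (slopeCLM B.L_pos (right_mem_Icc.2 B.L_pos.le))
      (slopeCLM B.L_pos (right_mem_Icc.2 B.L_pos.le))
    + K₂.k • (ContinuousLinearMap.mul ℝ ℝ).bilinearComp
      (valCLM B.L_pos (right_mem_Icc.2 B.L_pos.le)) (valCLM B.L_pos (right_mem_Icc.2 B.L_pos.le))

/-- The inner product of `H` as a continuous bilinear form on `H̃²_0(0, L)`. -/
def hBilin : B.Ht 2 →L[ℝ] B.Ht 2 →L[ℝ] ℝ :=
  B.J • (ContinuousLinearMap.mul ℝ ℝ).bilinearComp
      (slopeCLM B.L_pos (right_mem_Icc.2 B.L_pos.le))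
      (slopeCLM B.L_pos (right_mem_Icc.2 B.L_pos.le))
    + B.M • (ContinuousLinearMap.mul ℝ ℝ).bilinearComp
      (valCLM B.L_pos (right_mem_Icc.2 B.L_pos.le)) (valCLM B.L_pos (right_mem_Icc.2 B.L_pos.le))
    + (weighted B.μ_smooth.continuousOn).bilinearComp (jetCLM B.L_pos 0) (jetCLM B.L_pos 0)

/-- The form `(ζ, ξ) ↦ ζ · P ξ` as a continuous bilinear form. -/
def matrixBilin (P : Matrix (Fin n) (Fin n) ℝ) : (Fin n → ℝ) →L[ℝ] (Fin n → ℝ) →L[ℝ] ℝ :=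
  (Matrix.toLinearMap₂' ℝ P).toContinuousBilinearMap

variable {B}

lemma aBilin_eq_weighted (u w : B.Ht 2) : aBilin B K₁ K₂ u w =
    weighted B.Λ_smooth.continuousOn (u.1 2) (w.1 2) + K₁.k * (slope u B.L * slope w B.L)
      + K₂.k * (val u B.L * val w B.L) := rfl

lemma aBilin_apply (u w : B.Ht 2) : aBilin B K₁ K₂ u w = aForm B K₁ K₂ u w := by
  rw [aBilin_eq_weighted, aForm, weighted_apply, mul_assoc, mul_assoc]

lemma hBilin_eq_weighted (u w : B.Ht 2) : hBilin B u w =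
    B.J * (slope u B.L * slope w B.L) + B.M * (val u B.L * val w B.L) +
      weighted B.μ_smooth.continuousOn (u.1 0) (w.1 0) := rfl

lemma hBilin_apply (u w : B.Ht 2) : hBilin B u w = innerH B (hat u) (hat w) := by
  rw [hBilin_eq_weighted, innerH, weighted_apply, ← mul_assoc, ← mul_assoc]
  rfl

lemma matrixBilin_apply (P : Matrix (Fin n) (Fin n) ℝ) (ζ ξ : Fin n → ℝ) :
    matrixBilin P ζ ξ = ζ ⬝ᵥ P.mulVec ξ := by
  rw [matrixBilin, LinearMap.toContinuousBilinearMap_apply, Matrix.toLinearMap₂'_apply']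

lemma aBilin_comm (u w : B.Ht 2) : aBilin B K₁ K₂ u w = aBilin B K₁ K₂ w u := by
  rw [aBilin_eq_weighted, aBilin_eq_weighted, weighted_comm]; ring

lemma hBilin_comm (u w : B.Ht 2) : hBilin B u w = hBilin B w u := by
  rw [hBilin_eq_weighted, hBilin_eq_weighted, weighted_comm]; ring

lemma dotProduct_mulVec_comm {P : Matrix (Fin n) (Fin n) ℝ} (hP : P.PosDef) (ζ ξ : Fin n → ℝ) :
    ζ ⬝ᵥ P.mulVec ξ = ξ ⬝ᵥ P.mulVec ζ := by
  have hs : P.transpose = P := by simpa using hP.isHermitian.eq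
  rw [Matrix.dotProduct_mulVec, ← Matrix.mulVec_transpose, hs, dotProduct_comm]

lemma matrixBilin_comm {P : Matrix (Fin n) (Fin n) ℝ} (hP : P.PosDef) (ζ ξ : Fin n → ℝ) :
    matrixBilin P ζ ξ = matrixBilin P ξ ζ := by
  rw [matrixBilin_apply, matrixBilin_apply, dotProduct_mulVec_comm hP]

lemma matrixBilin_self_nonneg {P : Matrix (Fin n) (Fin n) ℝ} (hP : P.PosDef) (ζ : Fin n → ℝ) :
    0 ≤ matrixBilin P ζ ζ := by
  rw [matrixBilin_apply]
  simpa using hP.posSemidef.dotProduct_mulVec_nonneg ζ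

lemma mul_norm_sq_le_aBilin {K₁ K₂ : Controller n} (h₁ : 0 < K₁.k) (h₂ : 0 < K₂.k) {c : ℝ}
    (hc : ∀ x ∈ Icc 0 B.L, c ≤ B.Λ x) (u : B.Ht 2) :
    c * ‖u.1 2‖ ^ 2 ≤ aBilin B K₁ K₂ u u := by
  rw [aBilin_eq_weighted]
  have := mul_norm_sq_le_weighted B.Λ_smooth.continuousOn hc (u.1 2)
  have := mul_nonneg h₁.le (mul_self_nonneg (slope u B.L))
  have := mul_nonneg h₂.le (mul_self_nonneg (val u B.L))
  linarith

lemma mul_norm_sq_le_hBilin {c : ℝ} (hc : ∀ x ∈ Icc 0 B.L, c ≤ B.μ x) (v : B.Ht 2) :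
    c * ‖v.1 0‖ ^ 2 ≤ hBilin B v v := by
  rw [hBilin_eq_weighted]
  have := mul_norm_sq_le_weighted B.μ_smooth.continuousOn hc (v.1 0)
  have := mul_nonneg B.J_pos.le (mul_self_nonneg (slope v B.L))
  have := mul_nonneg B.M_pos.le (mul_self_nonneg (val v B.L))
  linarith

lemma aBilin_self_nonneg {K₁ K₂ : Controller n} (h₁ : 0 < K₁.k) (h₂ : 0 < K₂.k) (u : B.Ht 2) :
    0 ≤ aBilin B K₁ K₂ u u := by
  simpa using mul_norm_sq_le_aBilin h₁ h₂ (c := 0) (fun x hx => (B.Λ_pos x hx).le) u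

lemma hBilin_self_nonneg (v : B.Ht 2) : 0 ≤ hBilin B v v := by
  simpa using mul_norm_sq_le_hBilin (c := 0) (fun x hx => (B.μ_pos x hx).le) v

lemma energy_eq (P₁ P₂ : Matrix (Fin n) (Fin n) ℝ) (u v : B.Ht 2) (ζ₁ ζ₂ : Fin n → ℝ) :
    energy B K₁ K₂ P₁ P₂ u v ζ₁ ζ₂ = 1 / 2 * aBilin B K₁ K₂ u u + 1 / 2 * hBilin B v v
      + 1 / 2 * matrixBilin P₁ ζ₁ ζ₁ + 1 / 2 * matrixBilin P₂ ζ₂ ζ₂ := by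
  have e : ∫ x in Ioo 0 B.L, (B.Λ x * (u.1 2 x) ^ 2 + B.μ x * (v.1 0 x) ^ 2) =
      weighted B.Λ_smooth.continuousOn (u.1 2) (u.1 2)
        + weighted B.μ_smooth.continuousOn (v.1 0) (v.1 0) := by
    simp only [sq]
    exact integral_add (integrable_weight_mul B.Λ_smooth.continuousOn _ _)
      (integrable_weight_mul B.μ_smooth.continuousOn _ _)
  rw [energy, e, aBilin_eq_weighted, hBilin_eq_weighted, matrixBilin_apply, matrixBilin_apply]
  ring

lemma apply_add_add_le {E : Type*} [NormedAddCommGroup E] [NormedSpace ℝ E]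
    (b : E →L[ℝ] E →L[ℝ] ℝ) (h : ∀ x, 0 ≤ b x x) (x y : E) :
    b (x + y) (x + y) ≤ 2 * b x x + 2 * b y y := by
  have h1 := h (x - y)
  simp only [map_add, map_sub, add_apply, sub_apply] at h1 ⊢
  linarith

variable {K₁ K₂} {P₁ P₂ : Matrix (Fin n) (Fin n) ℝ}

lemma energy_nonneg (h₁ : 0 < K₁.k) (h₂ : 0 < K₂.k) (hP₁ : P₁.PosDef) (hP₂ : P₂.PosDef)
    (u v : B.Ht 2) (ζ₁ ζ₂ : Fin n → ℝ) : 0 ≤ energy B K₁ K₂ P₁ P₂ u v ζ₁ ζ₂ := by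
  rw [energy_eq]
  have := aBilin_self_nonneg h₁ h₂ u
  have := hBilin_self_nonneg v
  have := matrixBilin_self_nonneg hP₁ ζ₁
  have := matrixBilin_self_nonneg hP₂ ζ₂
  positivity

lemma energy_add_le (h₁ : 0 < K₁.k) (h₂ : 0 < K₂.k) (hP₁ : P₁.PosDef) (hP₂ : P₂.PosDef)
    (u v u' v' : B.Ht 2) (ζ₁ ζ₂ : Fin n → ℝ) :
    energy B K₁ K₂ P₁ P₂ (u + u') (v + v') ζ₁ ζ₂ ≤
      2 * energy B K₁ K₂ P₁ P₂ u v ζ₁ ζ₂ + 2 * energy B K₁ K₂ P₁ P₂ u' v' 0 0 := by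
  simp only [energy_eq]
  have := apply_add_add_le _ (aBilin_self_nonneg h₁ h₂) u u'
  have := apply_add_add_le _ hBilin_self_nonneg v v'
  have := matrixBilin_self_nonneg hP₁ ζ₁
  have := matrixBilin_self_nonneg hP₂ ζ₂
  simp only [map_zero]
  linarith

/-- The triangle inequality for the square root of the energy, up to a factor. -/
lemma sqrt_energy_add_le (h₁ : 0 < K₁.k) (h₂ : 0 < K₂.k) (hP₁ : P₁.PosDef) (hP₂ : P₂.PosDef)
    (u v u' v' : B.Ht 2) (ζ₁ ζ₂ : Fin n → ℝ) :
    Real.sqrt (energy B K₁ K₂ P₁ P₂ (u + u') (v + v') ζ₁ ζ₂) ≤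
      2 * Real.sqrt (energy B K₁ K₂ P₁ P₂ u v ζ₁ ζ₂)
        + 2 * Real.sqrt (energy B K₁ K₂ P₁ P₂ u' v' 0 0) := by
  have e1 := Real.sq_sqrt (energy_nonneg h₁ h₂ hP₁ hP₂ u v ζ₁ ζ₂)
  have e2 := Real.sq_sqrt (energy_nonneg h₁ h₂ hP₁ hP₂ u' v' 0 0)
  have p1 := Real.sqrt_nonneg (energy B K₁ K₂ P₁ P₂ u v ζ₁ ζ₂)
  have p2 := Real.sqrt_nonneg (energy B K₁ K₂ P₁ P₂ u' v' 0 0)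
  refine Real.sqrt_le_iff.2 ⟨by positivity, ?_⟩
  have := energy_add_le h₁ h₂ hP₁ hP₂ u v u' v' ζ₁ ζ₂
  nlinarith [mul_nonneg p1 p2]

lemma isPrimitiveOn_energy (hP₁ : P₁.PosDef) (hP₂ : P₂.PosDef) {T : ℝ} {u u' v v' : ℝ → B.Ht 2}
    {ζ₁ ζ₁' ζ₂ ζ₂' : ℝ → Fin n → ℝ} (hu : IsPrimitiveOn T u u') (hv : IsPrimitiveOn T v v')
    (hζ₁ : IsPrimitiveOn T ζ₁ ζ₁') (hζ₂ : IsPrimitiveOn T ζ₂ ζ₂') :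
    IsPrimitiveOn T (fun t => energy B K₁ K₂ P₁ P₂ (u t) (v t) (ζ₁ t) (ζ₂ t))
      fun t => aBilin B K₁ K₂ (u t) (u' t) + hBilin B (v' t) (v t)
        + matrixBilin P₁ (ζ₁ t) (ζ₁' t) + matrixBilin P₂ (ζ₂ t) (ζ₂' t) := by
  have key : ∀ {E : Type _} [NormedAddCommGroup E] [NormedSpace ℝ E] [CompleteSpace E]
      (b : E →L[ℝ] E →L[ℝ] ℝ) {f g : ℝ → E}, IsPrimitiveOn T f g →
      IsPrimitiveOn T (fun t => 1 / 2 * b (f t) (f t))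
        (fun t => 1 / 2 * (b (g t) (f t) + b (f t) (g t))) :=
    fun b f g h => (h.bilin b h).clm (ContinuousLinearMap.mul ℝ ℝ (1 / 2))
  have h := (((key (aBilin B K₁ K₂) hu).add (key (hBilin B) hv)).add
    (key (matrixBilin P₁) hζ₁)).add (key (matrixBilin P₂) hζ₂)
  refine (h.congr_left fun t _ => (energy_eq ..).symm).congr_right
    (Filter.Eventually.of_forall fun t => ?_)
  simp only
  rw [aBilin_comm K₁ K₂ (u' t), hBilin_comm (v t), matrixBilin_comm hP₁ (ζ₁' t),
    matrixBilin_comm hP₂ (ζ₂' t)]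
  ring

end Forms

section Dissipation

variable {n : ℕ} {K : Controller n} {δ : ℝ} {P : Matrix (Fin n) (Fin n) ℝ}

/-- A controller dissipates energy: the rate of change of `½ ζ · P ζ` does not exceed the supplied
power `(c · ζ + d y) y`. This is the positive real lemma: by the Lur'e equations the difference is
`-½ (q · ζ + √(2 (d - δ)) y)² - ½ ε ζ · P ζ - δ y²`. -/
lemma Controller.IsWeight.dissipation (h : K.IsWeight δ P) (hδ : 0 ≤ δ) (hd : δ ≤ K.d)
    (ζ : Fin n → ℝ) (y : ℝ) :
    matrixBilin P ζ (K.A.mulVec ζ + y • K.b) - K.d * y * y - (K.c ⬝ᵥ ζ) * y ≤ 0 := by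
  obtain ⟨hP, ε, hε, q, h1, h2⟩ := h
  have hnn := matrixBilin_self_nonneg hP ζ
  rw [matrixBilin_apply] at hnn
  have hs : Real.sqrt (2 * (K.d - δ)) ^ 2 = 2 * (K.d - δ) := Real.sq_sqrt (by linarith)
  set s := Real.sqrt (2 * (K.d - δ))
  have e1 : ζ ⬝ᵥ (P * K.A + K.A.transpose * P).mulVec ζ = 2 * (ζ ⬝ᵥ P.mulVec (K.A.mulVec ζ)) := by
    rw [Matrix.add_mulVec, dotProduct_add, ← Matrix.mulVec_mulVec, ← Matrix.mulVec_mulVec,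
      Matrix.dotProduct_mulVec ζ K.A.transpose, Matrix.vecMul_transpose,
      dotProduct_mulVec_comm hP (K.A.mulVec ζ)]
    ring
  have e2 : ζ ⬝ᵥ (P * K.A + K.A.transpose * P).mulVec ζ =
      -(q ⬝ᵥ ζ) ^ 2 - ε * (ζ ⬝ᵥ P.mulVec ζ) := by
    rw [h1, Matrix.sub_mulVec, dotProduct_sub, Matrix.neg_mulVec, dotProduct_neg,
      Matrix.smul_mulVec, dotProduct_smul, Matrix.vecMulVec_mulVec, smul_eq_mul]
    simp [dotProduct_comm ζ q, sq]
  have e3 : ζ ⬝ᵥ P.mulVec K.b = K.c ⬝ᵥ ζ - s * (q ⬝ᵥ ζ) := by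
    rw [h2, dotProduct_sub, dotProduct_smul, smul_eq_mul, dotProduct_comm ζ q,
      dotProduct_comm ζ K.c]
  have e4 : matrixBilin P ζ (K.A.mulVec ζ + y • K.b) =
      ζ ⬝ᵥ P.mulVec (K.A.mulVec ζ) + y * (ζ ⬝ᵥ P.mulVec K.b) := by
    rw [matrixBilin_apply, Matrix.mulVec_add, Matrix.mulVec_smul, dotProduct_add, dotProduct_smul,
      smul_eq_mul]
  rw [e4, e3]
  have e5 := e1.symm.trans e2
  nlinarith [sq_nonneg (q ⬝ᵥ ζ + s * y), mul_nonneg hε.le hnn, mul_nonneg hδ (sq_nonneg y)]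

end Dissipation

/-! ### Integral inequalities in time -/

section TimeEstimates

variable {T : ℝ}

/-- If `G' ≤ 2 g √G`, then `√G` grows by at most a multiple of `∫ g`; the point is that the maximum
of `√G` can be divided out. -/
lemma sqrt_le_of_deriv_le {G G' g : ℝ → ℝ} (hG : IsPrimitiveOn T G G')
    (hG0 : ∀ t ∈ Icc 0 T, 0 ≤ G t) (hg : Integrable g (vol T)) (hg0 : ∀ t, 0 ≤ g t)
    (hle : ∀ᵐ t ∂(vol T), G' t ≤ 2 * g t * Real.sqrt (G t)) {t : ℝ} (ht : t ∈ Icc 0 T) :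
    Real.sqrt (G t) ≤ Real.sqrt (G 0) + 2 * ∫ s in (0 : ℝ)..T, g s := by
  have hT : 0 ≤ T := ht.1.trans ht.2
  have h0 : (0 : ℝ) ∈ Icc 0 T := ⟨le_rfl, hT⟩
  obtain ⟨r, hr, hmax⟩ := isCompact_Icc.exists_isMaxOn ⟨t, ht⟩ hG.continuousOn.sqrt
  have hM : ∀ s ∈ Icc 0 T, Real.sqrt (G s) ≤ Real.sqrt (G r) := fun s hs => hmax hs
  set m := Real.sqrt (G r) with hm
  have hm0 : 0 ≤ m := Real.sqrt_nonneg _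
  have hgi := fun {a b : ℝ} (ha : a ∈ Icc 0 T) (hb : b ∈ Icc 0 T) =>
    intervalIntegrable_of_vol hg ha hb
  have h1 : G r - G 0 ≤ 2 * m * ∫ s in (0 : ℝ)..r, g s := by
    rw [hG.sub_eq h0 hr, ← intervalIntegral.integral_const_mul]
    refine intervalIntegral.integral_mono_ae_restrict hr.1
      (intervalIntegrable_of_vol hG.integrable h0 hr) ((hgi h0 hr).const_mul _) ?_
    have := ae_restrict_of_ae_restrict_of_subset (Ioo_subset_Ioo_right hr.2) hle
    rw [restrict_Ioo_eq_restrict_Icc] at this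
    filter_upwards [this, ae_restrict_mem measurableSet_Icc] with s hs hs'
    refine hs.trans ?_
    have := hM s ⟨hs'.1, hs'.2.trans hr.2⟩
    nlinarith [hg0 s, mul_le_mul_of_nonneg_left this (hg0 s)]
  have h2 : ∫ s in (0 : ℝ)..r, g s ≤ ∫ s in (0 : ℝ)..T, g s :=
    intervalIntegral.integral_mono_interval le_rfl hr.1 hr.2
      (Filter.Eventually.of_forall hg0) (hgi h0 (right_mem_Icc.2 hT))
  set I := ∫ s in (0 : ℝ)..T, g s with hI
  have hI0 : 0 ≤ I := intervalIntegral.integral_nonneg hT fun s _ => hg0 s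
  have e1 : m ^ 2 = G r := Real.sq_sqrt (hG0 r hr)
  have e2 : Real.sqrt (G 0) ^ 2 = G 0 := Real.sq_sqrt (hG0 0 h0)
  have e3 : 0 ≤ Real.sqrt (G 0) := Real.sqrt_nonneg _
  have e4 : Real.sqrt (G 0) ≤ m := hM 0 h0
  have e5 : m ^ 2 ≤ Real.sqrt (G 0) ^ 2 + 2 * m * I := by
    nlinarith [mul_le_mul_of_nonneg_left h2 hm0]
  refine (hM t ht).trans ?_
  by_contra! hlt
  nlinarith [mul_le_mul_of_nonneg_left e4 e3]

variable {X : Type*} [NormedAddCommGroup X]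

lemma integral_norm_le_sqrt_mul_lpNorm (hT : 0 ≤ T) {f : ℝ → X} (hf : MemLp f 2 (vol T)) :
    ∫ t in (0 : ℝ)..T, ‖f t‖ ≤ Real.sqrt T * lpNorm f 2 (vol T) := by
  have h0 : (0 : ℝ) ∈ Icc 0 T := ⟨le_rfl, hT⟩
  have hTT : T ∈ Icc 0 T := ⟨hT, le_rfl⟩
  have hn : MemLp (fun t => ‖f t‖) 2 (vol T) := hf.norm
  have h1 := sq_integral_abs_le hT
    (intervalIntegrable_of_vol (hn.integrable (by norm_num)) h0 hTT)
    (intervalIntegrable_of_vol hn.integrable_sq h0 hTT)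
  simp only [abs_norm, sub_zero] at h1
  have h2 : lpNorm f 2 (vol T) ^ 2 = ∫ t in (0 : ℝ)..T, ‖f t‖ ^ 2 := by
    rw [lpNorm_eq_integral_norm_rpow_toReal (by norm_num) (by norm_num) hf.aestronglyMeasurable,
      ← integral_Ioo_eq_intervalIntegral hT, ← Real.rpow_natCast, ← Real.rpow_mul
        (integral_nonneg fun _ => by positivity)]
    norm_num
  refine Real.le_sqrt_of_sq_le ?_ |>.trans_eq ?_ (b := Real.sqrt (T * lpNorm f 2 (vol T) ^ 2))
  · rw [h2]; exact h1
  · rw [Real.sqrt_mul hT, Real.sqrt_sq lpNorm_nonneg]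

lemma norm_le_integral_norm [NormedSpace ℝ X] (hT : 0 < T) {f g : ℝ → X}
    (h : IsPrimitiveOn T f g) {t : ℝ} (ht : t ∈ Icc 0 T) :
    ‖f t‖ ≤ 1 / T * (∫ s in (0 : ℝ)..T, ‖f s‖) + ∫ s in (0 : ℝ)..T, ‖g s‖ := by
  have h0 : (0 : ℝ) ∈ Icc 0 T := ⟨le_rfl, hT.le⟩
  have hTT : T ∈ Icc 0 T := ⟨hT.le, le_rfl⟩
  have hgi := intervalIntegrable_of_vol h.integrable.norm h0 hTT
  have hfi := intervalIntegrable_of_vol h.integrable_left.norm h0 hTT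
  have key : ∀ s ∈ Icc 0 T, ‖f t‖ ≤ ‖f s‖ + ∫ s in (0 : ℝ)..T, ‖g s‖ := fun s hs => by
    have e : f t = f s + (f t - f s) := by abel
    rw [e, h.sub_eq hs ht]
    refine (norm_add_le _ _).trans (add_le_add_right ?_ _)
    refine intervalIntegral.norm_integral_le_integral_norm_uIoc.trans ?_
    rw [intervalIntegral.integral_of_le hT.le]
    refine setIntegral_mono_set ((intervalIntegrable_iff_integrableOn_Ioc_of_le hT.le).1 hgi)
      (Filter.Eventually.of_forall fun _ => norm_nonneg _) (LE.le.eventuallyLE ?_)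
    exact Ioc_subset_Ioc (le_min hs.1 ht.1) (max_le hs.2 ht.2)
  have := intervalIntegral.integral_mono_on hT.le (f := fun _ => ‖f t‖) intervalIntegrable_const
    (hfi.add intervalIntegrable_const) key
  rw [intervalIntegral.integral_add hfi intervalIntegrable_const, intervalIntegral.integral_const,
    intervalIntegral.integral_const, sub_zero, smul_eq_mul, smul_eq_mul] at this
  rw [← mul_le_mul_iff_right₀ hT]
  field_simp
  linarith

end TimeEstimates

/-! ### The exact and the semidiscrete solution -/

section Solutions

variable {n : ℕ} {B : Beam} {K₁ K₂ : Controller n} {T : ℝ}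

lemma HasWeakDeriv.congr_left {X : Type*} [NormedAddCommGroup X] [NormedSpace ℝ X]
    {f f' g : ℝ → X} (h : HasWeakDeriv T f g) (e : f =ᵐ[vol T] f') : HasWeakDeriv T f' g := by
  intro φ h1 h2 h3
  rw [← h φ h1 h2 h3]
  refine integral_congr_ae ?_
  filter_upwards [e] with t ht
  rw [ht]

lemma integrable_apply_of_memLp {X : Type*} [NormedAddCommGroup X] [NormedSpace ℝ X]
    {q : ℝ → StrongDual ℝ X} (hq : MemLp q 2 (vol T)) (w : X) :
    Integrable (fun t => q t w) (vol T) :=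
  ((ContinuousLinearMap.apply ℝ ℝ w).comp_memLp' hq).integrable (by norm_num)

/-- The map `w ↦ ŵ` as a continuous linear map. -/
def hatCLM (B : Beam) : B.Ht 2 →L[ℝ] PivotH B :=
  (slopeCLM B.L_pos (right_mem_Icc.2 B.L_pos.le)).prod
    ((valCLM B.L_pos (right_mem_Icc.2 B.L_pos.le)).prod (jetCLM B.L_pos 0))

/-- The weak formulation, tested with finite elements only, for a solution `u` with two time
derivatives `v` and `a` in `H̃²_0`: the functional `û_tt` is then given by the inner product of `H`.
Since `W_h` has finitely many generators, a single null set of times suffices. -/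
lemma IsWeakSolution.strong {u v a : ℝ → B.Ht 2} {ζ₁ ζ₂ : ℝ → Fin n → ℝ} {u₀ : B.Ht 2}
    {v₀ : PivotH B} {ζ₁₀ ζ₂₀ : Fin n → ℝ} (hT : 0 < T)
    (h : IsWeakSolution B K₁ K₂ T u ζ₁ ζ₂ u₀ v₀ ζ₁₀ ζ₂₀) (hu : IsPrimitiveOn T u v)
    (hv : IsPrimitiveOn T v a) (N : ℕ) :
    (∀ᵐ t ∂(vol T), ∀ w ∈ hermiteSpace B.L_pos N,
      hBilin B (a t) w + aBilin B K₁ K₂ (u t) w + bForm K₁ K₂ (hat (v t)) (hat w)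
        + (K₁.c ⬝ᵥ ζ₁ t) * slope w B.L + (K₂.c ⬝ᵥ ζ₂ t) * val w B.L = 0) ∧
    IsPrimitiveOn T ζ₁ (fun t => K₁.A.mulVec (ζ₁ t) + slope (v t) B.L • K₁.b) ∧
    IsPrimitiveOn T ζ₂ (fun t => K₂.A.mulVec (ζ₂ t) + val (v t) B.L • K₂.b) := by
  obtain ⟨p, q, ζ₁', ζ₂', -, hp, hq, hdp, hdq, -, hζ₁', hdζ₁, -, hζ₂', hdζ₂, heq, ho₁, ho₂, -, -, -,
    hc₁, -, hc₂, -⟩ := h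
  have hpi : Integrable p (vol T) := hp.integrable (by norm_num)
  have hhat : IsPrimitiveOn T (fun t => hat (u t)) (fun t => hat (v t)) := hu.clm (hatCLM B)
  have hpv : p =ᵐ[vol T] fun t => hat (v t) :=
    hdp.unique (hhat.hasWeakDeriv hT) hpi hhat.integrable
  have hqa : ∀ w : B.Ht 2, ∀ᵐ t ∂(vol T), q t w = hBilin B (a t) w := fun w => by
    have hb : IsPrimitiveOn T (fun t => hBilin B (v t) w) (fun t => hBilin B (a t) w) :=
      hv.clm ((hBilin B).flip w)
    refine HasWeakDeriv.unique ((hdq w).congr_left ?_) (hb.hasWeakDeriv hT)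
      (integrable_apply_of_memLp (X := B.Ht 2) hq w) hb.integrable
    filter_upwards [hpv] with t ht
    rw [ht, hBilin_apply]
  have hqspan : ∀ᵐ t ∂(vol T), ∀ w ∈ hermiteSpace B.L_pos N, q t w = hBilin B (a t) w := by
    filter_upwards [ae_all_iff.2 fun m : Fin N => hqa (hermiteVal B.L_pos m),
      ae_all_iff.2 fun m : Fin N => hqa (hermiteSlope B.L_pos m)] with t h1 h2 w hw
    refine LinearMap.eqOn_span (f := (q t : B.Ht 2 →ₗ[ℝ] ℝ))
      (g := (hBilin B (a t) : B.Ht 2 →ₗ[ℝ] ℝ)) ?_ hw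
    rintro _ (⟨m, rfl⟩ | ⟨m, rfl⟩)
    · exact h1 m
    · exact h2 m
  refine ⟨?_, ?_, ?_⟩
  · filter_upwards [heq, hqspan, hpv] with t h1 h2 h3 w hw
    have := h1 w
    rwa [h2 w hw, h3, ← aBilin_apply] at this
  · refine (hdζ₁.isPrimitiveOn hT hc₁ (hζ₁'.integrable (by norm_num))).congr_right ?_
    filter_upwards [ho₁, hpv] with t h1 h2
    rw [h1, h2]
    rfl
  · refine (hdζ₂.isPrimitiveOn hT hc₂ (hζ₂'.integrable (by norm_num))).congr_right ?_
    filter_upwards [ho₂, hpv] with t h1 h2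
    rw [h1, h2]
    rfl

lemma isPrimitiveOn_of_contDiffOn {X : Type*} [NormedAddCommGroup X] [NormedSpace ℝ X]
    [CompleteSpace X] {f : ℝ → X} (hf : ContDiffOn ℝ 1 f (Ici 0)) :
    IsPrimitiveOn T f (derivWithin f (Ici 0)) := by
  have hc := hf.continuousOn_derivWithin (uniqueDiffOn_Ici 0) le_rfl
  refine .of_hasDerivAt (hf.continuousOn.mono Icc_subset_Ici_self) (fun t ht => ?_)
    (((hc.mono Icc_subset_Ici_self).integrableOn_Icc).mono_set Ioo_subset_Icc_self)
  exact ((hf.differentiableOn one_ne_zero) t ht.1.le).hasDerivWithinAt.hasDerivAt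
    (Ici_mem_nhds ht.1)

/-- The semidiscrete equations, in terms of the one-sided derivatives `v` of `u` and `a` of `v`,
which are continuous up to `t = 0`. -/
lemma IsSemidiscreteSolution.strong {N : ℕ} {u : ℝ → B.Ht 2} {ζ₁ ζ₂ : ℝ → Fin n → ℝ}
    {u₀ v₀ : B.Ht 2} {ζ₁₀ ζ₂₀ : Fin n → ℝ}
    (h : IsSemidiscreteSolution B K₁ K₂ N u ζ₁ ζ₂ u₀ v₀ ζ₁₀ ζ₂₀) :
    ∃ v a : ℝ → B.Ht 2, IsPrimitiveOn T u v ∧ IsPrimitiveOn T v a ∧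
      (∀ t, 0 ≤ t → v t ∈ hermiteSpace B.L_pos N) ∧
      (∀ t, 0 < t → ∀ w ∈ hermiteSpace B.L_pos N,
        hBilin B (a t) w + aBilin B K₁ K₂ (u t) w + bForm K₁ K₂ (hat (v t)) (hat w)
          + (K₁.c ⬝ᵥ ζ₁ t) * slope w B.L + (K₂.c ⬝ᵥ ζ₂ t) * val w B.L = 0) ∧
      IsPrimitiveOn T ζ₁ (fun t => K₁.A.mulVec (ζ₁ t) + slope (v t) B.L • K₁.b) ∧
      IsPrimitiveOn T ζ₂ (fun t => K₂.A.mulVec (ζ₂ t) + val (v t) B.L • K₂.b) := by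
  have hs := h.smooth.derivWithin (uniqueDiffOn_Ici 0) (m := 1) (by norm_num)
  have e1 : ∀ t, 0 < t → deriv u t = derivWithin u (Ici 0) t := fun t ht =>
    (derivWithin_of_mem_nhds (Ici_mem_nhds ht)).symm
  have e2 : ∀ t, 0 < t →
      deriv (deriv u) t = derivWithin (derivWithin u (Ici 0)) (Ici 0) t := fun t ht => by
    rw [derivWithin_of_mem_nhds (Ici_mem_nhds ht)]
    refine Filter.EventuallyEq.deriv_eq ?_
    filter_upwards [Ioi_mem_nhds ht] with s hs using e1 s hs
  refine ⟨derivWithin u (Ici 0), derivWithin (derivWithin u (Ici 0)) (Ici 0),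
    isPrimitiveOn_of_contDiffOn (h.smooth.of_le (by norm_num)), isPrimitiveOn_of_contDiffOn hs,
    fun t ht => ?_, fun t ht w hw => ?_, ?_, ?_⟩
  · have hfin : FiniteDimensional ℝ (hermiteSpace B.L_pos N) :=
      FiniteDimensional.span_of_finite ℝ ((finite_range _).union (finite_range _))
    have hclosed : IsClosed (hermiteSpace B.L_pos N : Set (B.Ht 2)) :=
      (hermiteSpace B.L_pos N).closed_of_finiteDimensional
    have hsub := range_derivWithin_subset_closure_span_image u (s := Ici 0) (t := Ici 0)
      (by simp)
    refine closure_minimal ?_ hclosed (hsub ⟨t, rfl⟩)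
    refine Submodule.span_le.2 ?_
    rintro _ ⟨s, hs, rfl⟩
    exact h.mem s hs
  · have := h.galerkin t ht w hw
    rwa [← hBilin_apply, ← aBilin_apply, e2 t ht, e1 t ht] at this
  · refine (isPrimitiveOn_of_contDiffOn h.smooth₁).congr_right ?_
    filter_upwards [ae_restrict_mem measurableSet_Ioo] with t ht
    rw [← e1 t ht.1, ← h.ode₁ t ht.1, derivWithin_of_mem_nhds (Ici_mem_nhds ht.1)]
  · refine (isPrimitiveOn_of_contDiffOn h.smooth₂).congr_right ?_
    filter_upwards [ae_restrict_mem measurableSet_Ioo] with t ht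
    rw [← e1 t ht.1, ← h.ode₂ t ht.1, derivWithin_of_mem_nhds (Ici_mem_nhds ht.1)]

end Solutions

/-! ### The energy of the error -/

section ErrorEnergy

variable {n : ℕ} {B : Beam} {K₁ K₂ : Controller n} {P₁ P₂ : Matrix (Fin n) (Fin n) ℝ} {N : ℕ}

/-- The interpolation error has no boundary contribution to the form `a`. -/
lemma aBilin_sub_nodalProj (hN : 0 < N) (u w : B.Ht 2) :
    aBilin B K₁ K₂ u (w - nodalProj N w) =
      weighted B.Λ_smooth.continuousOn (u.1 2) ((w - nodalProj N w).1 2) := by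
  rw [aBilin_eq_weighted, (val_slope_sub_nodalProj_tip hN w).1,
    (val_slope_sub_nodalProj_tip hN w).2]
  ring

/-- The interpolation error has no boundary contribution to the inner product of `H`. -/
lemma hBilin_sub_nodalProj (hN : 0 < N) (v w : B.Ht 2) :
    hBilin B (w - nodalProj N w) v =
      weighted B.μ_smooth.continuousOn ((w - nodalProj N w).1 0) (v.1 0) := by
  rw [hBilin_eq_weighted, (val_slope_sub_nodalProj_tip hN w).1,
    (val_slope_sub_nodalProj_tip hN w).2]
  ring

/-- The rate of change of the energy of `(u_h - u, v_h - ṽ, ζ_h - ζ)` at a fixed time. Testing both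
equations with `v_h - ṽ ∈ W_h`, where `ṽ` is the nodal projection of `v = u_t`, leaves only
interpolation errors and the dissipation of the controllers. -/
lemma energy_deriv_le (hN : 0 < N) {δ₁ δ₂ : ℝ} (hK₁ : K₁.Admissible δ₁) (hK₂ : K₂.Admissible δ₂)
    (hP₁ : K₁.IsWeight δ₁ P₁) (hP₂ : K₂.IsWeight δ₂ P₂) {u v a uh vh ah : B.Ht 2}
    {ζ₁ ζ₂ ζh₁ ζh₂ : Fin n → ℝ} (hvh : vh ∈ hermiteSpace B.L_pos N)
    (h : ∀ w ∈ hermiteSpace B.L_pos N,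
      hBilin B a w + aBilin B K₁ K₂ u w + bForm K₁ K₂ (hat v) (hat w)
        + (K₁.c ⬝ᵥ ζ₁) * slope w B.L + (K₂.c ⬝ᵥ ζ₂) * val w B.L = 0)
    (hh : ∀ w ∈ hermiteSpace B.L_pos N,
      hBilin B ah w + aBilin B K₁ K₂ uh w + bForm K₁ K₂ (hat vh) (hat w)
        + (K₁.c ⬝ᵥ ζh₁) * slope w B.L + (K₂.c ⬝ᵥ ζh₂) * val w B.L = 0) :
    aBilin B K₁ K₂ (uh - u) (vh - v) + hBilin B (ah - nodalProj N a) (vh - nodalProj N v)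
        + matrixBilin P₁ (ζh₁ - ζ₁) ((K₁.A.mulVec ζh₁ + slope vh B.L • K₁.b)
          - (K₁.A.mulVec ζ₁ + slope v B.L • K₁.b))
        + matrixBilin P₂ (ζh₂ - ζ₂) ((K₂.A.mulVec ζh₂ + val vh B.L • K₂.b)
          - (K₂.A.mulVec ζ₂ + val v B.L • K₂.b)) ≤
      -weighted B.Λ_smooth.continuousOn ((uh - u).1 2) ((v - nodalProj N v).1 2)
        + weighted B.μ_smooth.continuousOn ((a - nodalProj N a).1 0)
          ((vh - nodalProj N v).1 0) := by
  have hε : vh - nodalProj N v ∈ hermiteSpace B.L_pos N := sub_mem hvh (nodalProj_mem v)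
  have e1 := h _ hε
  have e2 := hh _ hε
  obtain ⟨t1, t2⟩ := val_slope_sub_nodalProj_tip hN v
  have hLm := right_mem_Icc.2 B.L_pos.le
  have s1 : slope (vh - v) B.L = slope (vh - nodalProj N v) B.L := by
    rw [← slopeCLM_apply hLm] at t2
    rw [← slopeCLM_apply hLm, ← slopeCLM_apply hLm]
    simp only [map_sub] at t2 ⊢
    linarith
  have s2 : val (vh - v) B.L = val (vh - nodalProj N v) B.L := by
    rw [← valCLM_apply hLm] at t1
    rw [← valCLM_apply hLm, ← valCLM_apply hLm]
    simp only [map_sub] at t1 ⊢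
    linarith
  have s1' : slope (vh - v) B.L = slope vh B.L - slope v B.L := map_sub (slopeCLM B.L_pos hLm) _ _
  have s2' : val (vh - v) B.L = val vh B.L - val v B.L := map_sub (valCLM B.L_pos hLm) _ _
  have m1 : (K₁.A.mulVec ζh₁ + slope vh B.L • K₁.b) - (K₁.A.mulVec ζ₁ + slope v B.L • K₁.b) =
      K₁.A.mulVec (ζh₁ - ζ₁) + slope (vh - v) B.L • K₁.b := by
    rw [Matrix.mulVec_sub, s1', sub_smul]; abel
  have m2 : (K₂.A.mulVec ζh₂ + val vh B.L • K₂.b) - (K₂.A.mulVec ζ₂ + val v B.L • K₂.b) =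
      K₂.A.mulVec (ζh₂ - ζ₂) + val (vh - v) B.L • K₂.b := by
    rw [Matrix.mulVec_sub, s2', sub_smul]; abel
  have d1 := hP₁.dissipation hK₁.δ_pos.le hK₁.δ_le (ζh₁ - ζ₁) (slope (vh - v) B.L)
  have d2 := hP₂.dissipation hK₂.δ_pos.le hK₂.δ_le (ζh₂ - ζ₂) (val (vh - v) B.L)
  have a1 : aBilin B K₁ K₂ (uh - u) (vh - v) =
      aBilin B K₁ K₂ uh (vh - nodalProj N v) - aBilin B K₁ K₂ u (vh - nodalProj N v)
        - aBilin B K₁ K₂ (uh - u) (v - nodalProj N v) := by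
    simp only [map_sub, sub_apply]; ring
  have a2 : hBilin B (ah - nodalProj N a) (vh - nodalProj N v) =
      hBilin B ah (vh - nodalProj N v) - hBilin B a (vh - nodalProj N v)
        + hBilin B (a - nodalProj N a) (vh - nodalProj N v) := by
    simp only [map_sub, sub_apply]; ring
  have f1 : K₁.c ⬝ᵥ (ζh₁ - ζ₁) = K₁.c ⬝ᵥ ζh₁ - K₁.c ⬝ᵥ ζ₁ := dotProduct_sub _ _ _
  have f2 : K₂.c ⬝ᵥ (ζh₂ - ζ₂) = K₂.c ⬝ᵥ ζh₂ - K₂.c ⬝ᵥ ζ₂ := dotProduct_sub _ _ _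
  have b1 : bForm K₁ K₂ (hat vh) (hat (vh - nodalProj N v)) -
      bForm K₁ K₂ (hat v) (hat (vh - nodalProj N v)) =
      K₁.d * slope (vh - v) B.L * slope (vh - v) B.L
        + K₂.d * val (vh - v) B.L * val (vh - v) B.L := by
    simp only [bForm, hat]
    rw [← s1, ← s2, s1', s2']
    ring
  rw [m1, m2, a1, a2, ← hBilin_sub_nodalProj hN, ← aBilin_sub_nodalProj hN (K₁ := K₁) (K₂ := K₂)]
  rw [f1] at d1
  rw [f2] at d2
  rw [← s1, ← s2] at e1 e2
  linarith

/-- The energy of the displacement part of an interpolation error. -/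
lemma sqrt_energy_nodalProj_sub_le (hN : 0 < N) {C : ℝ} (hC0 : 0 ≤ C)
    (hC : ∀ x ∈ Icc 0 B.L, |B.Λ x| ≤ C) (u : B.Ht 4) :
    Real.sqrt (energy B K₁ K₂ P₁ P₂ (nodalProj N (toH2 u) - toH2 u) 0 0 0) ≤
      Real.sqrt C * (meshSize B.L N ^ 2 * ‖u‖) := by
  set w := toH2 u
  have h1 := abs_integral_weight_le hC ((w - nodalProj N w).1 2) ((w - nodalProj N w).1 2)
  rw [← weighted_apply B.Λ_smooth.continuousOn] at h1
  have h2 := (norm_sub_nodalProj_two_le hN u).trans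
    (mul_le_mul_of_nonneg_left (norm_jet_le 4 u) (sq_nonneg _))
  have e : energy B K₁ K₂ P₁ P₂ (nodalProj N w - w) 0 0 0 =
      1 / 2 * weighted B.Λ_smooth.continuousOn ((w - nodalProj N w).1 2)
        ((w - nodalProj N w).1 2) := by
    rw [energy_eq, ← aBilin_sub_nodalProj hN (K₁ := K₁) (K₂ := K₂), ← neg_sub w (nodalProj N w)]
    simp
    ring
  rw [e]
  refine Real.sqrt_le_iff.2 ⟨by positivity, ?_⟩
  rw [mul_pow, Real.sq_sqrt hC0]
  have h3 := mul_le_mul h2 h2 (norm_nonneg _) (by positivity)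
  have h4 := mul_le_mul_of_nonneg_left h3 hC0
  nlinarith [le_abs_self (weighted B.Λ_smooth.continuousOn ((w - nodalProj N w).1 2)
    ((w - nodalProj N w).1 2)), norm_nonneg ((w - nodalProj N w).1 2)]

/-- The energy of the velocity part of an interpolation error. -/
lemma sqrt_energy_zero_nodalProj_sub_le (hN : 0 < N) {C : ℝ} (hC0 : 0 ≤ C)
    (hC : ∀ x ∈ Icc 0 B.L, |B.μ x| ≤ C) (v : B.Ht 2) :
    Real.sqrt (energy B K₁ K₂ P₁ P₂ 0 (nodalProj N v - v) 0 0) ≤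
      Real.sqrt C * (meshSize B.L N ^ 2 * ‖v‖) := by
  have h1 := abs_integral_weight_le hC ((v - nodalProj N v).1 0) ((v - nodalProj N v).1 0)
  rw [← weighted_apply B.μ_smooth.continuousOn] at h1
  have h2 := (norm_sub_nodalProj_zero_le hN v).trans
    (mul_le_mul_of_nonneg_left (norm_jet_le 2 v) (sq_nonneg _))
  have e : energy B K₁ K₂ P₁ P₂ 0 (nodalProj N v - v) 0 0 =
      1 / 2 * weighted B.μ_smooth.continuousOn ((v - nodalProj N v).1 0)
        ((v - nodalProj N v).1 0) := by
    rw [energy_eq, ← hBilin_sub_nodalProj hN, ← neg_sub v (nodalProj N v)]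
    simp
    ring
  rw [e]
  refine Real.sqrt_le_iff.2 ⟨by positivity, ?_⟩
  rw [mul_pow, Real.sq_sqrt hC0]
  have h3 := mul_le_mul h2 h2 (norm_nonneg _) (by positivity)
  have h4 := mul_le_mul_of_nonneg_left h3 hC0
  nlinarith [le_abs_self (weighted B.μ_smooth.continuousOn ((v - nodalProj N v).1 0)
    ((v - nodalProj N v).1 0)), norm_nonneg ((v - nodalProj N v).1 0)]

/-- The interpolation errors in `energy_deriv_le` are bounded by the square root of the energy. -/
lemma interpolation_power_le (hN : 0 < N) (hk₁ : 0 < K₁.k) (hk₂ : 0 < K₂.k) (hP₁ : P₁.PosDef)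
    (hP₂ : P₂.PosDef) {c C d D : ℝ} (hc0 : 0 < c) (hd0 : 0 < d)
    (hc : ∀ x ∈ Icc 0 B.L, c ≤ B.Λ x) (hC : ∀ x ∈ Icc 0 B.L, |B.Λ x| ≤ C)
    (hd : ∀ x ∈ Icc 0 B.L, d ≤ B.μ x) (hD : ∀ x ∈ Icc 0 B.L, |B.μ x| ≤ D)
    (U ε a : B.Ht 2) (v : B.Ht 4) (ζ₁ ζ₂ : Fin n → ℝ) :
    -weighted B.Λ_smooth.continuousOn (U.1 2) ((toH2 v - nodalProj N (toH2 v)).1 2)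
        + weighted B.μ_smooth.continuousOn ((a - nodalProj N a).1 0) (ε.1 0) ≤
      2 * ((C / Real.sqrt c + D / Real.sqrt d) * meshSize B.L N ^ 2 * (‖v‖ + ‖a‖)) *
        Real.sqrt (energy B K₁ K₂ P₁ P₂ U ε ζ₁ ζ₂) := by
  have h0 : (0 : ℝ) ∈ Icc 0 B.L := left_mem_Icc.2 B.L_pos.le
  have hC0 : 0 ≤ C := (abs_nonneg _).trans (hC 0 h0)
  have hD0 : 0 ≤ D := (abs_nonneg _).trans (hD 0 h0)
  set E := energy B K₁ K₂ P₁ P₂ U ε ζ₁ ζ₂ with hE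
  have q1 := mul_norm_sq_le_aBilin hk₁ hk₂ hc U
  have q2 := mul_norm_sq_le_hBilin hd ε
  have q3 := aBilin_self_nonneg hk₁ hk₂ U
  have q4 := hBilin_self_nonneg ε
  have q5 := matrixBilin_self_nonneg hP₁ ζ₁
  have q6 := matrixBilin_self_nonneg hP₂ ζ₂
  have hE' := energy_eq K₁ K₂ P₁ P₂ U ε ζ₁ ζ₂
  rw [← hE] at hE'
  have hsE := Real.sqrt_nonneg E
  have hE2 : Real.sqrt E ^ 2 = E := Real.sq_sqrt (energy_nonneg hk₁ hk₂ hP₁ hP₂ U ε ζ₁ ζ₂)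
  have hsc : 0 < Real.sqrt c := Real.sqrt_pos.2 hc0
  have hsd : 0 < Real.sqrt d := Real.sqrt_pos.2 hd0
  have n1 : ‖U.1 2‖ ≤ 2 * Real.sqrt E / Real.sqrt c := by
    rw [le_div_iff₀ hsc]
    refine (sq_le_sq₀ (by positivity) (by positivity)).1 ?_
    rw [mul_pow, mul_pow, Real.sq_sqrt hc0.le, hE2]
    linarith
  have n2 : ‖ε.1 0‖ ≤ 2 * Real.sqrt E / Real.sqrt d := by
    rw [le_div_iff₀ hsd]
    refine (sq_le_sq₀ (by positivity) (by positivity)).1 ?_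
    rw [mul_pow, mul_pow, Real.sq_sqrt hd0.le, hE2]
    linarith
  set h2 := meshSize B.L N ^ 2 with hh2
  have hh0 : 0 ≤ h2 := sq_nonneg _
  have i1 : ‖(toH2 v - nodalProj N (toH2 v)).1 2‖ ≤ h2 * (‖v‖ + ‖a‖) :=
    (norm_sub_nodalProj_two_le hN v).trans (mul_le_mul_of_nonneg_left
      ((norm_jet_le 4 v).trans (le_add_of_nonneg_right (norm_nonneg _))) hh0)
  have i2 : ‖(a - nodalProj N a).1 0‖ ≤ h2 * (‖v‖ + ‖a‖) :=
    (norm_sub_nodalProj_zero_le hN a).trans (mul_le_mul_of_nonneg_left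
      ((norm_jet_le 2 a).trans (le_add_of_nonneg_left (norm_nonneg _))) hh0)
  have w1 := abs_integral_weight_le hC (U.1 2) ((toH2 v - nodalProj N (toH2 v)).1 2)
  have w2 := abs_integral_weight_le hD ((a - nodalProj N a).1 0) (ε.1 0)
  rw [← weighted_apply B.Λ_smooth.continuousOn] at w1
  rw [← weighted_apply B.μ_smooth.continuousOn] at w2
  have z1 : C * ‖U.1 2‖ * ‖(toH2 v - nodalProj N (toH2 v)).1 2‖ ≤
      C * (2 * Real.sqrt E / Real.sqrt c) * (h2 * (‖v‖ + ‖a‖)) := by gcongr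
  have z2 : D * ‖(a - nodalProj N a).1 0‖ * ‖ε.1 0‖ ≤
      D * (h2 * (‖v‖ + ‖a‖)) * (2 * Real.sqrt E / Real.sqrt d) := by gcongr
  calc _ ≤ C * (2 * Real.sqrt E / Real.sqrt c) * (h2 * (‖v‖ + ‖a‖))
        + D * (h2 * (‖v‖ + ‖a‖)) * (2 * Real.sqrt E / Real.sqrt d) :=
      add_le_add ((neg_le_abs _).trans (w1.trans z1)) ((le_abs_self _).trans (w2.trans z2))
    _ = _ := by ring

lemma exists_bounds_of_pos {L : ℝ} {m : ℝ → ℝ} (hL : 0 < L) (hm : ContinuousOn m (Icc 0 L))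
    (hpos : ∀ x ∈ Icc 0 L, 0 < m x) :
    ∃ c C, 0 < c ∧ 0 < C ∧ (∀ x ∈ Icc 0 L, c ≤ m x) ∧ ∀ x ∈ Icc 0 L, |m x| ≤ C := by
  have hne : (Icc 0 L).Nonempty := ⟨0, left_mem_Icc.2 hL.le⟩
  obtain ⟨x, hx, hmin⟩ := isCompact_Icc.exists_isMinOn hne hm
  obtain ⟨y, hy, hmax⟩ := isCompact_Icc.exists_isMaxOn hne hm
  exact ⟨m x, m y, hpos x hx, hpos y hy, fun z hz => hmin hz, fun z hz => by
    rw [abs_of_pos (hpos z hz)]; exact hmax hz⟩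

end ErrorEnergy

/-! ### The error estimate -/

section ErrorEstimate

variable {n : ℕ} {B : Beam} {K₁ K₂ : Controller n} {P₁ P₂ : Matrix (Fin n) (Fin n) ℝ} {N : ℕ}
  {T : ℝ}

/-- A regular solution is continuously differentiable in time as a function with values in `H̃²_0`:
`u_t` has a continuous representative there, because `u_t` and `u_tt` are integrable. -/
lemma HasRegularity.exists_isPrimitiveOn (hT : 0 < T) {u u_t : ℝ → B.Ht 4} {u_tt : ℝ → B.Ht 2}
    (h : HasRegularity B T u u_t u_tt) :
    ∃ v : ℝ → B.Ht 2, IsPrimitiveOn T (fun t => toH2 (u t)) v ∧ IsPrimitiveOn T v u_tt ∧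
      v =ᵐ[vol T] fun t => toH2 (u_t t) := by
  obtain ⟨huc, hut, hu, hutt, hv⟩ := h
  have i1 : Integrable u_t (vol T) := hut.integrable one_le_two
  obtain ⟨v, hv1, hv2⟩ := hv.exists_isPrimitiveOn hT ((toH2CLM B.L_pos).integrable_comp i1)
    (hutt.integrable one_le_two)
  refine ⟨v, ?_, hv1, hv2⟩
  exact ((hu.isPrimitiveOn hT huc i1).clm (toH2CLM B.L_pos)).congr_right hv2.symm

/-- Bound on the continuous representative `v` of `u_t`, uniformly in time. -/
lemma norm_velocity_le (hT : 0 < T) {u_t : ℝ → B.Ht 4} {v u_tt : ℝ → B.Ht 2}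
    (hut : MemLp u_t 2 (vol T)) (hutt : MemLp u_tt 2 (vol T)) (h : IsPrimitiveOn T v u_tt)
    (hv : v =ᵐ[vol T] fun t => toH2 (u_t t)) {t : ℝ} (ht : t ∈ Icc 0 T) :
    ‖v t‖ ≤ (1 / T + 1) * Real.sqrt T * (lpNorm u_tt 2 (vol T) + lpNorm u_t 2 (vol T)) := by
  have h1 := norm_le_integral_norm hT h ht
  have h2 : ∫ s in (0 : ℝ)..T, ‖v s‖ ≤ ∫ s in (0 : ℝ)..T, ‖u_t s‖ := by
    rw [← integral_Ioo_eq_intervalIntegral hT.le, ← integral_Ioo_eq_intervalIntegral hT.le]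
    have i1 : Integrable u_t (vol T) := hut.integrable one_le_two
    have i2 : Integrable v (vol T) :=
      ((toH2CLM B.L_pos).integrable_comp i1).congr hv.symm
    refine integral_mono_ae i2.norm i1.norm ?_
    filter_upwards [hv] with s hs
    rw [hs]
    exact norm_toH2_le _
  have h3 := integral_norm_le_sqrt_mul_lpNorm hT.le hut
  have h4 := integral_norm_le_sqrt_mul_lpNorm hT.le hutt
  have h5 : 0 ≤ 1 / T := by positivity
  have h6 := mul_le_mul_of_nonneg_left (h2.trans h3) h5
  have h7 : 0 ≤ 1 / T * (Real.sqrt T * lpNorm u_tt 2 (vol T)) :=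
    mul_nonneg h5 (mul_nonneg (Real.sqrt_nonneg T) lpNorm_nonneg)
  have h8 : 0 ≤ Real.sqrt T * lpNorm u_t 2 (vol T) := mul_nonneg (Real.sqrt_nonneg T) lpNorm_nonneg
  linarith

/-- The energy of `(u_h - u, u_h' - ũ_t)`, in which the velocity error is a finite element
function, grows at most by the interpolation errors. -/
lemma sqrt_energy_discrete_error_le (hT : 0 < T) (hN : 0 < N) {δ₁ δ₂ : ℝ}
    (hK₁ : K₁.Admissible δ₁) (hK₂ : K₂.Admissible δ₂)
    (hP₁ : K₁.IsWeight δ₁ P₁) (hP₂ : K₂.IsWeight δ₂ P₂) {c C d D : ℝ} (hc0 : 0 < c) (hd0 : 0 < d)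
    (hc : ∀ x ∈ Icc 0 B.L, c ≤ B.Λ x) (hC : ∀ x ∈ Icc 0 B.L, |B.Λ x| ≤ C)
    (hd : ∀ x ∈ Icc 0 B.L, d ≤ B.μ x) (hD : ∀ x ∈ Icc 0 B.L, |B.μ x| ≤ D)
    {u v u_tt : ℝ → B.Ht 2} {u_t : ℝ → B.Ht 4} {ζ₁ ζ₂ : ℝ → Fin n → ℝ}
    {u₀ : B.Ht 2} {v₀ : PivotH B} {ζ₁₀ ζ₂₀ : Fin n → ℝ}
    (hw : IsWeakSolution B K₁ K₂ T u ζ₁ ζ₂ u₀ v₀ ζ₁₀ ζ₂₀)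
    (hut : MemLp u_t 2 (vol T)) (hutt : MemLp u_tt 2 (vol T))
    (hu : IsPrimitiveOn T u v) (hv : IsPrimitiveOn T v u_tt)
    (hvu : v =ᵐ[vol T] fun t => toH2 (u_t t))
    {uh vh ah : ℝ → B.Ht 2} {ζh₁ ζh₂ : ℝ → Fin n → ℝ}
    (huh : IsPrimitiveOn T uh vh) (hvh : IsPrimitiveOn T vh ah)
    (hmem : ∀ t, 0 ≤ t → vh t ∈ hermiteSpace B.L_pos N)
    (hG : ∀ t, 0 < t → ∀ w ∈ hermiteSpace B.L_pos N,
      hBilin B (ah t) w + aBilin B K₁ K₂ (uh t) w + bForm K₁ K₂ (hat (vh t)) (hat w)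
        + (K₁.c ⬝ᵥ ζh₁ t) * slope w B.L + (K₂.c ⬝ᵥ ζh₂ t) * val w B.L = 0)
    (hζ₁ : IsPrimitiveOn T ζh₁ fun t => K₁.A.mulVec (ζh₁ t) + slope (vh t) B.L • K₁.b)
    (hζ₂ : IsPrimitiveOn T ζh₂ fun t => K₂.A.mulVec (ζh₂ t) + val (vh t) B.L • K₂.b)
    {t : ℝ} (ht : t ∈ Icc 0 T) :
    Real.sqrt (energy B K₁ K₂ P₁ P₂ (uh t - u t) (vh t - nodalProj N (v t))
        (ζh₁ t - ζ₁ t) (ζh₂ t - ζ₂ t)) ≤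
      Real.sqrt (energy B K₁ K₂ P₁ P₂ (uh 0 - u 0) (vh 0 - nodalProj N (v 0))
        (ζh₁ 0 - ζ₁ 0) (ζh₂ 0 - ζ₂ 0)) +
      2 * ((C / Real.sqrt c + D / Real.sqrt d) * meshSize B.L N ^ 2 *
        (Real.sqrt T * (lpNorm u_tt 2 (vol T) + lpNorm u_t 2 (vol T)))) := by
  obtain ⟨hGw, hz₁, hz₂⟩ := hw.strong hT hu hv N
  have h0 : (0 : ℝ) ∈ Icc 0 B.L := left_mem_Icc.2 B.L_pos.le
  have hC0 : 0 ≤ C := (abs_nonneg _).trans (hC 0 h0)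
  have hD0 : 0 ≤ D := (abs_nonneg _).trans (hD 0 h0)
  set κ := (C / Real.sqrt c + D / Real.sqrt d) * meshSize B.L N ^ 2 with hκ
  have hκ0 : 0 ≤ κ := by positivity
  have hp : IsPrimitiveOn T (fun t => nodalProj N (v t)) fun t => nodalProj N (u_tt t) := by
    simpa only [nodalCLM_apply] using hv.clm (nodalCLM B.L_pos N)
  have hE := isPrimitiveOn_energy (B := B) (K₁ := K₁) (K₂ := K₂) hP₁.1 hP₂.1 (huh.sub hu)
    (hvh.sub hp) (hζ₁.sub hz₁) (hζ₂.sub hz₂)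
  have i1 : Integrable (fun t => ‖u_t t‖) (vol T) := (hut.integrable one_le_two).norm
  have i2 : Integrable (fun t => ‖u_tt t‖) (vol T) := (hutt.integrable one_le_two).norm
  have key := sqrt_le_of_deriv_le hE
    (fun t _ => energy_nonneg hK₁.k_pos hK₂.k_pos hP₁.1 hP₂.1 _ _ _ _)
    (g := fun t => κ * (‖u_t t‖ + ‖u_tt t‖)) ((i1.add i2).const_mul κ)
    (fun t => by positivity) ?_ ht
  · refine key.trans (add_le_add_right ?_ _)
    rw [intervalIntegral.integral_const_mul,
      intervalIntegral.integral_add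
        (intervalIntegrable_of_vol i1 (left_mem_Icc.2 hT.le) (right_mem_Icc.2 hT.le))
        (intervalIntegrable_of_vol i2 (left_mem_Icc.2 hT.le) (right_mem_Icc.2 hT.le))]
    have h3 := integral_norm_le_sqrt_mul_lpNorm hT.le hut
    have h4 := integral_norm_le_sqrt_mul_lpNorm hT.le hutt
    refine mul_le_mul_of_nonneg_left (mul_le_mul_of_nonneg_left ?_ hκ0) zero_le_two
    linarith
  · filter_upwards [hGw, hvu, ae_restrict_mem measurableSet_Ioo] with s hs hvs hsT
    refine (energy_deriv_le hN hK₁ hK₂ hP₁ hP₂ (hmem s hsT.1.le) hs (hG s hsT.1)).trans ?_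
    have := interpolation_power_le hN hK₁.k_pos hK₂.k_pos hP₁.1 hP₂.1 hc0 hd0 hc hC hd hD
      (uh s - u s) (vh s - nodalProj N (v s)) (u_tt s) (u_t s) (ζh₁ s - ζ₁ s) (ζh₂ s - ζ₂ s)
    rwa [← show v s = toH2 (u_t s) from hvs] at this

end ErrorEstimate

end BeamFEM

end

open BeamFEM
theorem mainTheorem5 {n : ℕ} (B : Beam) (K₁ K₂ : Controller n) (δ₁ δ₂ : ℝ)
    (hK₁ : K₁.Admissible δ₁) (hK₂ : K₂.Admissible δ₂)
    (P₁ P₂ : Matrix (Fin n) (Fin n) ℝ) (hP₁ : K₁.IsWeight δ₁ P₁) (hP₂ : K₂.IsWeight δ₂ P₂)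
    (T : ℝ) (hT : 0 < T) :
    ∃ C : ℝ, 0 < C ∧ ∀ (N : ℕ), 0 < N →
      -- the weak solution and its regularity
      ∀ (u u_t : ℝ → B.Ht 4) (u_tt : ℝ → B.Ht 2) (ζ₁ ζ₂ : ℝ → Fin n → ℝ)
        (u₀ : B.Ht 2) (v₀ : PivotH B) (ζ₁₀ ζ₂₀ : Fin n → ℝ),
      IsWeakSolution B K₁ K₂ T (fun t => toH2 (u t)) ζ₁ ζ₂ u₀ v₀ ζ₁₀ ζ₂₀ →
      HasRegularity B T u u_t u_tt →
      -- the semi-discrete solution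
      ∀ (uh : ℝ → B.Ht 2) (ζh₁ ζh₂ : ℝ → Fin n → ℝ) (uh₀ vh₀ : B.Ht 2) (ζh₁₀ ζh₂₀ : Fin n → ℝ),
      IsSemidiscreteSolution B K₁ K₂ N uh ζh₁ ζh₂ uh₀ vh₀ ζh₁₀ ζh₂₀ →
      -- the time derivative entering the energy of the error exists at every time
      DifferentiableOn ℝ (fun t => toH2 (u t)) (Icc 0 T) ∧
      ∀ t ∈ Icc 0 T,
        Real.sqrt (energyAt B K₁ K₂ P₁ P₂ T (fun s => uh s - toH2 (u s))
            (fun s => ζh₁ s - ζ₁ s) (fun s => ζh₂ s - ζ₂ s) t)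
          ≤ C * (Real.sqrt (energyAt B K₁ K₂ P₁ P₂ T (fun s => uh s - nodalProj N (toH2 (u s)))
                (fun s => ζh₁ s - ζ₁ s) (fun s => ζh₂ s - ζ₂ s) 0)
            + meshSize B.L N ^ 2 *
              (lpNorm u_tt 2 (vol T) + lpNorm u_t 2 (vol T) + ⨆ s : Icc 0 T, ‖u s‖)) := by
  obtain ⟨c, C, hc0, hC0, hc, hC⟩ :=
    exists_bounds_of_pos B.L_pos B.Λ_smooth.continuousOn B.Λ_pos
  obtain ⟨d, D, hd0, hD0, hd, hD⟩ :=
    exists_bounds_of_pos B.L_pos B.μ_smooth.continuousOn B.μ_pos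
  set κ := C / Real.sqrt c + D / Real.sqrt d with hκ
  have hκ0 : 0 ≤ κ := by positivity
  refine ⟨4 + 4 * Real.sqrt C + (4 * κ + 2 * Real.sqrt D * (1 / T + 1)) * Real.sqrt T,
    by positivity, ?_⟩
  intro N hN u u_t u_tt ζ₁ ζ₂ u₀ v₀ ζ₁₀ ζ₂₀ hw hr uh ζh₁ ζh₂ uh₀ vh₀ ζh₁₀ ζh₂₀ hs
  obtain ⟨v, hu, hv, hvu⟩ := hr.exists_isPrimitiveOn hT
  obtain ⟨vh, ah, huh, hvh, hmem, hG, hζ₁, hζ₂⟩ := hs.strong (T := T)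
  obtain ⟨huc, hut, -, hutt, -⟩ := hr
  have du : ∀ t ∈ Icc 0 T, HasDerivWithinAt (fun t => toH2 (u t)) (v t) (Icc 0 T) t :=
    fun t ht => hu.hasDerivWithinAt hv.continuousOn ht
  have duh : ∀ t ∈ Icc 0 T, HasDerivWithinAt uh (vh t) (Icc 0 T) t :=
    fun t ht => huh.hasDerivWithinAt hvh.continuousOn ht
  refine ⟨fun t ht => (du t ht).differentiableWithinAt, fun t ht => ?_⟩
  have h0 : (0 : ℝ) ∈ Icc 0 T := left_mem_Icc.2 hT.le
  have hd1 : derivWithin (fun s => uh s - toH2 (u s)) (Icc 0 T) t = vh t - v t :=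
    ((duh t ht).fun_sub (du t ht)).derivWithin (uniqueDiffOn_Icc hT t ht)
  have hd2 : derivWithin (fun s => uh s - nodalProj N (toH2 (u s))) (Icc 0 T) 0 =
      vh 0 - nodalProj N (v 0) := by
    have := (duh 0 h0).fun_sub
      ((nodalCLM B.L_pos N).hasFDerivAt.comp_hasDerivWithinAt 0 (du 0 h0))
    simp only [Function.comp_apply, nodalCLM_apply] at this
    exact this.derivWithin (uniqueDiffOn_Icc hT 0 h0)
  rw [energyAt, energyAt, hd1, hd2]
  have e1 := sqrt_energy_discrete_error_le hT hN hK₁ hK₂ hP₁ hP₂ hc0 hd0 hc hC hd hD hw hut hutt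
    hu hv hvu huh hvh hmem hG hζ₁ hζ₂ ht
  -- `ũ` in place of `u` in the initial displacement
  have e2 := sqrt_energy_add_le hK₁.k_pos hK₂.k_pos hP₁.1 hP₂.1 (uh 0 - nodalProj N (toH2 (u 0)))
    (vh 0 - nodalProj N (v 0)) (nodalProj N (toH2 (u 0)) - toH2 (u 0)) 0
    (ζh₁ 0 - ζ₁ 0) (ζh₂ 0 - ζ₂ 0)
  -- `u_t` in place of `ũ_t` in the velocity at time `t`
  have e3 := sqrt_energy_add_le hK₁.k_pos hK₂.k_pos hP₁.1 hP₂.1 (uh t - toH2 (u t))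
    (vh t - nodalProj N (v t)) 0 (nodalProj N (v t) - v t) (ζh₁ t - ζ₁ t) (ζh₂ t - ζ₂ t)
  rw [sub_add_sub_cancel, add_zero] at e2 e3
  have e4 := sqrt_energy_nodalProj_sub_le (K₁ := K₁) (K₂ := K₂) (P₁ := P₁) (P₂ := P₂) hN hC0.le hC
    (u 0)
  have e5 := sqrt_energy_zero_nodalProj_sub_le (K₁ := K₁) (K₂ := K₂) (P₁ := P₁) (P₂ := P₂) hN
    hD0.le hD (v t)
  have e6 := norm_velocity_le hT hut hutt hv hvu ht
  have e7 : ‖u 0‖ ≤ ⨆ s : Icc 0 T, ‖u s‖ := by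
    have hb : BddAbove (range fun s : Icc 0 T => ‖u s‖) := by
      have := (isCompact_Icc.image_of_continuousOn huc.norm).bddAbove
      rwa [image_eq_range] at this
    exact le_ciSup hb ⟨0, h0⟩
  rw [← hκ] at e1
  set S := ⨆ s : Icc 0 T, ‖u s‖
  set E := Real.sqrt (energy B K₁ K₂ P₁ P₂ (uh 0 - nodalProj N (toH2 (u 0)))
    (vh 0 - nodalProj N (v 0)) (ζh₁ 0 - ζ₁ 0) (ζh₂ 0 - ζ₂ 0))
  set q := lpNorm u_tt 2 (vol T) + lpNorm u_t 2 (vol T)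
  set h2 := meshSize B.L N ^ 2
  have hE : 0 ≤ E := Real.sqrt_nonneg _
  have hq : 0 ≤ q := add_nonneg lpNorm_nonneg lpNorm_nonneg
  have hh : 0 ≤ h2 := sq_nonneg _
  have hS : 0 ≤ S := (norm_nonneg _).trans e7
  have hsC := Real.sqrt_nonneg C
  have hsD := Real.sqrt_nonneg D
  have hsT := Real.sqrt_nonneg T
  have e4' := e4.trans (mul_le_mul_of_nonneg_left (mul_le_mul_of_nonneg_left e7 hh) hsC)
  have e5' := e5.trans (mul_le_mul_of_nonneg_left (mul_le_mul_of_nonneg_left e6 hh) hsD)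
  set R := (4 * κ + 2 * Real.sqrt D * (1 / T + 1)) * Real.sqrt T with hR
  have hR0 : 0 ≤ R := by positivity
  calc _ ≤ 4 * E + 4 * Real.sqrt C * (h2 * S) + R * (h2 * q) := by rw [hR]; linarith
    _ ≤ (4 + 4 * Real.sqrt C + R) * E + (4 + 4 * Real.sqrt C + R) * (h2 * S)
        + (4 + 4 * Real.sqrt C + R) * (h2 * q) := by gcongr <;> linarith
    _ = _ := by ring
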